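/- **Conventions.** Let $q$ be a power of an odd prime and let $M$ be a multiplication time for $\mathbb F_q[x]$: for every $m\ge 1$, polynomials in $\mathbb F_q[x]$ of degree less than $m$ can be multiplied using at most $M(m)$ operations in $\mathbb F_q$, and for all $m,m'\ge 1$ one has $M(m)/m\le M(m')/m'$ if $m\le m'$, $M(mm')\le m^2M(m')$, and $M(m)\ge m$. Costs are numbers of arithmetic operations $+,-,\times,/$ in $\mathbb F_q$, in the model of algebraic computation trees over $\mathbb F_q$: constants of $\mathbb F_q$ (hence precomputations that depend only on the tower below) and branching on whether a computed element is zero are not counted. Let $\ell$ be a prime and let $\mathbb F_q=F_0\subset F_1\subset F_2\subset\cdots$ be a Kummer tower for $\ell$. That is, $F_1=\mathbb F_q[x]/(P_1)$, where $P_1$ is monic and irreducible, $\deg P_1$ divides $\ell-1$, $\ell$ divides $\#F_1-1$, and the class of $x$ is not an $\ell$-th power in $F_1$ (for example, $P_1$ is primitive); and $F_i=\mathbb F_q[x]/\bigl(P_1(x^{\ell^{i-1}})\bigr)$ for $i\ge1$. If $\ell=2$ and $q\equiv 3\pmod 4$, one takes instead $F_1=F_0$ and $F_i=\mathbb F_q[x]/\bigl(P_2(x^{2^{i-2}})\bigr)$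 for $i\ge 2$, where $P_2$ is monic, irreducible and quadratic, and the class of $x$ is not a square in $F_2=\mathbb F_q[x]/(P_2)$. An element of $F_n$ is given by the coefficients of the polynomial of degree less than $[F_n:\mathbb F_q]$ that represents it. **Proposition.** Let $n,s\ge1$, and let $(v_1,w_1),\dots,(v_s,w_s)$ be pairs of elements of $F_n$ such that the minimal polynomials over $\mathbb F_q$ of $v_1,\dots,v_s$ are pairwise distinct and $w_i\in\mathbb F_q(v_i)$ for all $i$. Let $t_i$ be the degree of the minimal polynomial of $v_i$, and let $t=\sum_i t_i$. Then the polynomials * $T\in\mathbb F_q[x]$, monic of degree $t$, such that $T(v_i)=0$ for all $i$, and * $L\in\mathbb F_q[x]$, of degree less than $t$, such that $L(v_i)=w_i$ for all $i$, exist and can be computed from the pairs $(v_i,w_i)$ using $$O\bigl(M(t)\log s+n\,M(\ell^2t)\log \ell\bigr)$$ operations in $\mathbb F_q$. More precisely, there is an absolute constant $C>0$ such that, for all $q$, $M$, $\ell$, all Kummer towers and all $n,s\ge 1$, a single computation tree computes $T$ and $L$ from every such family of $s$ pairs, using at most $C\bigl(M(t)\log s+n\,M(\ell^2t)\log \ell\bigr)$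 operations. -/

import Mathlib

universe u

/-- The four arithmetic operations of a field. -/
inductive ArithOp where
  | add
  | sub
  | mul
  | div

/-- The value of an arithmetic operation. -/
def ArithOp.eval {F : Type*} [Field F] : ArithOp → F → F → F
  | .add, a, b => a + b
  | .sub, a, b => a - b
  | .mul, a, b => a * b
  | .div, a, b => a / b

/-- Algebraic computation trees over `F`. An element of `Program F V` is a program that may use the
values named by the elements of `V`: it stores a constant of `F`, or the result of an arithmetic
operation on two stored values, under the new name `none`; it branches on whether a stored value is
zero; and it ends by listing stored values as its output. -/
inductive Program (F : Type u) : Type → Type (max u 1)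
  | output {V : Type} (r : List V) : Program F V
  | const {V : Type} (c : F) (next : Program F (Option V)) : Program F V
  | arith {V : Type} (o : ArithOp) (a b : V) (next : Program F (Option V)) : Program F V
  | ifZero {V : Type} (a : V) (yes no : Program F V) : Program F V

/-- Add the value `c`, under the name `none`, to the stored values `env`. -/
def extendEnv {F : Type*} {V : Type} (env : V → F) (c : F) : Option V → F
  | none => c
  | some a => env a

/-- `P.Runs env out k`: started on the values `env`, the program `P` performs exactly `k` arithmetic
operations in `F`, never divides by zero, and outputs the list `out`. -/
def Program.Runs {F : Type*} [Field F] :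
    {V : Type} → Program F V → (V → F) → List F → ℕ → Prop
  | _, .output r, env, out, k => out = r.map env ∧ k = 0
  | _, .const c next, env, out, k => next.Runs (extendEnv env c) out k
  | _, .arith o a b next, env, out, k =>
      (o = ArithOp.div → env b ≠ 0) ∧
        ∃ k', k = k' + 1 ∧ next.Runs (extendEnv env (o.eval (env a) (env b))) out k'
  | _, .ifZero a yes no, env, out, k =>
      (env a = 0 → yes.Runs env out k) ∧ (env a ≠ 0 → no.Runs env out k)

/-- The list of the coefficients of `1, x, …, x ^ (n - 1)` in the polynomial `f`. -/
def coeffList {F : Type*} [Field F] (n : ℕ) (f : Polynomial F) : List F :=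
  (List.range n).map f.coeff

/-- The polynomial with coefficients `a 0, …, a (n - 1)`. -/
noncomputable def polyOfCoeffs {F : Type*} [Field F] {n : ℕ} (a : Fin n → F) : Polynomial F :=
  ∑ i : Fin n, Polynomial.C (a i) * Polynomial.X ^ (i : ℕ)

/-- `M` is a multiplication time for `F[x]` with the usual regularity assumptions:
polynomials of degree less than `n` can be multiplied using at most `M n` operations in `F`,
`M n / n` is nondecreasing, `M` grows at most quadratically, and `n ≤ M n`. -/
structure IsMultiplicationTime (F : Type*) [Field F] (M : ℕ → ℝ) : Prop where
  mul : ∀ n : ℕ, 1 ≤ n → ∃ P : Program F (Fin n ⊕ Fin n), ∀ a b : Fin n → F, ∃ k : ℕ,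
    P.Runs (Sum.elim a b) (coeffList (2 * n - 1) (polyOfCoeffs a * polyOfCoeffs b)) k ∧
      (k : ℝ) ≤ M n
  superlinear : ∀ m n : ℕ, 1 ≤ m → m ≤ n → M m / m ≤ M n / n
  quadratic : ∀ m n : ℕ, 1 ≤ m → 1 ≤ n → M (m * n) ≤ (m : ℝ) ^ 2 * M n
  le_self : ∀ n : ℕ, 1 ≤ n → (n : ℝ) ≤ M n

/-- The data that define a Kummer tower `F = F₀ ⊆ F₁ ⊆ F₂ ⊆ ⋯` over the finite field `F` for the
prime `ℓ`, where `[F₁ : F₀]` divides `ℓ - 1`, `ℓ` divides `#F₁ - 1`, and `[Fᵢ₊₁ : Fᵢ] = ℓ` for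
`i ≥ 1`.

In general `F₁ = F[x] / P` for a monic irreducible `P` whose root is not an `ℓ`-th power in `F₁`
(for instance, a primitive polynomial `P`), `Fᵢ = F[x] / P(x ^ ℓ ^ (i - 1))`, and the first level is
`1`. If `ℓ = 2` and `#F ≡ 3 mod 4`, then `F₁ = F₀`, `F₂ = F[x] / P` for a monic
irreducible quadratic `P` whose root is not a square in `F₂`, `Fᵢ = F[x] / P(x ^ 2 ^ (i - 2))` for
`i ≥ 2`, and the first level is `2`. In both cases `xᵢ ↦ xᵢ₊₁ ^ ℓ` embeds `Fᵢ` in `Fᵢ₊₁` from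
the first level on. -/
structure KummerTower (F : Type u) [Field F] (ℓ : ℕ) where
  prime : ℓ.Prime
  firstLevel : ℕ
  poly : Polynomial F
  monic : poly.Monic
  irreducible : Irreducible poly
  not_pow : ¬ ∃ y : AdjoinRoot poly, y ^ ℓ = AdjoinRoot.root poly
  shape :
    (firstLevel = 1 ∧ poly.natDegree ∣ ℓ - 1 ∧ ℓ ∣ Nat.card F ^ poly.natDegree - 1 ∧
      (ℓ = 2 → Nat.card F % 4 = 1)) ∨
    (firstLevel = 2 ∧ ℓ = 2 ∧ Nat.card F % 4 = 3 ∧ poly.natDegree = 2)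

namespace KummerTower

variable {F : Type u} [Field F] {ℓ : ℕ}

/-- The polynomial `Pᵢ` with `Fᵢ = F[x] / Pᵢ`; below the first level, `Fᵢ = F[x] / x = F`. -/
noncomputable def modulus (K : KummerTower F ℓ) (i : ℕ) : Polynomial F :=
  if i < K.firstLevel then Polynomial.X
  else Polynomial.expand F (ℓ ^ (i - K.firstLevel)) K.poly

theorem monic_modulus (K : KummerTower F ℓ) (i : ℕ) : (K.modulus i).Monic := by
  unfold modulus
  split_ifs
  · exact Polynomial.monic_X
  · exact (Polynomial.monic_expand_iff (pow_pos K.prime.pos _)).2 K.monic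

/-- The level `Fᵢ` of the tower. -/
abbrev Level (K : KummerTower F ℓ) (i : ℕ) : Type u := AdjoinRoot (K.modulus i)

/-- The degree `[Fᵢ : F]`. -/
noncomputable def levelDegree (K : KummerTower F ℓ) (i : ℕ) : ℕ := (K.modulus i).natDegree

/-- The coordinates of an element of `Fᵢ`: the coefficients of the polynomial of degree less than
`[Fᵢ : F]` that represents it modulo `Pᵢ`. -/
noncomputable def coords (K : KummerTower F ℓ) (i : ℕ) (v : K.Level i) :
    Fin (K.levelDegree i) → F :=
  fun j => (AdjoinRoot.modByMonicHom (K.monic_modulus i) v).coeff j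

end KummerTower

/-- The input that encodes the pairs `(v i, w i)` of elements of `Fₙ` by their coordinates. -/
noncomputable def interpolationInput {F : Type u} [Field F] {ℓ : ℕ} (K : KummerTower F ℓ)
    (n s : ℕ) (v w : Fin s → K.Level n) :
    (Fin s × Fin (K.levelDegree n)) ⊕ (Fin s × Fin (K.levelDegree n)) → F :=
  Sum.elim (fun x => K.coords n (v x.1) x.2) (fun x => K.coords n (w x.1) x.2)

/-- The sum of the degrees of the minimal polynomials over `F` of the elements `v i` of `Fₙ`. -/
noncomputable def totalDegree {F : Type u} [Field F] {ℓ : ℕ} (K : KummerTower F ℓ)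
    (n s : ℕ) (v : Fin s → K.Level n) : ℕ :=
  ∑ i : Fin s, (minpoly F (v i)).natDegree

universe v

section

open Polynomial

/-- `Win out bound X S c`: with the functions in `S` of the input already computed at cost `c`, a
computation tree can output `out` for all inputs in `X` at a total cost of at most `bound`. -/
inductive Win {F : Type u} [Field F] {Ω : Type v} (out : Ω → List F) (bound : Ω → ℝ) :
    Set Ω → Set (Ω → F) → ℝ → Prop
  | output {X : Set Ω} {S : Set (Ω → F)} {c : ℝ} (r : List (Ω → F)) (hr : ∀ f ∈ r, f ∈ S)
      (h : ∀ ω ∈ X, out ω = r.map (fun f => f ω)) (hc : ∀ ω ∈ X, c ≤ bound ω) : Win out bound X S c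
  | const {X : Set Ω} {S : Set (Ω → F)} {c : ℝ} (a : F)
      (h : Win out bound X (insert (fun _ => a) S) c) : Win out bound X S c
  | arith {X : Set Ω} {S : Set (Ω → F)} {c : ℝ} (o : ArithOp) (f g : Ω → F) (hf : f ∈ S)
      (hg : g ∈ S) (hd : o = ArithOp.div → ∀ ω ∈ X, g ω ≠ 0)
      (h : Win out bound X (insert (fun ω => o.eval (f ω) (g ω)) S) (c + 1)) : Win out bound X S c
  | ifZero {X : Set Ω} {S : Set (Ω → F)} {c : ℝ} (f : Ω → F) (hf : f ∈ S)
      (h₁ : Win out bound (X ∩ {ω | f ω = 0}) S c) (h₂ : Win out bound (X ∩ {ω | f ω ≠ 0}) S c) :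
      Win out bound X S c

section Model

variable {F : Type u} [Field F] {Ω : Type v} {out : Ω → List F} {bound : Ω → ℝ}

theorem Win.mono {X : Set Ω} {S : Set (Ω → F)} {c : ℝ} (h : Win out bound X S c) :
    ∀ {X' : Set Ω} {S' : Set (Ω → F)} {c' : ℝ}, X' ⊆ X → (∀ f ∈ S, ∃ g ∈ S', Set.EqOn g f X') →
      c' ≤ c → Win out bound X' S' c' := by
  induction h with
  | output r hr h hc =>
    intro X' S' c' hX hS hc'
    choose! φ hφ hφ' using hS
    refine .output (r.map φ) ?_ ?_ fun ω hω => hc'.trans (hc ω (hX hω))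
    · intro f hf
      obtain ⟨g, hg, rfl⟩ := List.mem_map.1 hf
      exact hφ g (hr g hg)
    · intro ω hω
      rw [h ω (hX hω), List.map_map]
      exact List.map_congr_left fun f hf => (hφ' f (hr f hf) hω).symm
  | const a h ih =>
    intro X' S' c' hX hS hc'
    refine .const a (ih hX ?_ hc')
    rintro f (rfl | hf)
    · exact ⟨_, Set.mem_insert _ _, fun _ _ => rfl⟩
    · obtain ⟨g, hg, h⟩ := hS f hf
      exact ⟨g, Set.mem_insert_of_mem _ hg, h⟩
  | arith o f g hf hg hd h ih =>
    intro X' S' c' hX hS hc'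
    obtain ⟨f', hf', hff⟩ := hS f hf
    obtain ⟨g', hg', hgg⟩ := hS g hg
    refine .arith o f' g' hf' hg' (fun ho ω hω => ?_) (ih hX ?_ (by linarith))
    · rw [hgg hω]; exact hd ho ω (hX hω)
    rintro f (rfl | hf)
    · exact ⟨_, Set.mem_insert _ _, fun ω hω => by simp only [hff hω, hgg hω]⟩
    · obtain ⟨g, hg, h⟩ := hS f hf
      exact ⟨g, Set.mem_insert_of_mem _ hg, h⟩
  | ifZero f hf h₁ h₂ ih₁ ih₂ =>
    intro X' S' c' hX hS hc'
    obtain ⟨f', hf', hff⟩ := hS f hf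
    refine .ifZero f' hf' (ih₁ ?_ ?_ hc') (ih₂ ?_ ?_ hc')
    · rintro ω ⟨hω, h0⟩
      exact ⟨hX hω, by simpa [← hff hω] using h0⟩
    · intro g hg
      obtain ⟨k, hk, h⟩ := hS g hg
      exact ⟨k, hk, h.mono Set.inter_subset_left⟩
    · rintro ω ⟨hω, h0⟩
      exact ⟨hX hω, by simpa [← hff hω] using h0⟩
    · intro g hg
      obtain ⟨k, hk, h⟩ := hS g hg
      exact ⟨k, hk, h.mono Set.inter_subset_left⟩

theorem Win.mono_set {X X' : Set Ω} {S S' : Set (Ω → F)} {c c' : ℝ} (h : Win out bound X S c)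
    (hX : X' ⊆ X) (hS : S ⊆ S') (hc : c' ≤ c) : Win out bound X' S' c' :=
  h.mono hX (fun f hf => ⟨f, hS hf, fun _ _ => rfl⟩) hc

theorem Win.of_empty {S : Set (Ω → F)} {c : ℝ} : Win out bound ∅ S c :=
  .output [] (by simp) (by simp) (by simp)

theorem Win.exists_program {X : Set Ω} {S : Set (Ω → F)} {c : ℝ} (h : Win out bound X S c) :
    ∀ {V : Type} (e : V → Ω → F), (∀ f ∈ S, ∃ a, Set.EqOn (e a) f X) →
      ∃ P : Program F V, ∀ ω ∈ X, ∃ k : ℕ, P.Runs (fun a => e a ω) (out ω) k ∧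
        c + k ≤ bound ω := by
  have key : ∀ {V : Type} (e : V → Ω → F) (f : Ω → F) (ω : Ω),
      extendEnv (fun a => e a ω) (f ω) = fun a => (Option.elim a f e : Ω → F) ω := by
    intro V e f ω
    funext a
    cases a <;> rfl
  have hins : ∀ {V : Type} {e : V → Ω → F} {S : Set (Ω → F)} {X : Set Ω} {f f' : Ω → F},
      (∀ f ∈ S, ∃ a, Set.EqOn (e a) f X) → Set.EqOn f' f X →
      ∀ g ∈ insert f S, ∃ a, Set.EqOn (Option.elim a f' e : Ω → F) g X := by
    rintro V e S X f f' hS hf g (rfl | hg)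
    · exact ⟨none, hf⟩
    · obtain ⟨a, ha⟩ := hS g hg
      exact ⟨some a, ha⟩
  induction h with
  | @output X S c r hr h hc =>
    intro V e hS
    rcases isEmpty_or_nonempty V with hV | hV
    · refine ⟨.output [], fun ω hω => ⟨0, ⟨?_, rfl⟩, by simpa using hc ω hω⟩⟩
      have : r = [] := List.eq_nil_iff_forall_not_mem.2 fun f hf => hV.elim (hS f (hr f hf)).choose
      simp [h ω hω, this]
    choose! φ hφ using hS
    refine ⟨.output (r.map φ), fun ω hω => ⟨0, ⟨?_, rfl⟩, by simpa using hc ω hω⟩⟩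
    rw [h ω hω, List.map_map]
    exact List.map_congr_left fun f hf => (hφ f (hr f hf) hω).symm
  | const a h ih =>
    intro V e hS
    obtain ⟨P, hP⟩ := ih (fun b => Option.elim b (fun _ => a) e) (hins hS fun _ _ => rfl)
    refine ⟨.const a P, fun ω hω => ?_⟩
    obtain ⟨k, hk, hk'⟩ := hP ω hω
    refine ⟨k, ?_, hk'⟩
    rw [Program.Runs, key e (fun _ => a)]
    exact hk
  | arith o f g hf hg hd h ih =>
    intro V e hS
    obtain ⟨a, ha⟩ := hS f hf
    obtain ⟨b, hb⟩ := hS g hg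
    obtain ⟨P, hP⟩ := ih (fun i => Option.elim i (fun ω => o.eval (e a ω) (e b ω)) e)
      (hins hS fun ω hω => by simp only [ha hω, hb hω])
    refine ⟨.arith o a b P, fun ω hω => ?_⟩
    obtain ⟨k, hk, hk'⟩ := hP ω hω
    refine ⟨k + 1, ?_, by push_cast; linarith⟩
    rw [Program.Runs]
    refine ⟨fun ho => by rw [hb hω]; exact hd ho ω hω, k, rfl, ?_⟩
    rw [key e (fun ω => o.eval (e a ω) (e b ω))]
    exact hk
  | ifZero f hf h₁ h₂ ih₁ ih₂ =>
    intro V e hS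
    obtain ⟨a, ha⟩ := hS f hf
    obtain ⟨P₁, hP₁⟩ := ih₁ e fun g hg =>
      (hS g hg).imp fun i hi => hi.mono Set.inter_subset_left
    obtain ⟨P₂, hP₂⟩ := ih₂ e fun g hg =>
      (hS g hg).imp fun i hi => hi.mono Set.inter_subset_left
    refine ⟨.ifZero a P₁ P₂, fun ω hω => ?_⟩
    by_cases h0 : f ω = 0
    · obtain ⟨k, hk, hk'⟩ := hP₁ ω ⟨hω, h0⟩
      refine ⟨k, ?_, hk'⟩
      rw [Program.Runs]
      exact ⟨fun _ => hk, fun h => absurd ((ha hω).trans h0) h⟩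
    · obtain ⟨k, hk, hk'⟩ := hP₂ ω ⟨hω, h0⟩
      refine ⟨k, ?_, hk'⟩
      rw [Program.Runs]
      exact ⟨fun h => absurd ((ha hω).symm.trans h) h0, fun _ => hk⟩

theorem Win.of_subtype {X : Set Ω} {S : Set (Ω → F)} {c : ℝ}
    (h : Win (fun ω : X => out ω) (fun ω : X => bound ω) Set.univ
      ((fun f (ω : X) => f ω) '' S) c) : Win out bound X S c := by
  suffices H : ∀ {Y : Set X} {S' : Set (X → F)} {c : ℝ},
      Win (fun ω : X => out ω) (fun ω : X => bound ω) Y S' c → ∀ S : Set (Ω → F),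
        (∀ f ∈ S', ∃ g ∈ S, ∀ ω ∈ Y, g ω = f ω) →
        Win out bound (Subtype.val '' Y) S c by
    have := H h S (by rintro _ ⟨f, hf, rfl⟩; exact ⟨f, hf, fun _ _ => rfl⟩)
    simpa using this
  intro Y S' c h
  have hins : ∀ {Y : Set X} {S' : Set (X → F)} {S : Set (Ω → F)} {f : X → F} {f' : Ω → F},
      (∀ f ∈ S', ∃ g ∈ S, ∀ ω ∈ Y, g ω = f ω) → (∀ ω ∈ Y, f' ω = f ω) →
      ∀ k ∈ insert f S', ∃ g ∈ insert f' S, ∀ ω ∈ Y, g ω = k ω := by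
    rintro Y S' S f f' hS hf g (rfl | hg)
    · exact ⟨_, Set.mem_insert _ _, hf⟩
    · obtain ⟨a, ha, ha'⟩ := hS g hg
      exact ⟨a, Set.mem_insert_of_mem _ ha, ha'⟩
  induction h with
  | output r hr h hc =>
    intro S hS
    choose! φ hφ hφ' using hS
    refine .output (r.map φ) ?_ ?_ ?_
    · intro f hf
      obtain ⟨g, hg, rfl⟩ := List.mem_map.1 hf
      exact hφ g (hr g hg)
    · rintro _ ⟨ω, hω, rfl⟩
      rw [h ω hω, List.map_map]
      exact List.map_congr_left fun f hf => (hφ' f (hr f hf) ω hω).symm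
    · rintro _ ⟨ω, hω, rfl⟩
      exact hc ω hω
  | const a h ih =>
    intro S hS
    exact .const a (ih _ (hins hS fun _ _ => rfl))
  | arith o f g hf hg hd h ih =>
    intro S hS
    obtain ⟨f', hf', hff⟩ := hS f hf
    obtain ⟨g', hg', hgg⟩ := hS g hg
    refine .arith o f' g' hf' hg' ?_ (ih _ (hins hS fun ω hω => by simp only [hff ω hω, hgg ω hω]))
    rintro ho _ ⟨ω, hω, rfl⟩
    rw [hgg ω hω]
    exact hd ho ω hω
  | ifZero f hf h₁ h₂ ih₁ ih₂ =>
    intro S hS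
    obtain ⟨f', hf', hff⟩ := hS f hf
    refine .ifZero f' hf' ((ih₁ S ?_).mono_set ?_ subset_rfl le_rfl)
      ((ih₂ S ?_).mono_set ?_ subset_rfl le_rfl)
    · intro g hg
      obtain ⟨k, hk, h⟩ := hS g hg
      exact ⟨k, hk, fun ω hω => h ω hω.1⟩
    · rintro _ ⟨⟨ω, hω, rfl⟩, h0⟩
      exact ⟨ω, ⟨hω, by simpa [hff ω hω] using h0⟩, rfl⟩
    · intro g hg
      obtain ⟨k, hk, h⟩ := hS g hg
      exact ⟨k, hk, fun ω hω => h ω hω.1⟩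
    · rintro _ ⟨⟨ω, hω, rfl⟩, h0⟩
      exact ⟨ω, ⟨hω, by simpa [hff ω hω] using h0⟩, rfl⟩

/-- Branching on the zero patterns of the known functions. -/
theorem Win.of_forall_pattern {α : Type*} [Nonempty α] {X : Set Ω} {S : Set (Ω → F)} {c : ℝ}
    (hS : S.Finite) (κ : Ω → α)
    (hκ : ∀ ω ω', (∀ f ∈ S, f ω = 0 ↔ f ω' = 0) → κ ω = κ ω')
    (h : ∀ a, Win out bound (X ∩ {ω | κ ω = a}) S c) : Win out bound X S c := by
  suffices H : ∀ Z : Set (Ω → F), Z.Finite → Z ⊆ S → ∀ X : Set Ω,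
      (∀ X' ⊆ X, (∀ ω ∈ X', ∀ ω' ∈ X', ∀ f ∈ Z, f ω = 0 ↔ f ω' = 0) → Win out bound X' S c) →
        Win out bound X S c by
    refine H S hS subset_rfl X fun X' hX hp => ?_
    rcases X'.eq_empty_or_nonempty with rfl | ⟨ω, hω⟩
    · exact .of_empty
    · exact (h (κ ω)).mono_set (fun ω' hω' => ⟨hX hω', hκ _ _ (hp ω' hω' ω hω)⟩) subset_rfl le_rfl
  intro Z hZ
  induction Z, hZ using Set.Finite.induction_on with
  | empty => exact fun _ X hX => hX X subset_rfl (by simp)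
  | @insert f Z hf hZ ih =>
    intro hZS X hX
    rw [Set.insert_subset_iff] at hZS
    refine .ifZero f hZS.1 (ih hZS.2 _ fun X' hX' hp => hX X' (hX'.trans Set.inter_subset_left) ?_)
      (ih hZS.2 _ fun X' hX' hp => hX X' (hX'.trans Set.inter_subset_left) ?_)
    · rintro ω hω ω' hω' g (rfl | hg)
      · exact iff_of_true (hX' hω).2 (hX' hω').2
      · exact hp ω hω ω' hω' g hg
    · rintro ω hω ω' hω' g (rfl | hg)
      · exact iff_of_false (hX' hω).2 (hX' hω').2
      · exact hp ω hω ω' hω' g hg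

theorem Win.of_program {V : Type} (P : Program F V) :
    ∀ {X : Set Ω} {R : Set (Ω → F)} {c K : ℝ} (e : V → Ω → F) (fs : List (Ω → F)),
      (∀ a, e a ∈ R) →
      (∀ ω ∈ X, ∃ k : ℕ, P.Runs (fun a => e a ω) (fs.map fun f => f ω) k ∧ (k : ℝ) ≤ K) →
      Win out bound X (R ∪ {f | f ∈ fs}) (c + K) → Win out bound X R c := by
  have key : ∀ {V : Type} (e : V → Ω → F) (f : Ω → F) (ω : Ω),
      extendEnv (fun a => e a ω) (f ω) = fun a => (Option.elim a f e : Ω → F) ω := by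
    intro V e f ω
    funext a
    cases a <;> rfl
  induction P with
  | output r =>
    intro X R c K e fs he hP hW
    rcases X.eq_empty_or_nonempty with rfl | ⟨ω₀, hω₀⟩
    · exact .of_empty
    have hK : 0 ≤ K := by
      obtain ⟨k, -, hk⟩ := hP ω₀ hω₀
      exact (Nat.cast_nonneg k).trans hk
    refine hW.mono subset_rfl ?_ (by linarith)
    rintro f (hf | hf)
    · exact ⟨f, hf, fun _ _ => rfl⟩
    obtain ⟨i, hi, rfl⟩ := List.getElem_of_mem hf
    have hlen : fs.length = r.length := by
      obtain ⟨k, hk, -⟩ := hP ω₀ hω₀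
      simpa using congrArg List.length hk.1
    refine ⟨e r[i], he _, fun ω hω => ?_⟩
    obtain ⟨k, hk, -⟩ := hP ω hω
    have := congrArg (fun l => l[i]?) hk.1
    simp only [List.getElem?_map, List.getElem?_eq_getElem hi,
      List.getElem?_eq_getElem (hlen ▸ hi), Option.map_some, Option.some.injEq] at this
    exact this.symm
  | const a P ih =>
    intro X R c K e fs he hP hW
    refine .const a (ih (K := K) (fun b => Option.elim b (fun _ => a) e) fs ?_ ?_ ?_)
    · rintro (_ | b)
      · exact Set.mem_insert _ _
      · exact Set.mem_insert_of_mem _ (he b)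
    · intro ω hω
      obtain ⟨k, hk, hk'⟩ := hP ω hω
      rw [Program.Runs, key e (fun _ => a)] at hk
      exact ⟨k, hk, hk'⟩
    · exact hW.mono_set subset_rfl (Set.union_subset_union_left _ (Set.subset_insert _ _)) le_rfl
  | arith o a b P ih =>
    intro X R c K e fs he hP hW
    refine .arith o (e a) (e b) (he a) (he b) ?_
      (ih (K := K - 1) (fun i => Option.elim i (fun ω => o.eval (e a ω) (e b ω)) e) fs ?_ ?_ ?_)
    · intro ho ω hω
      obtain ⟨k, hk, -⟩ := hP ω hω
      exact hk.1 ho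
    · rintro (_ | b)
      · exact Set.mem_insert _ _
      · exact Set.mem_insert_of_mem _ (he b)
    · intro ω hω
      obtain ⟨k, ⟨-, k', rfl, hk⟩, hk'⟩ := hP ω hω
      rw [key e (fun ω => o.eval (e a ω) (e b ω))] at hk
      push_cast at hk'
      exact ⟨k', hk, by linarith⟩
    · exact hW.mono_set subset_rfl (Set.union_subset_union_left _ (Set.subset_insert _ _))
        (by linarith)
  | ifZero a P₁ P₂ ih₁ ih₂ =>
    intro X R c K e fs he hP hW
    refine .ifZero (e a) (he a) (ih₁ (K := K) e fs he ?_ ?_) (ih₂ (K := K) e fs he ?_ ?_)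
    · rintro ω ⟨hω, h0⟩
      obtain ⟨k, hk, hk'⟩ := hP ω hω
      exact ⟨k, hk.1 h0, hk'⟩
    · exact hW.mono_set Set.inter_subset_left subset_rfl le_rfl
    · rintro ω ⟨hω, h0⟩
      obtain ⟨k, hk, hk'⟩ := hP ω hω
      exact ⟨k, hk.2 h0, hk'⟩
    · exact hW.mono_set Set.inter_subset_left subset_rfl le_rfl

/-- `Cost S T k`: the functions in `T` can be computed from those in `S` with `k` operations. -/
def Cost (S T : Set (Ω → F)) (k : ℝ) : Prop :=
  ∀ (out : Ω → List F) (bound : Ω → ℝ) (X : Set Ω) (R : Set (Ω → F)) (c : ℝ), S ⊆ R →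
    Win out bound X (R ∪ T) (c + k) → Win out bound X R c

/-- The constant functions. -/
def Consts (F : Type u) (Ω : Type v) : Set (Ω → F) := Set.range fun a _ => a

theorem Consts.mem {F : Type u} {Ω : Type v} (a : F) : (fun _ => a) ∈ Consts F Ω := ⟨a, rfl⟩

namespace Cost

variable {S S' T T' U : Set (Ω → F)} {k k' l : ℝ}

theorem mono (h : Cost S T k) (hS : S ⊆ S') (hT : T' ⊆ T) (hk : k ≤ k') : Cost S' T' k' :=
  fun out bound X R c hR hW => h out bound X R c (hS.trans hR)
    (hW.mono_set subset_rfl (Set.union_subset_union_right _ hT) (by linarith))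

theorem trans (h : Cost S T k) (h' : Cost (S ∪ T) U l) : Cost S (T ∪ U) (k + l) :=
  fun out bound X R c hR hW => h out bound X R c hR
    (h' out bound X (R ∪ T) (c + k) (Set.union_subset_union_left _ hR)
      (by rwa [Set.union_assoc, add_assoc]))

theorem comp (h : Cost S T k) (h' : Cost (S ∪ T) U l) : Cost S U (k + l) :=
  (h.trans h').mono subset_rfl Set.subset_union_right le_rfl

theorem of_subset (h : T ⊆ S) (hk : 0 ≤ k) : Cost S T k :=
  fun out bound X R c hR hW => hW.mono_set subset_rfl (Set.union_subset subset_rfl (h.trans hR))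
    (by linarith)

theorem union (h : Cost S T k) (h' : Cost S U l) : Cost S (T ∪ U) (k + l) :=
  h.trans (h'.mono Set.subset_union_left subset_rfl le_rfl)

theorem biUnion {ι : Type*} (s : Finset ι) (T : ι → Set (Ω → F)) (k : ι → ℝ)
    (h : ∀ i ∈ s, Cost S (T i) (k i)) : Cost S (⋃ i ∈ s, T i) (∑ i ∈ s, k i) := by
  classical
  induction s using Finset.induction_on with
  | empty => exact of_subset (by simp) (by simp)
  | insert a s ha ih =>
    rw [Finset.sum_insert ha, Finset.set_biUnion_insert]
    exact (h a (Finset.mem_insert_self a s)).union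
      (ih fun i hi => h i (Finset.mem_insert_of_mem hi))

theorem consts [Finite F] (hk : 0 ≤ k) : Cost S (Consts F Ω) k := by
  have : ∀ s : Finset F, Cost S (Set.range fun (a : s) (_ : Ω) => (a : F)) 0 := by
    classical
    intro s
    induction s using Finset.induction_on with
    | empty => exact of_subset (by rintro _ ⟨⟨a, ha⟩, rfl⟩; simp at ha) le_rfl
    | insert a s ha ih =>
      refine (ih.union (l := 0) (U := {fun _ => a}) ?_).mono subset_rfl ?_ (by simp)
      · intro out bound X R c hR hW
        exact .const a (hW.mono_set subset_rfl (by rw [Set.insert_eq, Set.union_comm]) (by simp))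
      · rintro _ ⟨⟨b, hb⟩, rfl⟩
        rcases Finset.mem_insert.1 hb with rfl | hb
        · exact .inr rfl
        · exact .inl ⟨⟨b, hb⟩, rfl⟩
  have hF := Fintype.ofFinite F
  refine (this Finset.univ).mono subset_rfl ?_ hk
  rintro _ ⟨a, rfl⟩
  exact ⟨⟨a, Finset.mem_univ a⟩, rfl⟩

theorem of_subset_consts [Finite F] (h : T ⊆ S ∪ Consts F Ω) (hk : 0 ≤ k) : Cost S T k :=
  ((consts (S := S) le_rfl).comp (of_subset h le_rfl)).mono subset_rfl subset_rfl (by simpa)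

theorem add_consts [Finite F] (h : Cost (S ∪ Consts F Ω) T k) : Cost S T k :=
  ((consts le_rfl).comp h).mono subset_rfl subset_rfl (by simp)

theorem arith (o : ArithOp) {f g : Ω → F} (hf : f ∈ S) (hg : g ∈ S)
    (hd : o = ArithOp.div → ∀ ω, g ω ≠ 0) : Cost S {fun ω => o.eval (f ω) (g ω)} 1 :=
  fun out bound X R c hR hW => .arith o f g (hR hf) (hR hg) (fun ho ω _ => hd ho ω)
    (by rwa [Set.insert_eq, Set.union_comm])

theorem add {f g : Ω → F} (hf : f ∈ S) (hg : g ∈ S) : Cost S {fun ω => f ω + g ω} 1 :=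
  arith .add hf hg (by simp)

theorem sub {f g : Ω → F} (hf : f ∈ S) (hg : g ∈ S) : Cost S {fun ω => f ω - g ω} 1 :=
  arith .sub hf hg (by simp)

theorem mul {f g : Ω → F} (hf : f ∈ S) (hg : g ∈ S) : Cost S {fun ω => f ω * g ω} 1 :=
  arith .mul hf hg (by simp)

theorem div {f g : Ω → F} (hf : f ∈ S) (hg : g ∈ S) (h : ∀ ω, g ω ≠ 0) :
    Cost S {fun ω => f ω / g ω} 1 :=
  arith .div hf hg fun _ => h

theorem const_mul [Finite F] (a : F) {f : Ω → F} (hf : f ∈ S) : Cost S {fun ω => a * f ω} 1 :=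
  add_consts (mul (.inr (Consts.mem a)) (.inl hf))

theorem linearCombination [Finite F] {ι : Type*} (s : Finset ι) (a : ι → F) (f : ι → Ω → F)
    (hf : ∀ i ∈ s, f i ∈ S) : Cost S {fun ω => ∑ i ∈ s, a i * f i ω} (2 * s.card) := by
  classical
  induction s using Finset.induction_on with
  | empty =>
    refine of_subset_consts ?_ (by simp)
    rintro _ rfl
    exact .inr ⟨0, by simp⟩
  | insert i s hi ih =>
    have h := (ih fun j hj => hf j (Finset.mem_insert_of_mem hj)).union
      (const_mul (a i) (hf i (Finset.mem_insert_self i s)))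
    refine (h.comp (add (f := fun ω => a i * f i ω) (g := fun ω => ∑ i ∈ s, a i * f i ω)
      (by simp) (by simp))).mono subset_rfl ?_ ?_
    · rintro _ rfl
      simp [Finset.sum_insert hi]
    · rw [Finset.card_insert_of_notMem hi]
      push_cast
      linarith

theorem of_program {V : Type} (P : Program F V) (e : V → Ω → F) (fs : List (Ω → F))
    (he : ∀ a, e a ∈ S)
    (hP : ∀ ω, ∃ n : ℕ, P.Runs (fun a => e a ω) (fs.map fun f => f ω) n ∧ (n : ℝ) ≤ k) :
    Cost S {f | f ∈ fs} k :=
  fun _ _ _ _ _ hR hW => Win.of_program P e fs (fun a => hR (he a)) (fun ω _ => hP ω) hW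

end Cost

end Model

namespace IsMultiplicationTime

variable {F : Type*} [Field F] {M : ℕ → ℝ}

theorem pos (hM : IsMultiplicationTime F M) {n : ℕ} (hn : 1 ≤ n) : 0 < M n :=
  (Nat.cast_pos.2 hn).trans_le (hM.le_self n hn)

theorem le_mul_div (hM : IsMultiplicationTime F M) {m n : ℕ} (hm : 1 ≤ m) (h : m ≤ n) :
    M m ≤ m * (M n / n) := by
  have h1 := hM.superlinear m n hm h
  have : (0 : ℝ) < m := Nat.cast_pos.2 hm
  rwa [div_le_iff₀ this, mul_comm] at h1

theorem mono (hM : IsMultiplicationTime F M) {m n : ℕ} (hm : 1 ≤ m) (h : m ≤ n) : M m ≤ M n := by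
  refine (hM.le_mul_div hm h).trans ?_
  have hn : (0 : ℝ) < n := Nat.cast_pos.2 (hm.trans h)
  rw [mul_div_assoc', div_le_iff₀ hn, mul_comm]
  exact mul_le_mul_of_nonneg_left (Nat.cast_le.2 h) (hM.pos (hm.trans h)).le

theorem sum_le {α : Type*} (hM : IsMultiplicationTime F M) {s : Finset α} (n : α → ℕ) {N : ℕ}
    (hs : s.Nonempty) (hn : ∀ a ∈ s, 1 ≤ n a) (hN : ∑ a ∈ s, n a ≤ N) :
    ∑ a ∈ s, M (n a) ≤ M N := by
  obtain ⟨a₀, ha₀⟩ := hs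
  have hle : ∀ a ∈ s, n a ≤ N := fun a ha =>
    (Finset.single_le_sum (fun _ _ => Nat.zero_le _) ha).trans hN
  have hN1 : 1 ≤ N := (hn a₀ ha₀).trans (hle a₀ ha₀)
  have hN0 : (0 : ℝ) < N := Nat.cast_pos.2 hN1
  calc ∑ a ∈ s, M (n a) ≤ ∑ a ∈ s, n a * (M N / N) :=
        Finset.sum_le_sum fun a ha => hM.le_mul_div (hn a ha) (hle a ha)
    _ = ((∑ a ∈ s, n a : ℕ) : ℝ) * (M N / N) := by rw [← Finset.sum_mul]; push_cast; rfl
    _ ≤ N * (M N / N) := mul_le_mul_of_nonneg_right (Nat.cast_le.2 hN)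
        (div_nonneg (hM.pos hN1).le hN0.le)
    _ = M N := by field_simp

theorem nat_mul_le (hM : IsMultiplicationTime F M) {k m N : ℕ} (hk : 1 ≤ k) (hm : 1 ≤ m)
    (h : k * m ≤ N) : k * M m ≤ M N := by
  have := hM.sum_le (s := Finset.range k) (fun _ => m) (Finset.nonempty_range_iff.2 (by omega))
    (fun _ _ => hm) (N := N) (by simpa using h)
  simpa using this

theorem le_sq_mul (hM : IsMultiplicationTime F M) {k m n : ℕ} (hn : 1 ≤ n) (hm : 1 ≤ m)
    (h : n ≤ k * m) : M n ≤ (k : ℝ) ^ 2 * M m := by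
  have hk : 1 ≤ k := by
    rcases Nat.eq_zero_or_pos k with rfl | hk
    · omega
    · exact hk
  exact (hM.mono hn h).trans (hM.quadratic k m hk hm)

end IsMultiplicationTime

section Frobenius

variable (F : Type*) [Field F] [Finite F] {E : Type*} [Field E] [Algebra F E]

/-- The `k`-th power of the Frobenius automorphism `z ↦ z ^ #F`. -/
noncomputable def Fr (k : ℕ) : E →ₐ[F] E :=
  (letI := Fintype.ofFinite F; FiniteField.frobeniusAlgHom F E) ^ k

theorem Fr_zero : (Fr F 0 : E →ₐ[F] E) = 1 := pow_zero _

theorem Fr_add (a b : ℕ) (z : E) : Fr F (a + b) z = Fr F a (Fr F b z) := by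
  rw [Fr, pow_add]; rfl

theorem Fr_apply (k : ℕ) (z : E) : Fr F k z = z ^ Nat.card F ^ k := by
  induction k with
  | zero => simp [Fr_zero]
  | succ k ih =>
    have h1 : Fr F 1 z = z ^ Nat.card F := by
      let := Fintype.ofFinite F
      rw [Fr, pow_one, FiniteField.frobeniusAlgHom_apply, Nat.card_eq_fintype_card]
    rw [Fr_add, h1, map_pow, ih, ← pow_mul, pow_succ]

theorem Fr_injective (k : ℕ) : Function.Injective (Fr F k : E →ₐ[F] E) :=
  (Fr F k : E →ₐ[F] E).toRingHom.injective

theorem Fr_mul_of_fixed {a : ℕ} {z : E} (h : Fr F a z = z) (k : ℕ) : Fr F (a * k) z = z := by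
  induction k with
  | zero => simp [Fr_zero]
  | succ k ih => rw [Nat.mul_succ, Fr_add, h, ih]

theorem Fr_of_dvd {a b : ℕ} {z : E} (h : Fr F a z = z) (hab : a ∣ b) : Fr F b z = z := by
  obtain ⟨k, rfl⟩ := hab
  exact Fr_mul_of_fixed F h k

theorem Fr_gcd {a b : ℕ} {z : E} (ha : Fr F a z = z) (hb : Fr F b z = z) :
    Fr F (a.gcd b) z = z := by
  have hit : ∀ k, (Fr F 1 : E → E)^[k] z = Fr F k z := by
    intro k
    induction k with
    | zero => simp [Fr_zero]
    | succ k ih => rw [Function.iterate_succ_apply', ih, add_comm k 1, Fr_add]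
  have h1 : Function.IsPeriodicPt (Fr F 1 : E → E) a z := (hit a).trans ha
  have h2 : Function.IsPeriodicPt (Fr F 1 : E → E) b z := (hit b).trans hb
  exact (hit _).symm.trans (h1.gcd h2)

/-- The `k`-th power of the Frobenius automorphism, applied to the coefficients. -/
noncomputable def fr (k : ℕ) : E[X] →ₐ[F] E[X] := Polynomial.mapAlgHom (Fr F k)

@[simp]
theorem coeff_fr (k : ℕ) (f : E[X]) (i : ℕ) : (fr F k f).coeff i = Fr F k (f.coeff i) := by
  simp [fr]

theorem fr_eq_iff {k : ℕ} {f : E[X]} : fr F k f = f ↔ ∀ i, Fr F k (f.coeff i) = f.coeff i := by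
  simp [Polynomial.ext_iff]

@[simp]
theorem fr_C (k : ℕ) (z : E) : fr F k (C z) = C (Fr F k z) := by simp [fr]

@[simp]
theorem fr_X (k : ℕ) : fr F k (X : E[X]) = X := by simp [fr]

theorem fr_zero (f : E[X]) : fr F 0 f = f := by
  ext i; simp [Fr_zero]

theorem fr_add (a b : ℕ) (f : E[X]) : fr F (a + b) f = fr F a (fr F b f) := by
  ext i; simp [Fr_add]

@[simp]
theorem natDegree_fr (k : ℕ) (f : E[X]) : (fr F k f).natDegree = f.natDegree := by
  simp only [fr, coe_mapAlgHom]
  exact natDegree_map_eq_of_injective (Fr_injective F k) f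

theorem fr_monic (k : ℕ) {f : E[X]} (hf : f.Monic) : (fr F k f).Monic := by
  simp only [fr, coe_mapAlgHom]
  exact hf.map _

theorem fr_of_dvd {a b : ℕ} {f : E[X]} (h : fr F a f = f) (hab : a ∣ b) : fr F b f = f := by
  rw [fr_eq_iff] at h ⊢
  exact fun i => Fr_of_dvd F (h i) hab

theorem eval_fr (k : ℕ) (f : E[X]) (z : E) : (fr F k f).eval (Fr F k z) = Fr F k (f.eval z) := by
  simp only [fr, coe_mapAlgHom]
  exact Polynomial.eval_map_apply (f := ((Fr F k : E →ₐ[F] E) : E →+* E)) z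

end Frobenius

section Known

variable {F : Type u} [Field F] [Finite F] {E : Type*} [Field E] [Algebra F E] {Ω : Type v}
  {ι : Type*} (b : Module.Basis ι F E)

/-- The coordinates of an element of `E`, as functions of the input. -/
def KE (z : Ω → E) : Set (Ω → F) := Set.range fun j ω => b.repr (z ω) j

/-- The coordinates of the coefficients of a polynomial, as functions of the input. -/
def KP (f : Ω → E[X]) : Set (Ω → F) := Set.range fun (x : ℕ × ι) ω => b.repr ((f ω).coeff x.1) x.2

variable {b}

omit [Finite F] in
theorem mem_KP (f : Ω → E[X]) (i : ℕ) (j : ι) : (fun ω => b.repr ((f ω).coeff i) j) ∈ KP b f :=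
  ⟨(i, j), rfl⟩

omit [Finite F] in
theorem KP_subset_of_coeff {f g : Ω → E[X]}
    (h : ∀ i, (∃ i', ∀ ω, (g ω).coeff i = (f ω).coeff i') ∨ ∃ z, ∀ ω, (g ω).coeff i = z) :
    KP b g ⊆ KP b f ∪ Consts F Ω := by
  rintro _ ⟨⟨i, j⟩, rfl⟩
  rcases h i with ⟨i', hi'⟩ | ⟨z, hz⟩
  · exact .inl ⟨(i', j), by simp [hi']⟩
  · exact .inr ⟨b.repr z j, by simp [hz]⟩

omit [Finite F] in
theorem KP_C (z : Ω → E) : KP b (fun ω => C (z ω)) ⊆ KE b z ∪ Consts F Ω := by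
  rintro _ ⟨⟨i, j⟩, rfl⟩
  rcases i with _ | i
  · exact .inl ⟨j, by simp⟩
  · exact .inr ⟨0, by simp⟩

omit [Finite F] in
theorem KE_subset_KP_C (z : Ω → E) : KE b z ⊆ KP b (fun ω => C (z ω)) := by
  rintro _ ⟨j, rfl⟩
  exact ⟨(0, j), by simp⟩

omit [Finite F] in
theorem KP_const (f : E[X]) : KP b (fun _ : Ω => f) ⊆ Consts F Ω := by
  rintro _ ⟨⟨i, j⟩, rfl⟩
  exact ⟨_, rfl⟩

/-- The polynomial `f ω` has fewer than `m` coefficients, fixed by the `K`-th power of Frobenius. -/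
def SmallPoly (F : Type u) [Field F] [Finite F] [Algebra F E] (K m : ℕ) (f : Ω → E[X]) : Prop :=
  ∀ ω, fr F K (f ω) = f ω ∧ (f ω).natDegree < m

theorem SmallPoly.mono {K m n : ℕ} {f : Ω → E[X]} (h : SmallPoly F K m f) (hmn : m ≤ n) : SmallPoly F K n f :=
  fun ω => ⟨(h ω).1, (h ω).2.trans_le hmn⟩

theorem SmallPoly.mul {K m n N : ℕ} {f g : Ω → E[X]} (hf : SmallPoly F K m f) (hg : SmallPoly F K n g)
    (h : m + n ≤ N + 1) : SmallPoly F K N (f * g) := fun ω =>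
  ⟨by simp [(hf ω).1, (hg ω).1], by
    have := natDegree_mul_le (p := f ω) (q := g ω)
    have := (hf ω).2
    have := (hg ω).2
    simp only [Pi.mul_apply]
    omega⟩

theorem SmallPoly.add {K m : ℕ} {f g : Ω → E[X]} (hf : SmallPoly F K m f) (hg : SmallPoly F K m g) :
    SmallPoly F K m (f + g) := fun ω =>
  ⟨by simp [(hf ω).1, (hg ω).1],
    (natDegree_add_le _ _).trans_lt (max_lt (hf ω).2 (hg ω).2)⟩

theorem SmallPoly.const {K : ℕ} {z : Ω → E} (hz : ∀ ω, Fr F K (z ω) = z ω) :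
    SmallPoly F K 1 (fun ω => C (z ω)) := fun ω => ⟨by simp [hz ω], by simp⟩

theorem SmallPoly.of_dvd {K K' m : ℕ} {f : Ω → E[X]} (h : SmallPoly F K m f) (hK : K ∣ K') :
    SmallPoly F K' m f := fun ω => ⟨fr_of_dvd F (h ω).1 hK, (h ω).2⟩

theorem SmallPoly.prod {α : Type*} {K N : ℕ} {s : Finset α} {f : α → Ω → E[X]} {n : α → ℕ}
    (hf : ∀ a ∈ s, SmallPoly F K (n a) (f a)) (hN : ∑ a ∈ s, n a < N + s.card) :
    SmallPoly F K N (∏ a ∈ s, f a) := by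
  intro ω
  have hprod : (∏ a ∈ s, f a) ω = ∏ a ∈ s, f a ω := Finset.prod_apply _ _ _
  rw [hprod]
  refine ⟨by rw [map_prod]; exact Finset.prod_congr rfl fun a ha => (hf a ha ω).1, ?_⟩
  have h1 := natDegree_prod_le s fun a => f a ω
  have h2 : ∑ a ∈ s, ((f a ω).natDegree + 1) ≤ ∑ a ∈ s, n a :=
    Finset.sum_le_sum fun a ha => (hf a ha ω).2
  rw [Finset.sum_add_distrib, Finset.sum_const, smul_eq_mul, mul_one] at h2
  omega

variable (b) in
/-- The field fixed by the `K`-th power of Frobenius has `K` coordinates, and its polynomials can be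
multiplied through polynomials over `F` with `K` times as many coefficients. -/
structure FrobLevel (M : ℕ → ℝ) (Ω : Type v) (K : ℕ) : Prop where
  pos : 1 ≤ K
  coords : ∃ I : Finset ι, I.card = K ∧ ∀ z, Fr F K z = z → ∀ j ∉ I, b.repr z j = 0
  mul : ∀ (m : ℕ) (f g : Ω → E[X]), 1 ≤ m → SmallPoly F K m f → SmallPoly F K m g →
    Cost (KP b f ∪ KP b g) (KP b (f * g)) (10 * M (K * m))

namespace FrobLevel

variable {M : ℕ → ℝ} {K : ℕ} {S : Set (Ω → F)}

theorem coordwise (hL : FrobLevel b M Ω K) {m : ℕ} {f : Ω → E[X]} {a : ℝ}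
    (hf : SmallPoly F K m f)
    (h : ∀ i j, Cost S {fun ω => b.repr ((f ω).coeff i) j} a) :
    Cost S (KP b f) (m * K * a) := by
  obtain ⟨I, hI, hI0⟩ := hL.coords
  have := Cost.biUnion (S := S) (Finset.range m ×ˢ I)
    (fun x => {fun ω => b.repr ((f ω).coeff x.1) x.2}) (fun _ => a) fun x _ => h x.1 x.2
  refine (this.trans (Cost.consts le_rfl)).comp (Cost.of_subset (T := KP b f) ?_ le_rfl) |>.mono
    subset_rfl subset_rfl ?_
  · rintro _ ⟨⟨i, j⟩, rfl⟩
    refine .inr ?_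
    by_cases hij : i < m ∧ j ∈ I
    · left
      simp only [Set.mem_iUnion]
      exact ⟨(i, j), by simpa using hij, rfl⟩
    · right
      refine ⟨0, funext fun ω => ?_⟩
      rw [not_and_or] at hij
      change (0 : F) = b.repr ((f ω).coeff i) j
      rcases hij with hi | hj
      · rw [coeff_eq_zero_of_natDegree_lt ((hf ω).2.trans_le (not_lt.1 hi))]
        simp
      · exact (hI0 _ (by rw [← coeff_fr, (hf ω).1]) j hj).symm
  · simp [hI]

theorem add (hL : FrobLevel b M Ω K) {m : ℕ} {f g : Ω → E[X]}
    (hf : SmallPoly F K m f) (hg : SmallPoly F K m g) :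
    Cost (KP b f ∪ KP b g) (KP b (f + g)) (m * K) := by
  refine (hL.coordwise (a := 1) (hf.add hg) fun i j => ?_).mono subset_rfl subset_rfl (by simp)
  refine (Cost.add (.inl (mem_KP f i j)) (.inr (mem_KP g i j))).mono subset_rfl ?_ le_rfl
  simp

theorem sub (hL : FrobLevel b M Ω K) {m : ℕ} {f g : Ω → E[X]}
    (hf : SmallPoly F K m f) (hg : SmallPoly F K m g) :
    Cost (KP b f ∪ KP b g) (KP b (f - g)) (m * K) := by
  have hfg : SmallPoly F K m (f - g) := fun ω =>
    ⟨by simp [(hf ω).1, (hg ω).1], (natDegree_sub_le _ _).trans_lt (max_lt (hf ω).2 (hg ω).2)⟩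
  refine (hL.coordwise (a := 1) hfg fun i j => ?_).mono subset_rfl subset_rfl (by simp)
  refine (Cost.sub (.inl (mem_KP f i j)) (.inr (mem_KP g i j))).mono subset_rfl ?_ le_rfl
  simp

/-- An `F`-linear map applied to the coefficients. -/
theorem linearMap (hL : FrobLevel b M Ω K) {K' : ℕ} (hL' : FrobLevel b M Ω K') {m : ℕ} {f g : Ω → E[X]}
    (hf : SmallPoly F K m f) (hg : SmallPoly F K' m g) (Λ : E →ₗ[F] E)
    (h : ∀ ω i, (g ω).coeff i = Λ ((f ω).coeff i)) :
    Cost (KP b f) (KP b g) (m * K' * (2 * K)) := by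
  obtain ⟨I, hI, hI0⟩ := hL.coords
  refine hL'.coordwise hg fun i j => ?_
  refine (Cost.linearCombination I (fun a => b.repr (Λ (b a)) j)
    (fun a ω => b.repr ((f ω).coeff i) a) fun a _ => mem_KP f i a).mono subset_rfl ?_ (by rw [hI])
  rintro _ rfl
  refine funext fun ω => ?_
  have hz : (f ω).coeff i = ∑ a ∈ I, b.repr ((f ω).coeff i) a • b a := by
    conv_lhs => rw [← b.linearCombination_repr ((f ω).coeff i), Finsupp.linearCombination_apply]
    refine Finsupp.sum_of_support_subset _ (fun a ha => ?_) _ (by simp)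
    by_contra haI
    exact (Finsupp.mem_support_iff.1 ha)
      (hI0 _ (by rw [← coeff_fr, (hf ω).1]) a haI)
  rw [h]
  conv_lhs => rw [hz]
  simp [map_sum, mul_comm]

end FrobLevel

end Known

/-- The `a`-th block of `2 ^ i` consecutive natural numbers. -/
def block (i a : ℕ) : Finset ℕ := Finset.Ico (a * 2 ^ i) ((a + 1) * 2 ^ i)

theorem block_zero (a : ℕ) : block 0 a = {a} := by simp [block]

theorem block_succ (i a : ℕ) : block (i + 1) a = block i (2 * a) ∪ block i (2 * a + 1) := by
  simp only [block]
  rw [Finset.Ico_union_Ico_eq_Ico (Nat.mul_le_mul_right _ (by omega))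
    (Nat.mul_le_mul_right _ (by omega))]
  congr 1 <;> ring

theorem block_disjoint {i a a' : ℕ} (h : a < a') : Disjoint (block i a) (block i a') :=
  Finset.Ico_disjoint_Ico_consecutive _ _ _ |>.mono_right
    (Finset.Ico_subset_Ico_left (Nat.mul_le_mul_right _ h))

theorem block_nonempty (i a : ℕ) : (block i a).Nonempty :=
  ⟨a * 2 ^ i, by simp [block]⟩

theorem block_root (k : ℕ) : block k 0 = Finset.range (2 ^ k) := by
  ext; simp [block]

theorem block_subset {i j a : ℕ} (ha : a < 2 ^ j) : block i a ⊆ Finset.range (2 ^ (i + j)) := by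
  intro x hx
  simp only [block, Finset.mem_Ico] at hx
  rw [Finset.mem_range, pow_add, mul_comm]
  exact hx.2.trans_le (Nat.mul_le_mul_right _ ha)

theorem sum_block (n : ℕ → ℕ) (i m : ℕ) :
    ∑ a ∈ Finset.range m, ∑ c ∈ block i a, n c = ∑ c ∈ Finset.range (m * 2 ^ i), n c := by
  induction m with
  | zero => simp
  | succ m ih =>
    rw [Finset.sum_range_succ, ih, Finset.range_eq_Ico, Finset.range_eq_Ico, block,
      Finset.sum_Ico_consecutive _ (Nat.zero_le _) (Nat.mul_le_mul_right _ (by omega))]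

/-- The numerator of the sum of the fractions `g c / f c`, for `c ∈ s`. -/
noncomputable def fracNum {R : Type*} [CommRing R] (f g : ℕ → R) (s : Finset ℕ) : R :=
  ∑ c ∈ s, g c * ∏ c' ∈ s.erase c, f c'

theorem fracNum_union {R : Type*} [CommRing R] (f g : ℕ → R) {s t : Finset ℕ}
    (h : Disjoint s t) :
    fracNum f g (s ∪ t) = fracNum f g s * ∏ c ∈ t, f c + fracNum f g t * ∏ c ∈ s, f c := by
  rw [fracNum, Finset.sum_union h, fracNum, fracNum, Finset.sum_mul, Finset.sum_mul]
  congr 1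
  · refine Finset.sum_congr rfl fun c hc => ?_
    rw [Finset.erase_union_distrib, Finset.erase_eq_of_notMem (Finset.disjoint_left.1 h hc),
      Finset.prod_union (h.mono_left (Finset.erase_subset _ _)), mul_assoc]
  · refine Finset.sum_congr rfl fun c hc => ?_
    rw [Finset.erase_union_distrib, Finset.erase_eq_of_notMem (Finset.disjoint_right.1 h hc),
      Finset.prod_union (h.mono_right (Finset.erase_subset _ _)), mul_assoc, mul_comm (∏ c ∈ s, f c)]

/-- The polynomial whose coefficients are the values of `φ` at `W, W * X, …, W * X ^ (p - 1)`. -/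
noncomputable def momentPoly {E : Type*} [Field E] (φ : E[X] →ₗ[E] E) (W : E[X]) (p : ℕ) : E[X] :=
  ∑ m ∈ Finset.range p, monomial m (φ (W * X ^ m))

section Moment

variable {E : Type*} [Field E] (φ : E[X] →ₗ[E] E) (W U : E[X])

theorem coeff_momentPoly (p i : ℕ) :
    (momentPoly φ W p).coeff i = if i < p then φ (W * X ^ i) else 0 := by
  simp [momentPoly, coeff_monomial]

theorem natDegree_momentPoly {p n : ℕ} (hpn : p ≤ n) (hn : 1 ≤ n) :
    (momentPoly φ W p).natDegree < n := by
  rcases Nat.eq_zero_or_pos p with rfl | hp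
  · simpa [momentPoly] using Nat.pos_of_ne_zero (by omega)
  · refine lt_of_le_of_lt (natDegree_sum_le_of_forall_le (n := p - 1) _ _ fun m hm => ?_)
      (by omega : p - 1 < n)
    exact (natDegree_monomial_le _).trans (by have := Finset.mem_range.1 hm; omega)

/-- The transposed product. -/
theorem coeff_reflect_mul_momentPoly {p p' u i : ℕ} (hU : U.natDegree ≤ u) (h : p' + u ≤ p)
    (hi : i < p') :
    (reflect u U * momentPoly φ W p).coeff (u + i) = φ (W * U * X ^ i) := by
  have hUsum : W * U * X ^ i = ∑ k ∈ Finset.range (u + 1), U.coeff k • (W * X ^ (i + k)) := by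
    conv_lhs => rw [U.as_sum_range' (u + 1) (by omega)]
    rw [Finset.mul_sum, Finset.sum_mul]
    refine Finset.sum_congr rfl fun k _ => ?_
    rw [← C_mul_X_pow_eq_monomial, smul_eq_C_mul, pow_add]
    ring
  rw [hUsum, map_sum, coeff_mul, Finset.Nat.sum_antidiagonal_eq_sum_range_succ
    fun a c => (reflect u U).coeff a * (momentPoly φ W p).coeff c]
  rw [show (u + i).succ = (u + 1) + i by omega, Finset.sum_range_add,
    ← Finset.sum_range_reflect _ (u + 1)]
  have h0 : ∑ x ∈ Finset.range i, (reflect u U).coeff (u + 1 + x) *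
      (momentPoly φ W p).coeff (u + i - (u + 1 + x)) = 0 := by
    refine Finset.sum_eq_zero fun x _ => ?_
    rw [coeff_reflect, revAt_eq_self_of_lt (by omega),
      coeff_eq_zero_of_natDegree_lt (by omega), zero_mul]
  rw [h0, add_zero]
  refine Finset.sum_congr rfl fun k hk => ?_
  have hk := Finset.mem_range.1 hk
  rw [coeff_reflect, revAt_le (by omega), coeff_momentPoly, if_pos (by omega), map_smul,
    smul_eq_mul]
  congr 3 <;> [skip; congr 2] <;> omega

end Moment

section Tree

variable {F : Type u} [Field F] [Finite F] {E : Type*} [Field E] [Algebra F E] {Ω : Type v}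
  {ι : Type*} {b : Module.Basis ι F E} {M : ℕ → ℝ} {K : ℕ}

theorem SmallPoly.momentPoly {φ : Ω → E[X] →ₗ[E] E} {W : Ω → E[X]} {p n : ℕ}
    (hφ : ∀ ω g, fr F K g = g → Fr F K (φ ω g) = φ ω g) (hW : ∀ ω, fr F K (W ω) = W ω)
    (hpn : p ≤ n) (hn : 1 ≤ n) : SmallPoly F K n fun ω => momentPoly (φ ω) (W ω) p := by
  refine fun ω => ⟨?_, natDegree_momentPoly _ _ hpn hn⟩
  rw [fr_eq_iff]
  intro i
  rw [coeff_momentPoly]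
  split_ifs
  · exact hφ ω _ (by simp [hW])
  · simp

theorem fr_reflect (k u : ℕ) (f : E[X]) : fr F k (reflect u f) = reflect u (fr F k f) := by
  ext i
  simp [coeff_reflect]

theorem FrobLevel.middleProduct (hL : FrobLevel b M Ω K) {φ : Ω → E[X] →ₗ[E] E} {U W : Ω → E[X]}
    {p p' u n : ℕ} (hφ : ∀ ω g, fr F K g = g → Fr F K (φ ω g) = φ ω g)
    (hW : ∀ ω, fr F K (W ω) = W ω) (hU : SmallPoly F K (u + 1) U) (hp : p' + u ≤ p) (hpn : p ≤ n)
    (hun : u < n) :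
    Cost (KP b (fun ω => momentPoly (φ ω) (W ω) p) ∪ KP b U)
      (KP b fun ω => momentPoly (φ ω) (W ω * U ω) p') (10 * M (K * n)) := by
  have hR : KP b (fun ω => reflect u (U ω)) ⊆ KP b U ∪ Consts F Ω :=
    KP_subset_of_coeff fun i => .inl ⟨revAt u i, fun ω => coeff_reflect _ _ _⟩
  have hRs : SmallPoly F K n fun ω => reflect u (U ω) := fun ω =>
    ⟨by rw [fr_reflect, (hU ω).1], (natDegree_reflect_le.trans
      (max_le le_rfl (Nat.lt_succ_iff.1 (hU ω).2))).trans_lt hun⟩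
  have h := hL.mul n _ _ (by omega) hRs (SmallPoly.momentPoly hφ hW hpn (by omega))
  refine Cost.add_consts ((h.mono ?_ subset_rfl le_rfl).comp (l := 0)
    (Cost.of_subset_consts ?_ le_rfl) |>.mono subset_rfl subset_rfl (by simp))
  · refine Set.union_subset (hR.trans ?_) ?_
    · exact Set.union_subset_union_left _ Set.subset_union_right
    · exact Set.subset_union_left.trans Set.subset_union_left
  · refine (KP_subset_of_coeff (f := (fun ω => reflect u (U ω)) *
      fun ω => _root_.momentPoly (φ ω) (W ω) p) fun i => ?_).trans
      (Set.union_subset_union_left _ Set.subset_union_right)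
    by_cases hi : i < p'
    · refine .inl ⟨u + i, fun ω => ?_⟩
      rw [Pi.mul_apply, coeff_reflect_mul_momentPoly _ _ _ (Nat.lt_succ_iff.1 (hU ω).2) hp hi,
        coeff_momentPoly, if_pos hi]
    · exact .inr ⟨0, fun ω => by rw [coeff_momentPoly, if_neg hi]⟩

omit [Finite F] in
theorem IsMultiplicationTime.sum_block_le (hM : IsMultiplicationTime F M) (hK : 1 ≤ K)
    {n : ℕ → ℕ} (hn : ∀ c, 1 ≤ n c) (i j : ℕ) :
    ∑ a ∈ Finset.range (2 ^ j), M (K * ∑ c ∈ block i a, n c) ≤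
      M (K * ∑ c ∈ Finset.range (2 ^ (i + j)), n c) := by
  refine hM.sum_le _ (by simp) (fun a _ => ?_) ?_
  · obtain ⟨c, hc⟩ := block_nonempty i a
    exact Nat.mul_pos hK ((hn c).trans (Finset.single_le_sum (fun _ _ => Nat.zero_le _) hc))
  · rw [← Finset.mul_sum, sum_block, pow_add, mul_comm (2 ^ i)]

variable {f g : ℕ → Ω → E[X]} {n : ℕ → ℕ}

theorem SmallPoly.prod_block (hf : ∀ c, SmallPoly F K (n c) (f c)) (i a : ℕ) :
    SmallPoly F K (∑ c ∈ block i a, n c) (∏ c ∈ block i a, f c) :=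
  SmallPoly.prod (fun c _ => hf c) (by have := (block_nonempty i a).card_pos; omega)

theorem one_le_sum_block (hn : ∀ c, 1 ≤ n c) (i a : ℕ) : 1 ≤ ∑ c ∈ block i a, n c := by
  obtain ⟨c, hc⟩ := block_nonempty i a
  exact (hn c).trans (Finset.single_le_sum (fun _ _ => Nat.zero_le _) hc)

/-- The products of all blocks of the first `2 ^ k` polynomials, up to blocks of length `2 ^ i`. -/
def treeSet (b : Module.Basis ι F E) (f : ℕ → Ω → E[X]) (k i : ℕ) : Set (Ω → F) :=
  ⋃ i' ∈ Finset.range (i + 1), ⋃ a ∈ Finset.range (2 ^ (k - i')), KP b (∏ c ∈ block i' a, f c)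

omit [Finite F] in
theorem subset_treeSet {k i i' a : ℕ} (hi : i' ≤ i) (ha : a < 2 ^ (k - i')) :
    KP b (∏ c ∈ block i' a, f c) ⊆ treeSet b f k i := by
  intro x hx
  simp only [treeSet, Set.mem_iUnion, Finset.mem_range]
  exact ⟨i', by omega, a, ha, hx⟩

theorem FrobLevel.treeProduct (hL : FrobLevel b M Ω K) (hM : IsMultiplicationTime F M)
    (hn : ∀ c, 1 ≤ n c) (hf : ∀ c, SmallPoly F K (n c) (f c)) (k : ℕ) :
    ∀ i ≤ k, Cost (⋃ c ∈ Finset.range (2 ^ k), KP b (f c)) (treeSet b f k i)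
      (i * (10 * M (K * ∑ c ∈ Finset.range (2 ^ k), n c))) := by
  intro i
  induction i with
  | zero =>
    intro _
    refine Cost.of_subset ?_ (by simp)
    simp [treeSet, block_zero]
  | succ i ih =>
    intro hi
    have h := Cost.biUnion (S := treeSet b f k i) (Finset.range (2 ^ (k - (i + 1))))
      (fun a => KP b (∏ c ∈ block (i + 1) a, f c))
      (fun a => 10 * M (K * ∑ c ∈ block (i + 1) a, n c)) fun a ha => ?_
    · refine ((ih (by omega)).trans (h.mono Set.subset_union_right subset_rfl le_rfl)).mono
        subset_rfl ?_ ?_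
      · rw [treeSet, Finset.range_add_one, Finset.set_biUnion_insert, Set.union_comm]
        exact subset_rfl
      · have := hM.sum_block_le hL.pos hn (i + 1) (k - (i + 1))
        rw [Nat.add_sub_cancel' hi] at this
        rw [← Finset.mul_sum]
        push_cast
        linarith
    · have ha := Finset.mem_range.1 ha
      have hk : 2 ^ (k - i) = 2 * 2 ^ (k - (i + 1)) := by
        rw [← pow_succ']; congr 1; omega
      have hs := sum_block n i
      rw [block_succ, Finset.prod_union (block_disjoint (by omega)),
        Finset.sum_union (block_disjoint (by omega))]
      refine (hL.mul _ _ _ ?_ ((SmallPoly.prod_block hf _ _).mono ?_)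
        ((SmallPoly.prod_block hf _ _).mono ?_)).mono ?_ subset_rfl le_rfl
      · have := one_le_sum_block hn i (2 * a); omega
      · omega
      · omega
      · exact Set.union_subset (subset_treeSet le_rfl (by omega))
          (subset_treeSet le_rfl (by omega))

/-- Transposed products down a product tree. -/
theorem FrobLevel.treeMoments (hL : FrobLevel b M Ω K) (hM : IsMultiplicationTime F M)
    {φ : Ω → E[X] →ₗ[E] E} (hφ : ∀ ω g, fr F K g = g → Fr F K (φ ω g) = φ ω g)
    (hn : ∀ c, 1 ≤ n c) (hf : ∀ c, SmallPoly F K (n c) (f c)) (k : ℕ) :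
    ∀ j ≤ k, Cost (treeSet b f k k ∪ KP b fun ω => momentPoly (φ ω) 1
        (∑ c ∈ Finset.range (2 ^ k), (n c - 1)))
      (⋃ a ∈ Finset.range (2 ^ j), KP b fun ω => momentPoly (φ ω)
        (∏ c ∈ Finset.range (2 ^ k) \ block (k - j) a, f c ω) (∑ c ∈ block (k - j) a, (n c - 1)))
      (j * (20 * M (K * ∑ c ∈ Finset.range (2 ^ k), n c))) := by
  intro j
  induction j with
  | zero =>
    intro _
    refine Cost.of_subset ?_ (by simp)
    simp [block_root]
  | succ j ih =>
    intro hj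
    set i := k - (j + 1) with hi
    have hi1 : k - j = i + 1 := by omega
    rw [hi1] at ih
    have key : ∀ a ∈ Finset.range (2 ^ j), ∀ x y, block (i + 1) a = block i x ∪ block i y →
        Disjoint (block i x) (block i y) → x < 2 ^ (j + 1) → y < 2 ^ (j + 1) →
        Cost (treeSet b f k k ∪ KP b fun ω => momentPoly (φ ω)
          (∏ c ∈ Finset.range (2 ^ k) \ block (i + 1) a, f c ω)
          (∑ c ∈ block (i + 1) a, (n c - 1)))
        (KP b fun ω => momentPoly (φ ω) (∏ c ∈ Finset.range (2 ^ k) \ block i x, f c ω)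
          (∑ c ∈ block i x, (n c - 1))) (10 * M (K * ∑ c ∈ block (i + 1) a, n c)) := by
      intro a ha x y hxy hd hx hy
      have hyk : block i y ⊆ Finset.range (2 ^ k) := by
        have := block_subset (i := i) hy
        rwa [show i + (j + 1) = k by omega] at this
      have hprod : ∀ ω, ∏ c ∈ Finset.range (2 ^ k) \ block i x, f c ω =
          (∏ c ∈ Finset.range (2 ^ k) \ block (i + 1) a, f c ω) * (∏ c ∈ block i y, f c) ω := by
        intro ω
        rw [Finset.prod_apply, ← Finset.prod_union]
        · congr 1
          rw [hxy]
          ext z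
          simp only [Finset.mem_sdiff, Finset.mem_union, not_or]
          constructor
          · rintro ⟨h1, h2⟩
            by_cases hz : z ∈ block i y
            · exact .inr hz
            · exact .inl ⟨h1, h2, hz⟩
          · rintro (⟨h1, h2, -⟩ | h)
            · exact ⟨h1, h2⟩
            · exact ⟨hyk h, Finset.disjoint_right.1 hd h⟩
        · rw [hxy]
          exact Finset.disjoint_left.2 fun z hz hz' => (Finset.mem_sdiff.1 hz).2
            (Finset.mem_union_right _ hz')
      simp only [hprod]
      refine (hL.middleProduct (u := ∑ c ∈ block i y, (n c - 1))
        (p := ∑ c ∈ block (i + 1) a, (n c - 1)) hφ ?_ ?_ ?_ ?_ ?_).mono ?_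
        subset_rfl le_rfl
      · intro ω
        rw [map_prod]
        exact Finset.prod_congr rfl fun c _ => (hf c ω).1
      · refine SmallPoly.prod (fun c _ => hf c) ?_
        have : ∑ c ∈ block i y, n c = ∑ c ∈ block i y, (n c - 1) + (block i y).card := by
          rw [Finset.card_eq_sum_ones, ← Finset.sum_add_distrib]
          exact Finset.sum_congr rfl fun c _ => by have := hn c; omega
        omega
      · rw [hxy, Finset.sum_union hd]
      · exact Finset.sum_le_sum fun c _ => Nat.sub_le _ _
      · rw [hxy, Finset.sum_union hd]
        have h1 : ∑ c ∈ block i y, (n c - 1) ≤ ∑ c ∈ block i y, n c :=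
          Finset.sum_le_sum fun c _ => Nat.sub_le _ _
        have h2 := one_le_sum_block hn i x
        omega
      · refine Set.union_subset Set.subset_union_right (Set.Subset.trans ?_ Set.subset_union_left)
        exact subset_treeSet (by omega) (by rwa [show k - i = j + 1 by omega])
    have h := Cost.biUnion (S := treeSet b f k k ∪ ⋃ a ∈ Finset.range (2 ^ j), KP b fun ω =>
        momentPoly (φ ω) (∏ c ∈ Finset.range (2 ^ k) \ block (i + 1) a, f c ω)
          (∑ c ∈ block (i + 1) a, (n c - 1))) (Finset.range (2 ^ j))
      (fun a => KP b (fun ω => momentPoly (φ ω) (∏ c ∈ Finset.range (2 ^ k) \ block i (2 * a),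
          f c ω) (∑ c ∈ block i (2 * a), (n c - 1))) ∪
        KP b (fun ω => momentPoly (φ ω) (∏ c ∈ Finset.range (2 ^ k) \ block i (2 * a + 1),
          f c ω) (∑ c ∈ block i (2 * a + 1), (n c - 1))))
      (fun a => 10 * M (K * ∑ c ∈ block (i + 1) a, n c) +
        10 * M (K * ∑ c ∈ block (i + 1) a, n c)) fun a ha => ?_
    · refine ((ih (by omega)).comp (h.mono ?_ subset_rfl le_rfl)).mono subset_rfl ?_ ?_
      · exact Set.union_subset_union_left _ Set.subset_union_left
      · intro z hz
        simp only [Set.mem_iUnion, Finset.mem_range] at hz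
        obtain ⟨a, ha, hz⟩ := hz
        simp only [Set.mem_iUnion, Finset.mem_range]
        rw [pow_succ] at ha
        refine ⟨a / 2, by omega, ?_⟩
        rcases Nat.even_or_odd' a with ⟨x, rfl | rfl⟩
        · left; rwa [show 2 * x / 2 = x by omega]
        · right; rwa [show (2 * x + 1) / 2 = x by omega]
      · have := hM.sum_block_le hL.pos hn (i + 1) j
        rw [show i + 1 + j = k by omega] at this
        rw [Finset.sum_add_distrib, ← Finset.mul_sum]
        push_cast
        linarith
    · have ha' := Finset.mem_range.1 ha
      have hd := block_disjoint (i := i) (show 2 * a < 2 * a + 1 by omega)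
      rw [pow_succ] at key
      have hS : treeSet b f k k ∪ KP b (fun ω => momentPoly (φ ω)
          (∏ c ∈ Finset.range (2 ^ k) \ block (i + 1) a, f c ω)
          (∑ c ∈ block (i + 1) a, (n c - 1))) ⊆ treeSet b f k k ∪ ⋃ a ∈ Finset.range (2 ^ j),
          KP b fun ω => momentPoly (φ ω)
          (∏ c ∈ Finset.range (2 ^ k) \ block (i + 1) a, f c ω)
          (∑ c ∈ block (i + 1) a, (n c - 1)) :=
        Set.union_subset_union_right _ (Set.subset_biUnion_of_mem (u := fun a => KP b fun ω =>
          momentPoly (φ ω) (∏ c ∈ Finset.range (2 ^ k) \ block (i + 1) a, f c ω)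
          (∑ c ∈ block (i + 1) a, (n c - 1))) ha)
      exact ((key a ha _ _ (block_succ i a) hd (by omega) (by omega)).mono hS subset_rfl
        le_rfl).union ((key a ha _ _ ((block_succ i a).trans (Finset.union_comm _ _)) hd.symm
          (by omega) (by omega)).mono hS subset_rfl le_rfl)

theorem SmallPoly.fracNum (hn : ∀ c, 1 ≤ n c) (hf : ∀ c, SmallPoly F K (n c) (f c))
    (hg : ∀ c, SmallPoly F K (n c) (g c)) (s : Finset ℕ) (hs : s.Nonempty) :
    SmallPoly F K (∑ c ∈ s, n c) (fracNum f g s) := by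
  have hsum : ∀ t : Finset ℕ, t ⊆ s →
      SmallPoly F K (∑ c ∈ s, n c) (∑ c ∈ t, g c * ∏ c' ∈ s.erase c, f c') := by
    intro t
    induction t using Finset.induction_on with
    | empty =>
      intro _ ω
      obtain ⟨c, hc⟩ := hs
      refine ⟨by simp, ?_⟩
      have := (hn c).trans (Finset.single_le_sum (f := n) (fun _ _ => Nat.zero_le _) hc)
      simpa using Nat.pos_of_ne_zero (by omega)
    | insert c t hc ih =>
      intro ht
      rw [Finset.insert_subset_iff] at ht
      rw [Finset.sum_insert hc]
      refine SmallPoly.add ?_ (ih ht.2)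
      have h1 := Finset.add_sum_erase s n ht.1
      refine (hg c).mul (SmallPoly.prod (N := ∑ c ∈ s.erase c, n c + 1)
        (fun c _ => hf c) (by omega)) (by omega)
  exact hsum s subset_rfl

/-- Sums of fractions up a product tree. -/
theorem FrobLevel.treeFractions (hL : FrobLevel b M Ω K) (hM : IsMultiplicationTime F M)
    (hn : ∀ c, 1 ≤ n c) (hf : ∀ c, SmallPoly F K (n c) (f c))
    (hg : ∀ c, SmallPoly F K (n c) (g c)) (k : ℕ) :
    ∀ i ≤ k, Cost (treeSet b f k k ∪ ⋃ c ∈ Finset.range (2 ^ k), KP b (g c))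
      (⋃ a ∈ Finset.range (2 ^ (k - i)), KP b (fracNum f g (block i a)))
      (i * (21 * M (K * ∑ c ∈ Finset.range (2 ^ k), n c))) := by
  intro i
  induction i with
  | zero =>
    intro _
    refine Cost.of_subset ?_ (by simp)
    simp [fracNum, block_zero]
  | succ i ih =>
    intro hi
    have h := Cost.biUnion (S := treeSet b f k k ∪ ⋃ a ∈ Finset.range (2 ^ (k - i)),
        KP b (fracNum f g (block i a))) (Finset.range (2 ^ (k - (i + 1))))
      (fun a => KP b (fracNum f g (block (i + 1) a)))
      (fun a => 21 * M (K * ∑ c ∈ block (i + 1) a, n c)) fun a ha => ?_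
    · refine ((ih (by omega)).comp (h.mono ?_ subset_rfl le_rfl)).mono subset_rfl subset_rfl ?_
      · exact Set.union_subset_union_left _ Set.subset_union_left
      · have := hM.sum_block_le hL.pos hn (i + 1) (k - (i + 1))
        rw [Nat.add_sub_cancel' hi] at this
        rw [← Finset.mul_sum]
        push_cast
        linarith
    · have ha := Finset.mem_range.1 ha
      have hk : 2 ^ (k - i) = 2 * 2 ^ (k - (i + 1)) := by
        rw [← pow_succ']; congr 1; omega
      have hs1 := one_le_sum_block hn i (2 * a)
      have hs2 := one_le_sum_block hn i (2 * a + 1)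
      have hd : Disjoint (block i (2 * a)) (block i (2 * a + 1)) := block_disjoint (by omega)
      have hsum : ∑ c ∈ block (i + 1) a, n c = ∑ c ∈ block i (2 * a), n c +
          ∑ c ∈ block i (2 * a + 1), n c := by
        rw [block_succ, Finset.sum_union hd]
      set N := ∑ c ∈ block (i + 1) a, n c
      have hF : ∀ x < 2 ^ (k - i), KP b (∏ c ∈ block i x, f c) ⊆ treeSet b f k k ∪
          ⋃ a ∈ Finset.range (2 ^ (k - i)), KP b (fracNum f g (block i a)) := fun x hx =>
        (subset_treeSet (by omega) hx).trans Set.subset_union_left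
      have hG : ∀ x < 2 ^ (k - i), KP b (fracNum f g (block i x)) ⊆ treeSet b f k k ∪
          ⋃ a ∈ Finset.range (2 ^ (k - i)), KP b (fracNum f g (block i a)) := fun x hx =>
        (Set.subset_biUnion_of_mem (u := fun a => KP b (fracNum f g (block i a)))
          (Finset.mem_range.2 hx)).trans Set.subset_union_right
      have hfs := fun x => SmallPoly.prod_block (K := K) hf i x
      have hgs := fun x => SmallPoly.fracNum (K := K) hn hf hg (block i x) (block_nonempty i x)
      have h1 := (hL.mul N _ _ (by omega) ((hgs (2 * a)).mono (by omega))
        ((hfs (2 * a + 1)).mono (by omega))).mono (Set.union_subset (hG _ (by omega))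
          (hF _ (by omega))) subset_rfl le_rfl
      have h2 := (hL.mul N _ _ (by omega) ((hgs (2 * a + 1)).mono (by omega))
        ((hfs (2 * a)).mono (by omega))).mono (Set.union_subset (hG _ (by omega))
          (hF _ (by omega))) subset_rfl le_rfl
      have h3 := hL.add (((hgs (2 * a)).mul (hfs (2 * a + 1)) (N := N) (by omega)))
        (((hgs (2 * a + 1)).mul (hfs (2 * a)) (N := N) (by omega)))
      rw [block_succ, fracNum_union f g hd]
      refine ((h1.union h2).comp (h3.mono Set.subset_union_right subset_rfl le_rfl)).mono
        subset_rfl subset_rfl ?_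
      have := hM.le_self (K * N) (Nat.mul_pos hL.pos (by omega))
      push_cast at this
      linarith

end Tree

section Quotient

variable {R : Type*} [CommRing R]

/-- The quotient of `f` by `X ^ u`. -/
noncomputable def shiftDown (u : ℕ) (f : R[X]) : R[X] :=
  ∑ i ∈ Finset.range (f.natDegree + 1), monomial i (f.coeff (i + u))

theorem coeff_shiftDown (u : ℕ) (f : R[X]) (i : ℕ) :
    (shiftDown u f).coeff i = f.coeff (i + u) := by
  simp only [shiftDown, finsetSum_coeff, coeff_monomial, Finset.sum_ite_eq', Finset.mem_range]
  split_ifs with h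
  · rfl
  · exact (coeff_eq_zero_of_natDegree_lt (by omega)).symm

theorem degree_sub_shiftDown_lt (u : ℕ) (f : R[X]) : degree (f - shiftDown u f * X ^ u) < (u : WithBot ℕ) := by
  rw [degree_lt_iff_coeff_zero]
  intro m hm
  rw [coeff_sub, coeff_mul_X_pow', if_pos hm, coeff_shiftDown, Nat.sub_add_cancel hm, sub_self]

theorem degree_shiftDown_lt {u n : ℕ} {f : R[X]} (h : degree f < ((u + n : ℕ) : WithBot ℕ)) :
    degree (shiftDown u f) < (n : WithBot ℕ) := by
  rw [degree_lt_iff_coeff_zero] at h ⊢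
  intro m hm
  rw [coeff_shiftDown]
  exact h _ (by omega)

/-- The quotient by a monic polynomial from the quotient of a power of `X`. -/
theorem divByMonic_eq_shiftDown [Nontrivial R] {Q c : R[X]} {D N : ℕ} (hQ : Q.Monic)
    (hD : Q.natDegree = D) (hc : degree c < ((D + N : ℕ) : WithBot ℕ)) :
    c /ₘ Q = shiftDown N (shiftDown D c * (X ^ (D + N) /ₘ Q)) := by
  have hQ' : Q.degree = D := by rw [degree_eq_natDegree hQ.ne_zero, hD]
  set J := X ^ (D + N) /ₘ Q
  set u := shiftDown N (shiftDown D c * J)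
  set r := (X ^ (D + N) : R[X]) %ₘ Q
  have hr : r.degree < D := hQ' ▸ degree_modByMonic_lt _ hQ
  have hJ : Q * J = X ^ (D + N) - r := by
    rw [eq_sub_iff_add_eq, add_comm]; exact modByMonic_add_div _ _
  have key : X ^ N * (c - Q * u) = shiftDown D c * r + (c - shiftDown D c * X ^ D) * X ^ N +
      Q * (shiftDown D c * J - u * X ^ N) := by
    linear_combination -shiftDown D c * hJ
  have hmul : ∀ {f g : R[X]} {m n : ℕ}, f.degree < m → g.degree ≤ n →
      (f * g).degree < (m + n : ℕ) := by
    intro f g m n hf hg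
    rcases Nat.eq_zero_or_pos m with rfl | hm
    · have hf0 : f = 0 := by
        rw [← degree_eq_bot]
        exact Nat.WithBot.lt_zero_iff.1 (by exact_mod_cast hf)
      rw [hf0, zero_mul, degree_zero]
      exact WithBot.bot_lt_coe _
    have hf' : f.degree ≤ (m - 1 : ℕ) := by
      rw [degree_le_iff_coeff_zero]
      rw [degree_lt_iff_coeff_zero] at hf
      exact fun k hk => hf k (by have : m - 1 < k := by exact_mod_cast hk
                                 omega)
    refine (degree_mul_le_of_le hf' hg).trans_lt ?_
    exact_mod_cast (by omega : m - 1 + n < m + n)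
  have hdeg : degree (X ^ N * (c - Q * u)) < ((D + N : ℕ) : WithBot ℕ) := by
    rw [key]
    refine (degree_add_le _ _).trans_lt (max_lt ((degree_add_le _ _).trans_lt (max_lt ?_ ?_)) ?_)
    · rw [add_comm D N]
      exact hmul (degree_shiftDown_lt hc) hr.le
    · exact hmul (degree_sub_shiftDown_lt _ _) (degree_X_pow_le _)
    · rw [mul_comm, add_comm D N]
      exact hmul (degree_sub_shiftDown_lt _ _) hQ'.le
  have hlt : degree (c - Q * u) < degree Q := by
    rw [hQ']
    rw [degree_lt_iff_coeff_zero] at hdeg ⊢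
    intro m hm
    have := hdeg (m + N) (by omega)
    rwa [mul_comm, coeff_mul_X_pow] at this
  exact (div_modByMonic_unique u _ hQ ⟨by ring, hlt⟩).1

end Quotient

theorem coeff_eval_X_pow {R : Type*} [CommRing R] {B : R[X][X]} {D : ℕ}
    (hB : ∀ i, (B.coeff i).natDegree < D) (i k : ℕ) (hk : k < D) :
    (B.eval (X ^ D)).coeff (D * i + k) = (B.coeff i).coeff k := by
  rw [eval_eq_sum_range' (n := max (B.natDegree + 1) (i + 1)) (by omega), finsetSum_coeff,
    Finset.sum_eq_single i]
  · rw [← pow_mul, coeff_mul_X_pow', if_pos (by omega), Nat.add_sub_cancel_left]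
  · intro j _ hj
    rw [← pow_mul, coeff_mul_X_pow']
    split_ifs with h
    · refine coeff_eq_zero_of_natDegree_lt ((hB j).trans_le ?_)
      have hji : j < i := by
        by_contra hij
        have := Nat.mul_le_mul_left D (show i + 1 ≤ j by omega)
        rw [Nat.mul_add, mul_one] at this
        omega
      have := Nat.mul_le_mul_left D (show j + 1 ≤ i by omega)
      rw [Nat.mul_add, mul_one] at this
      omega
    · rfl
  · intro h
    exact absurd (Finset.mem_range.2 (by omega)) h

section BaseField

variable {F : Type u} [Field F] {Ω : Type v} {M : ℕ → ℝ}

/-- The coefficients of a polynomial over `F`, as functions of the input. -/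
def KF (f : Ω → F[X]) : Set (Ω → F) := Set.range fun i ω => (f ω).coeff i

theorem KF_const (f : F[X]) : KF (fun _ : Ω => f) ⊆ Consts F Ω := by
  rintro _ ⟨i, rfl⟩
  exact ⟨_, rfl⟩

theorem polyOfCoeffs_coeff {n : ℕ} {f : F[X]} (h : f.natDegree < n) :
    polyOfCoeffs (fun i : Fin n => f.coeff i) = f := by
  rw [polyOfCoeffs, Fin.sum_univ_eq_sum_range fun i => C (f.coeff i) * X ^ i]
  exact (f.as_sum_range_C_mul_X_pow' h).symm

theorem Cost.polyMul [Finite F] (hM : IsMultiplicationTime F M) {n : ℕ} (hn : 1 ≤ n)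
    {f g : Ω → F[X]} (hf : ∀ ω, (f ω).natDegree < n) (hg : ∀ ω, (g ω).natDegree < n) :
    Cost (KF f ∪ KF g) (KF (f * g)) (M n) := by
  obtain ⟨P, hP⟩ := hM.mul n hn
  have h := Cost.of_program (S := KF f ∪ KF g) (k := M n) P
    (Sum.elim (fun i ω => (f ω).coeff i) (fun i ω => (g ω).coeff i))
    ((List.range (2 * n - 1)).map fun i ω => (f ω * g ω).coeff i) ?_ ?_
  · refine (h.comp (l := 0) (Cost.of_subset_consts ?_ le_rfl)).mono subset_rfl subset_rfl (by simp)
    rintro _ ⟨i, rfl⟩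
    by_cases hi : i < 2 * n - 1
    · refine .inl (.inr ?_)
      simp only [Set.mem_ofPred_eq, List.mem_map, List.mem_range]
      exact ⟨i, hi, rfl⟩
    · refine .inr ⟨0, funext fun ω => ?_⟩
      refine (coeff_eq_zero_of_natDegree_lt ?_).symm
      have := natDegree_mul_le (p := f ω) (q := g ω)
      have := hf ω
      have := hg ω
      simp only [Pi.mul_apply]
      omega
  · rintro (i | i)
    · exact .inl ⟨i, rfl⟩
    · exact .inr ⟨i, rfl⟩
  · intro ω
    obtain ⟨k, hk, hk'⟩ := hP (fun i => (f ω).coeff i) (fun i => (g ω).coeff i)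
    refine ⟨k, ?_, hk'⟩
    rw [polyOfCoeffs_coeff (hf ω), polyOfCoeffs_coeff (hg ω)] at hk
    convert hk using 1
    · funext i
      cases i <;> rfl
    · simp [_root_.coeffList, Function.comp_def]

/-- Reduction modulo a constant monic polynomial. -/
theorem Cost.modByMonic [Finite F] (hM : IsMultiplicationTime F M) {D : ℕ} (hD : 1 ≤ D) {Q : F[X]}
    (hQ : Q.Monic) (hQD : Q.natDegree = D) {f : Ω → F[X]}
    (hf : ∀ ω, (f ω).natDegree < 2 * D - 1) :
    Cost (KF f) (KF fun ω => f ω %ₘ Q) (3 * M D) := by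
  have hQ' : Q.degree = D := by rw [degree_eq_natDegree hQ.ne_zero, hQD]
  have hnat : ∀ {g : F[X]}, g.degree < D → g.natDegree < D := by
    intro g hg
    rcases eq_or_ne g 0 with rfl | h0
    · simpa using Nat.pos_of_ne_zero (by omega)
    · exact (natDegree_lt_iff_degree_lt h0).2 hg
  set J := X ^ (D + (D - 1)) /ₘ Q
  have hJ : J.natDegree < D := by
    rw [natDegree_divByMonic _ hQ, natDegree_X_pow]; omega
  have hfd : ∀ ω, (f ω).degree < (D + (D - 1) : ℕ) := fun ω =>
    lt_of_le_of_lt degree_le_natDegree (by exact_mod_cast (hf ω).trans_le (by omega))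
  have hhi : ∀ ω, (shiftDown D (f ω)).natDegree < D := fun ω =>
    hnat ((degree_shiftDown_lt (hfd ω)).trans_le (by exact_mod_cast Nat.sub_le D 1))
  have h1 := Cost.polyMul hM hD hhi (fun _ => hJ)
  have hq : ∀ ω, (f ω /ₘ Q).natDegree < D := fun ω => by
    rw [natDegree_divByMonic _ hQ]
    have := hf ω
    omega
  have hlo : (Q - X ^ D).natDegree < D := by
    refine hnat ?_
    rw [← hQ']
    refine degree_sub_lt_left ?_ hQ.ne_zero ?_
    · rw [hQ', degree_X_pow]
    · rw [hQ.leadingCoeff, (monic_X_pow D).leadingCoeff]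
  have h2 := Cost.polyMul hM hD hq (fun _ => hlo)
  have hcoeff : ∀ ω i, i < D → (f ω %ₘ Q).coeff i =
      (f ω).coeff i - (f ω /ₘ Q * (Q - X ^ D)).coeff i := by
    intro ω i hi
    have := congrArg (fun g => coeff g i) (modByMonic_add_div (f ω) Q)
    simp only [coeff_add] at this
    rw [← this, mul_sub, coeff_sub, coeff_mul_X_pow', if_neg (by omega), mul_comm]
    ring
  have h3 := Cost.biUnion (S := KF f ∪ KF ((fun ω => f ω /ₘ Q) * fun _ => Q - X ^ D))
    (Finset.range D) (fun i => {fun ω => (f ω %ₘ Q).coeff i}) (fun _ => 1) fun i hi => by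
      simp only [hcoeff _ i (Finset.mem_range.1 hi)]
      exact Cost.sub (.inl ⟨i, rfl⟩) (.inr ⟨i, rfl⟩)
  have hA : KF (fun ω => shiftDown D (f ω)) ∪ KF (fun _ : Ω => J) ⊆ KF f ∪ Consts F Ω := by
    refine Set.union_subset_union ?_ (KF_const J)
    rintro _ ⟨i, rfl⟩
    exact ⟨i + D, by simp [coeff_shiftDown]⟩
  have hB : KF (fun ω => f ω /ₘ Q) ∪ KF (fun _ : Ω => Q - X ^ D) ⊆
      KF ((fun ω => shiftDown D (f ω)) * fun _ => J) ∪ Consts F Ω := by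
    refine Set.union_subset_union ?_ (KF_const _)
    rintro _ ⟨i, rfl⟩
    refine ⟨i + (D - 1), funext fun ω => ?_⟩
    simp only [divByMonic_eq_shiftDown hQ hQD (hfd ω)]
    rw [coeff_shiftDown]
    rfl
  have hcs : ∀ ω i, D ≤ i → (f ω %ₘ Q).coeff i = 0 := fun ω i hi =>
    coeff_eq_zero_of_degree_lt ((degree_modByMonic_lt _ hQ).trans_le (by rw [hQ']; exact_mod_cast hi))
  refine Cost.add_consts ?_
  refine ((h1.mono hA subset_rfl le_rfl).trans ((h2.mono (hB.trans ?_) subset_rfl le_rfl).comp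
    ((h3.mono ?_ subset_rfl le_rfl).comp (l := 0) (Cost.of_subset_consts ?_ le_rfl)))).mono
    subset_rfl Set.subset_union_right ?_
  · exact Set.union_subset Set.subset_union_right
      (Set.subset_union_right.trans Set.subset_union_left)
  · exact Set.union_subset ((Set.subset_union_left.trans Set.subset_union_left).trans
      Set.subset_union_left) Set.subset_union_right
  · rintro _ ⟨i, rfl⟩
    by_cases hi : i < D
    · refine .inl (.inr ?_)
      simp only [Set.mem_iUnion, Finset.mem_range]
      exact ⟨i, hi, rfl⟩
    · exact .inr ⟨0, funext fun ω => (hcs ω i (by omega)).symm⟩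
  · have := hM.le_self D hD
    simp only [Finset.sum_const, Finset.card_range, nsmul_eq_mul, mul_one]
    linarith

end BaseField

section Kronecker

variable {F : Type u} [Field F] [Finite F] {E : Type*} [Field E] [Algebra F E] {Ω : Type v}
  {ι : Type*} {b : Module.Basis ι F E} {M : ℕ → ℝ} {K : ℕ}

theorem FrobLevel.of_powers (hM : IsMultiplicationTime F M) (hK : 1 ≤ K) {Q : F[X]} (hQ : Q.Monic)
    (hQK : Q.natDegree = K) {y : E} (hy : aeval y Q = 0) (σ : ℕ → ι)
    (hinj : Set.InjOn σ (Set.Iio K)) (hσ : ∀ k < K, b (σ k) = y ^ k)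
    (hspan : ∀ z, Fr F K z = z → z ∈ Submodule.span F (Set.range fun k : Fin K => y ^ (k : ℕ))) :
    FrobLevel b M Ω K := by
  classical
  have hQ' : Q.degree = K := by rw [degree_eq_natDegree hQ.ne_zero, hQK]
  have hrepr : ∀ g : F[X], g.natDegree < K → ∀ j,
      b.repr (aeval y g) j = ∑ k ∈ Finset.range K, if σ k = j then g.coeff k else 0 := by
    intro g hg j
    rw [aeval_eq_sum_range' hg, map_sum, Finsupp.finsetSum_apply]
    refine Finset.sum_congr rfl fun k hk => ?_
    rw [← hσ k (Finset.mem_range.1 hk)]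
    simp [Finsupp.single_apply]
  have hreprσ : ∀ g : F[X], g.natDegree < K → ∀ k < K, b.repr (aeval y g) (σ k) = g.coeff k := by
    intro g hg k hk
    rw [hrepr g hg, Finset.sum_eq_single k]
    · simp
    · intro k' hk' hne
      rw [if_neg]
      exact fun h => hne (hinj (Finset.mem_range.1 hk') hk h)
    · simp [hk]
  have hrepr0 : ∀ g : F[X], g.natDegree < K → ∀ j ∉ (Finset.range K).image σ,
      b.repr (aeval y g) j = 0 := by
    intro g hg j hj
    rw [hrepr g hg]
    refine Finset.sum_eq_zero fun k hk => if_neg ?_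
    rintro rfl
    exact hj (Finset.mem_image_of_mem _ hk)
  set L : E → F[X] := fun z => ∑ k ∈ Finset.range K, monomial k (b.repr z (σ k)) with hLdef
  have hLcoeff : ∀ z k, (L z).coeff k = if k < K then b.repr z (σ k) else 0 := by
    intro z k
    simp [L, coeff_monomial]
  have hLdeg : ∀ z, (L z).natDegree < K := by
    intro z
    refine lt_of_le_of_lt (natDegree_sum_le_of_forall_le (n := K - 1) _ _ fun m hm => ?_)
      (by omega : K - 1 < K)
    exact (natDegree_monomial_le _).trans (by have := Finset.mem_range.1 hm; omega)
  have hLz : ∀ z, Fr F K z = z → aeval y (L z) = z := by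
    intro z hz
    have : ∃ g : F[X], g.natDegree < K ∧ aeval y g = z := by
      obtain ⟨c, hc⟩ := (Submodule.mem_span_range_iff_exists_fun F).1 (hspan z hz)
      refine ⟨∑ k : Fin K, monomial (k : ℕ) (c k), ?_, ?_⟩
      · refine lt_of_le_of_lt (natDegree_sum_le_of_forall_le (n := K - 1) _ _ fun m hm => ?_)
          (by omega : K - 1 < K)
        exact (natDegree_monomial_le _).trans (by omega)
      · rw [← hc, map_sum]
        refine Finset.sum_congr rfl fun k _ => ?_
        rw [aeval_monomial, Algebra.smul_def]
    obtain ⟨g, hg, rfl⟩ := this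
    congr 1
    ext k
    rw [hLcoeff]
    split_ifs with hk
    · exact hreprσ g hg k hk
    · exact (coeff_eq_zero_of_natDegree_lt (by omega)).symm
  refine ⟨hK, ⟨(Finset.range K).image σ, ?_, fun z hz j hj => ?_⟩, ?_⟩
  · rw [Finset.card_image_of_injOn, Finset.card_range]
    simpa [Set.InjOn] using hinj
  · rw [← hLz z hz]
    exact hrepr0 _ (hLdeg z) j hj
  intro m f g hm hf hg
  set B : E[X] → F[X][X] := fun p => ∑ i ∈ Finset.range m, monomial i (L (p.coeff i)) with hBdef
  have hBcoeff : ∀ p i, (B p).coeff i = if i < m then L (p.coeff i) else 0 := by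
    intro p i
    simp [B, coeff_monomial]
  have hBdeg : ∀ p i, ((B p).coeff i).natDegree < K := by
    intro p i
    rw [hBcoeff]
    split_ifs
    · exact hLdeg _
    · simpa using Nat.pos_of_ne_zero (by omega)
  have hBnat : ∀ p, (B p).natDegree < m := by
    intro p
    refine lt_of_le_of_lt (natDegree_sum_le_of_forall_le (n := m - 1) _ _ fun i hi => ?_)
      (by omega : m - 1 < m)
    exact (natDegree_monomial_le _).trans (by have := Finset.mem_range.1 hi; omega)
  have hBmap : ∀ {p : Ω → E[X]} (_ : SmallPoly F K m p) (ω : Ω),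
      (B (p ω)).map (aeval y : F[X] →ₐ[F] E).toRingHom = p ω := by
    intro p hp ω
    ext i
    rw [coeff_map, hBcoeff]
    split_ifs with hi
    · exact hLz _ (by rw [← coeff_fr, (hp ω).1])
    · rw [map_zero, coeff_eq_zero_of_natDegree_lt ((hp ω).2.trans_le (not_lt.1 hi))]
  have hBe : ∀ p, ((B p).eval (X ^ (2 * K))).natDegree < 2 * K * m := by
    intro p
    rw [eval_eq_sum_range' (hBnat p)]
    refine lt_of_le_of_lt (natDegree_sum_le_of_forall_le (n := 2 * K * m - 1) _ _ fun i hi => ?_)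
      (Nat.sub_lt (by positivity) one_pos)
    have hi := Finset.mem_range.1 hi
    rw [← pow_mul]
    refine (natDegree_mul_le.trans (Nat.add_le_add_left (natDegree_X_pow_le _) _)).trans ?_
    have h1 := hBdeg p i
    have h2 := Nat.mul_le_mul_left (2 * K) (show i + 1 ≤ m by omega)
    rw [Nat.mul_add, mul_one] at h2
    omega
  have hBKF : ∀ {p : Ω → E[X]}, KF (fun ω => (B (p ω)).eval (X ^ (2 * K))) ⊆
      KP b p ∪ Consts F Ω := by
    rintro p _ ⟨n, rfl⟩
    have hn : ∀ ω, ((B (p ω)).eval (X ^ (2 * K))).coeff n =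
        ((B (p ω)).coeff (n / (2 * K))).coeff (n % (2 * K)) := by
      intro ω
      conv_lhs => rw [← Nat.div_add_mod n (2 * K)]
      exact coeff_eval_X_pow (fun i => (hBdeg _ i).trans_le (by omega)) _ _
        (Nat.mod_lt _ (by omega))
    simp only [hn, hBcoeff]
    by_cases h1 : n / (2 * K) < m
    · by_cases h2 : n % (2 * K) < K
      · refine .inl ⟨(n / (2 * K), σ (n % (2 * K))), funext fun ω => ?_⟩
        simp [h1, h2, hLcoeff]
      · exact .inr ⟨0, funext fun ω => by simp [h1, h2, hLcoeff]⟩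
    · exact .inr ⟨0, funext fun ω => by simp [h1]⟩
  set H : Ω → F[X][X] := fun ω => B (f ω) * B (g ω) with hH
  have hHdeg : ∀ ω i, ((H ω).coeff i).natDegree < 2 * K - 1 := by
    intro ω i
    rw [hH, coeff_mul]
    refine lt_of_le_of_lt (natDegree_sum_le_of_forall_le (n := 2 * K - 2) _ _ fun x _ => ?_)
      (by omega)
    have h1 := hBdeg (f ω) x.1
    have h2 := hBdeg (g ω) x.2
    exact natDegree_mul_le.trans (by omega)
  have hmul := Cost.polyMul (Ω := Ω) hM (n := 2 * K * m) (Nat.mul_pos (by omega) hm)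
    (fun ω => hBe (f ω)) (fun ω => hBe (g ω))
  have hHKF : ∀ i, KF (fun ω => (H ω).coeff i) ⊆ KF ((fun ω => (B (f ω)).eval (X ^ (2 * K))) *
      fun ω => (B (g ω)).eval (X ^ (2 * K))) ∪ Consts F Ω := by
    rintro i _ ⟨k, rfl⟩
    by_cases hk : k < 2 * K
    · refine .inl ⟨2 * K * i + k, funext fun ω => ?_⟩
      simp only [Pi.mul_apply]
      rw [← eval_mul]
      exact coeff_eval_X_pow (fun i => (hHdeg ω i).trans_le (by omega)) i k hk
    · refine .inr ⟨0, funext fun ω => ?_⟩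
      exact (coeff_eq_zero_of_natDegree_lt ((hHdeg ω i).trans_le (by omega))).symm
  have hred := Cost.biUnion (S := KF ((fun ω => (B (f ω)).eval (X ^ (2 * K))) *
      fun ω => (B (g ω)).eval (X ^ (2 * K))) ∪ Consts F Ω) (Finset.range (2 * m))
    (fun i => KF fun ω => (H ω).coeff i %ₘ Q) (fun _ => 3 * M K) fun i _ =>
      (Cost.modByMonic hM hK hQ hQK fun ω => hHdeg ω i).mono (hHKF i) subset_rfl le_rfl
  refine Cost.add_consts (((hmul.mono ?_ subset_rfl le_rfl).comp ((hred.mono ?_ subset_rfl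
    le_rfl).comp (l := 0) (Cost.of_subset_consts ?_ le_rfl))).mono subset_rfl subset_rfl ?_)
  · refine Set.union_subset (hBKF.trans ?_) (hBKF.trans ?_)
    · exact Set.union_subset_union_left _ Set.subset_union_left
    · exact Set.union_subset_union_left _ Set.subset_union_right
  · exact Set.union_subset Set.subset_union_right
      (Set.subset_union_right.trans Set.subset_union_left)
  · rintro _ ⟨⟨i, j⟩, rfl⟩
    have hfg : ∀ ω, ((f * g) ω).coeff i = aeval y ((H ω).coeff i %ₘ Q) := by
      intro ω
      rw [aeval_modByMonic_eq_self_of_root hy, Pi.mul_apply]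
      conv_lhs => rw [← hBmap hf ω, ← hBmap hg ω]
      rw [← Polynomial.map_mul, coeff_map]
      rfl
    have hdeg : ∀ ω, ((H ω).coeff i %ₘ Q).natDegree < K := by
      intro ω
      have := natDegree_modByMonic_lt ((H ω).coeff i) hQ (by rintro rfl; simp at hQK; omega)
      omega
    simp only [hfg]
    by_cases hj : ∃ k < K, σ k = j
    · obtain ⟨k, hk, rfl⟩ := hj
      simp only [hreprσ _ (hdeg _) k hk]
      by_cases hi : i < 2 * m
      · refine .inl (.inr ?_)
        simp only [Set.mem_iUnion, Finset.mem_range]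
        exact ⟨i, hi, k, rfl⟩
      · refine .inr ⟨0, funext fun ω => ?_⟩
        have h0 : (H ω).coeff i = 0 := by
          refine coeff_eq_zero_of_natDegree_lt ?_
          have h1 := hBnat (f ω)
          have h2 := hBnat (g ω)
          have := natDegree_mul_le (p := B (f ω)) (q := B (g ω))
          simp only [hH]
          omega
        simp [h0]
    · refine .inr ⟨0, funext fun ω => ?_⟩
      refine (hrepr0 _ (hdeg ω) j ?_).symm
      simpa using hj
  · have h1 : M (2 * K * m) ≤ (2 : ℝ) ^ 2 * M (K * m) := by
      exact_mod_cast hM.le_sq_mul (k := 2) (Nat.mul_pos (by omega) hm) (Nat.mul_pos hK hm)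
        (by rw [mul_assoc])
    have h2 : (m : ℝ) * M K ≤ M (K * m) := hM.nat_mul_le hm hK (by rw [mul_comm])
    simp only [Finset.sum_const, Finset.card_range, nsmul_eq_mul]
    push_cast
    linarith

end Kronecker

section Fixed

variable {F : Type*} [Field F] [Finite F] {E : Type*} [Field E] [Algebra F E]

theorem Fr_natDegree_minpoly [FiniteDimensional F E] (v : E) :
    Fr F (minpoly F v).natDegree v = v := by
  have hv : IsIntegral F v := Algebra.IsIntegral.isIntegral v
  have : Finite E := Module.finite_of_finite F
  have hcard : Nat.card (IntermediateField.adjoin F {v}) =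
      Nat.card F ^ (minpoly F v).natDegree := by
    rw [Module.natCard_eq_pow_finrank (K := F), IntermediateField.adjoin.finrank hv]
  have : Fintype (IntermediateField.adjoin F {v}) := Fintype.ofFinite _
  have h := FiniteField.pow_card (IntermediateField.AdjoinSimple.gen F v)
  rw [Fintype.card_eq_nat_card, hcard] at h
  rw [Fr_apply]
  simpa using congrArg (algebraMap (IntermediateField.adjoin F {v}) E) h

/-- The fixed points of the `K`-th power of Frobenius are contained in every space of dimension `K`
that consists of fixed points. -/
theorem mem_of_Fr_eq [FiniteDimensional F E] {K : ℕ} (hK : 1 ≤ K) (V : Submodule F E)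
    (hV : Module.finrank F V = K) (h : ∀ z ∈ V, Fr F K z = z) {z : E} (hz : Fr F K z = z) :
    z ∈ V := by
  classical
  have : Finite E := Module.finite_of_finite F
  have : Fintype E := Fintype.ofFinite E
  have hq : 1 < Nat.card F := Finite.one_lt_card
  have hqK : 1 < Nat.card F ^ K := Nat.one_lt_pow (by omega) hq
  have hp : (X ^ Nat.card F ^ K - X : E[X]) ≠ 0 := FiniteField.X_pow_card_sub_X_ne_zero E hqK
  have hsub : (V : Set E).toFinset ⊆ (X ^ Nat.card F ^ K - X : E[X]).roots.toFinset := by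
    intro y hy
    have hy := h y (by simpa using hy)
    rw [Fr_apply] at hy
    simp [hp, hy]
  have hcard : (X ^ Nat.card F ^ K - X : E[X]).roots.toFinset.card ≤ (V : Set E).toFinset.card := by
    rw [Set.toFinset_card, ← Nat.card_eq_fintype_card]
    refine (Multiset.toFinset_card_le _).trans ((card_roots' _).trans ?_)
    rw [FiniteField.X_pow_card_sub_X_natDegree_eq E hqK]
    exact ((Module.natCard_eq_pow_finrank (K := F) (V := V)).trans (by rw [hV])).ge
  have heq := Finset.eq_of_subset_of_card_le hsub hcard
  have hzm : z ∈ (X ^ Nat.card F ^ K - X : E[X]).roots.toFinset := by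
    rw [Fr_apply] at hz
    simp [hp, hz]
  rw [← heq] at hzm
  simpa using hzm

theorem exists_algebraMap_of_Fr_one [FiniteDimensional F E] {z : E} (hz : Fr F 1 z = z) :
    ∃ a, algebraMap F E a = z := by
  have := mem_of_Fr_eq le_rfl (Submodule.span F {(1 : E)}) (finrank_span_singleton one_ne_zero)
    (fun y hy => ?_) hz
  · obtain ⟨a, rfl⟩ := Submodule.mem_span_singleton.1 this
    exact ⟨a, by rw [Algebra.smul_def, mul_one]⟩
  · obtain ⟨a, rfl⟩ := Submodule.mem_span_singleton.1 hy
    rw [map_smul, map_one]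

theorem exists_map_of_fr_one [FiniteDimensional F E] {f : E[X]} (hf : fr F 1 f = f) :
    ∃ g : F[X], g.map (algebraMap F E) = f := by
  choose! a ha using fun (z : E) => exists_algebraMap_of_Fr_one (F := F) (z := z)
  refine ⟨∑ i ∈ Finset.range (f.natDegree + 1), monomial i (a (f.coeff i)), ?_⟩
  rw [Polynomial.map_sum]
  conv_rhs => rw [f.as_sum_range]
  refine Finset.sum_congr rfl fun i _ => ?_
  rw [map_monomial, ha _ ((fr_eq_iff F).1 hf i)]

theorem fr_map (k : ℕ) (g : F[X]) : fr F k (g.map (algebraMap F E)) = g.map (algebraMap F E) := by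
  ext i
  simp

/-- The product of the first `r` powers of `fr F a`, applied to `f`. -/
noncomputable def frProd (F : Type*) [Field F] [Finite F] [Algebra F E] (a r : ℕ) (f : E[X]) :
    E[X] := ∏ k ∈ Finset.range r, fr F (a * k) f

theorem fr_frProd {a r : ℕ} {f : E[X]} (hr : 1 ≤ r) (hf : fr F (a * r) f = f) :
    fr F a (frProd F a r f) = frProd F a r f := by
  obtain ⟨r, rfl⟩ := Nat.exists_eq_add_of_le' hr
  rw [frProd, map_prod, Finset.prod_range_succ, Finset.prod_range_succ']
  congr 1
  · exact Finset.prod_congr rfl fun k _ => by rw [← fr_add]; congr 2; rw [Nat.mul_succ, add_comm]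
  · rw [← fr_add, Nat.mul_zero, fr_zero]
    rwa [Nat.mul_succ, add_comm] at hf

theorem fr_frProd_of_fr {a r k : ℕ} {f : E[X]} (hf : fr F k f = f) :
    fr F k (frProd F a r f) = frProd F a r f := by
  rw [frProd, map_prod]
  exact Finset.prod_congr rfl fun i _ => by rw [← fr_add, add_comm, fr_add, hf]

theorem natDegree_minpoly_le [FiniteDimensional F E] {v : E} {k m : ℕ} {f : E[X]}
    (hf : fr F 1 f = f) (hfm : f.Monic) (hfv : f.eval v = 0) (hd : f.natDegree = m * k) :
    (minpoly F v).natDegree ≤ m * k := by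
  obtain ⟨g, rfl⟩ := exists_map_of_fr_one hf
  have hg : g ≠ 0 := by rintro rfl; simp at hfm
  rw [← hd, natDegree_map]
  refine natDegree_le_of_dvd (minpoly.dvd F v ?_) hg
  rwa [eval_map_algebraMap] at hfv

theorem frProd_monic {a r : ℕ} {f : E[X]} (hf : f.Monic) : (frProd F a r f).Monic :=
  monic_prod_of_monic _ _ fun _ _ => fr_monic F _ hf

theorem natDegree_frProd {a r : ℕ} {f : E[X]} (hf : f.Monic) :
    (frProd F a r f).natDegree = r * f.natDegree := by
  rw [frProd, natDegree_prod_of_monic _ _ fun _ _ => fr_monic F _ hf]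
  simp

theorem natDegree_frProd_le (a r : ℕ) (f : E[X]) :
    (frProd F a r f).natDegree ≤ r * f.natDegree := by
  refine (natDegree_prod_le _ _).trans ?_
  simp

theorem Fr_eq_self_iff [FiniteDimensional F E] {v : E} {k : ℕ} :
    Fr F k v = v ↔ (minpoly F v).natDegree ∣ k := by
  refine ⟨fun h => ?_, fun h => Fr_of_dvd F (Fr_natDegree_minpoly v) h⟩
  set t := (minpoly F v).natDegree with ht
  have hg := Fr_gcd F (Fr_natDegree_minpoly v) h
  have hv : IsIntegral F v := Algebra.IsIntegral.isIntegral v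
  have ht0 : 0 < t := minpoly.natDegree_pos hv
  have hg0 : 0 < t.gcd k := Nat.gcd_pos_of_pos_left _ ht0
  have hle : t ≤ t.gcd k := by
    refine (natDegree_minpoly_le (m := t.gcd k) (k := 1) (f := frProd F 1 (t.gcd k) (X - C v))
      (fr_frProd hg0 (by simp [ht, hg])) (frProd_monic (monic_X_sub_C v)) ?_ ?_).trans (by simp)
    · rw [frProd, eval_prod]
      exact Finset.prod_eq_zero (Finset.mem_range.2 hg0) (by simp [Fr_zero])
    · rw [natDegree_frProd (monic_X_sub_C v), natDegree_X_sub_C]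
  rw [← Nat.le_antisymm (Nat.gcd_le_left k ht0) hle]
  exact Nat.gcd_dvd_right t k

end Fixed

/-- The field `E` is the top of a Kummer tower of height `h` over an extension of degree `d` of `F`:
it is generated by a root of the irreducible polynomial `poly (X ^ ℓ ^ h)`. -/
structure KummerField (F E : Type*) [Field F] [Finite F] [Field E] [Algebra F E] (ℓ d h : ℕ) where
  poly : F[X]
  monic : poly.Monic
  natDegree : poly.natDegree = d
  irreducible : Irreducible (expand F (ℓ ^ h) poly)
  prime : ℓ.Prime
  le : d ≤ ℓ
  dvd : 0 < h → ℓ ∣ Nat.card F ^ d - 1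
  gen : E
  root : aeval gen (expand F (ℓ ^ h) poly) = 0
  basis : Module.Basis (Fin (d * ℓ ^ h)) F E
  basis_apply : ∀ i, basis i = gen ^ (i : ℕ)

namespace KummerField

variable {F E : Type*} [Field F] [Finite F] [Field E] [Algebra F E] {ℓ d h : ℕ}
  (K : KummerField F E ℓ d h)

include K

theorem d_pos : 1 ≤ d := by
  have := of_irreducible_expand_pow K.prime.ne_zero K.irreducible
  rw [← K.natDegree]
  exact this.natDegree_pos

theorem finiteDimensional : FiniteDimensional F E := Module.Basis.finiteDimensional_of_finite K.basis

/-- The generator of the `j`-th level. -/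
def x (j : ℕ) : E := K.gen ^ ℓ ^ (h - j)

theorem x_pow {i j : ℕ} (hij : i ≤ j) (hj : j ≤ h) : K.x j ^ ℓ ^ (j - i) = K.x i := by
  rw [x, x, ← pow_mul, ← pow_add]
  congr 2; omega

theorem minpoly_x {j : ℕ} (hj : j ≤ h) : minpoly F (K.x j) = expand F (ℓ ^ j) K.poly := by
  refine (minpoly.eq_of_irreducible_of_monic ?_ ?_ ?_).symm
  · refine of_irreducible_expand_pow (n := h - j) K.prime.ne_zero ?_
    rw [expand_expand, ← pow_add, Nat.sub_add_cancel hj]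
    exact K.irreducible
  · have := K.root
    rw [expand_aeval] at this ⊢
    have hx := K.x_pow (Nat.zero_le j) hj
    rw [Nat.sub_zero] at hx
    rwa [hx]
  · exact (monic_expand_iff (pow_pos K.prime.pos _)).2 K.monic

theorem natDegree_minpoly_x {j : ℕ} (hj : j ≤ h) : (minpoly F (K.x j)).natDegree = d * ℓ ^ j := by
  rw [K.minpoly_x hj, natDegree_expand, K.natDegree]

theorem Fr_x {j : ℕ} (hj : j ≤ h) : Fr F (d * ℓ ^ j) (K.x j) = K.x j := by
  have := K.finiteDimensional
  rw [← K.natDegree_minpoly_x hj]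
  exact Fr_natDegree_minpoly _

theorem index_lt {j k : ℕ} (hj : j ≤ h) (hk : k < d * ℓ ^ j) :
    ℓ ^ (h - j) * k < d * ℓ ^ h := by
  have : d * ℓ ^ h = ℓ ^ (h - j) * (d * ℓ ^ j) := by
    rw [mul_left_comm, ← pow_add, Nat.sub_add_cancel hj]
  rw [this]
  exact Nat.mul_lt_mul_of_pos_left hk (pow_pos K.prime.pos _)

theorem basis_mul {j k : ℕ} (hj : j ≤ h) (hk : k < d * ℓ ^ j) :
    K.basis ⟨ℓ ^ (h - j) * k, K.index_lt hj hk⟩ = K.x j ^ k := by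
  rw [K.basis_apply, x, pow_mul]

theorem mem_span_of_Fr {j : ℕ} (hj : j ≤ h) {z : E} (hz : Fr F (d * ℓ ^ j) z = z) :
    z ∈ Submodule.span F (Set.range fun k : Fin (d * ℓ ^ j) => K.x j ^ (k : ℕ)) := by
  have := K.finiteDimensional
  refine mem_of_Fr_eq (Nat.mul_pos K.d_pos (pow_pos K.prime.pos j)) _ ?_ ?_ hz
  · have hli : LinearIndependent F fun k : Fin (d * ℓ ^ j) => K.x j ^ (k : ℕ) := by
      have := K.basis.linearIndependent.comp
        (fun k : Fin (d * ℓ ^ j) => ⟨ℓ ^ (h - j) * k, K.index_lt hj k.2⟩) fun a c hac => by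
          have := Nat.eq_of_mul_eq_mul_left (pow_pos K.prime.pos _) (Fin.mk.inj hac)
          exact Fin.ext this
      convert this using 1
      funext k
      exact (K.basis_mul hj k.2).symm
    rw [finrank_span_eq_card hli, Fintype.card_fin]
  · intro y hy
    refine Submodule.span_induction ?_ (map_zero _) (fun a c _ _ ha hc => by rw [map_add, ha, hc])
      (fun a c _ hc => by rw [map_smul, hc]) hy
    rintro _ ⟨k, rfl⟩
    simp only [map_pow, K.Fr_x hj]

theorem Fr_eq_self_iff_repr {j : ℕ} (hj : j ≤ h) {z : E} :
    Fr F (d * ℓ ^ j) z = z ↔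
      ∀ i : Fin (d * ℓ ^ h), ¬ ℓ ^ (h - j) ∣ i → K.basis.repr z i = 0 := by
  constructor
  · intro hz i hi
    refine Submodule.span_induction ?_ (by simp) (fun a c _ _ ha hc => by simp [ha, hc])
      (fun a c _ hc => by simp [hc]) (K.mem_span_of_Fr hj hz)
    rintro _ ⟨k, rfl⟩
    simp only
    rw [← K.basis_mul hj k.2, Module.Basis.repr_self, Finsupp.single_apply, if_neg]
    rintro rfl
    exact hi (Dvd.intro _ rfl)
  · intro hz
    rw [← K.basis.sum_repr z, map_sum]
    refine Finset.sum_congr rfl fun i _ => ?_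
    rw [map_smul]
    by_cases hi : ℓ ^ (h - j) ∣ (i : ℕ)
    · obtain ⟨k, hk⟩ := hi
      rw [K.basis_apply, hk, pow_mul, map_pow]
      have := K.Fr_x hj
      rw [x] at this
      rw [this]
    · rw [hz i hi, zero_smul, zero_smul]

theorem frobLevel {Ω : Type*} {M : ℕ → ℝ} (hM : IsMultiplicationTime F M) {j : ℕ} (hj : j ≤ h) :
    FrobLevel K.basis M Ω (d * ℓ ^ j) := by
  have hpos : 0 < d * ℓ ^ h := Nat.mul_pos K.d_pos (pow_pos K.prime.pos h)
  have hσ : ∀ (k : ℕ) (hlt : k < d * ℓ ^ j), (if hk : ℓ ^ (h - j) * k < d * ℓ ^ h then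
      (⟨ℓ ^ (h - j) * k, hk⟩ : Fin (d * ℓ ^ h)) else ⟨0, hpos⟩) =
      ⟨ℓ ^ (h - j) * k, K.index_lt hj hlt⟩ := fun k hk => dif_pos (K.index_lt hj hk)
  refine FrobLevel.of_powers hM (Nat.mul_pos K.d_pos (pow_pos K.prime.pos j))
    (Q := expand F (ℓ ^ j) K.poly) ((monic_expand_iff (pow_pos K.prime.pos _)).2 K.monic)
    (by rw [natDegree_expand, K.natDegree]) (y := K.x j) ?_
    (fun k => if hk : ℓ ^ (h - j) * k < d * ℓ ^ h then ⟨ℓ ^ (h - j) * k, hk⟩ else ⟨0, hpos⟩) ?_ ?_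
    fun z hz => K.mem_span_of_Fr hj hz
  · rw [← K.minpoly_x hj]; exact minpoly.aeval _ _
  · intro a ha c hc hac
    simp only at hac
    rw [hσ a ha, hσ c hc] at hac
    exact Nat.eq_of_mul_eq_mul_left (pow_pos K.prime.pos _) (Fin.mk.inj hac)
  · intro k hk
    rw [hσ k hk, K.basis_mul hj hk]

theorem frobLevel_one {Ω : Type*} {M : ℕ → ℝ} (hM : IsMultiplicationTime F M) :
    FrobLevel K.basis M Ω 1 := by
  have := K.finiteDimensional
  have hpos : 0 < d * ℓ ^ h := Nat.mul_pos K.d_pos (pow_pos K.prime.pos h)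
  refine FrobLevel.of_powers hM le_rfl (Q := X) monic_X natDegree_X (y := 0) (by simp)
    (fun _ => ⟨0, hpos⟩) ?_ ?_ ?_
  · intro a ha c hc _
    simp only [Set.mem_Iio] at ha hc
    omega
  · intro k hk
    rw [K.basis_apply, Nat.lt_one_iff.1 hk]; simp
  · intro z hz
    obtain ⟨a, rfl⟩ := exists_algebraMap_of_Fr_one hz
    rw [Algebra.algebraMap_eq_smul_one]
    exact Submodule.smul_mem _ _ (Submodule.subset_span ⟨0, by simp⟩)

theorem repr_algebraMap_zero (a : F) (hpos : 0 < d * ℓ ^ h) :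
    K.basis.repr (algebraMap F E a) ⟨0, hpos⟩ = a := by
  have : algebraMap F E a = a • K.basis ⟨0, hpos⟩ := by
    rw [K.basis_apply, pow_zero, Algebra.algebraMap_eq_smul_one]
  rw [this]
  simp

theorem exists_zeta {j : ℕ} (hj : j < h) : ∃ ζ : E, Fr F d ζ = ζ ∧ ζ ^ ℓ = 1 ∧ ζ ≠ 1 ∧
    ∀ k, Fr F (d * ℓ ^ j * k) (K.x (j + 1)) = ζ ^ k * K.x (j + 1) := by
  have := K.finiteDimensional
  have hpos : 0 < d * ℓ ^ j := Nat.mul_pos K.d_pos (pow_pos K.prime.pos j)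
  have hdeg := K.natDegree_minpoly_x (show j + 1 ≤ h from hj)
  have hlt : d * ℓ ^ j < d * ℓ ^ (j + 1) := by
    rw [pow_succ, ← mul_assoc]
    exact lt_mul_of_one_lt_right hpos K.prime.one_lt
  have hx0 : K.x (j + 1) ≠ 0 := by
    intro h0
    rw [h0, minpoly.zero, natDegree_X] at hdeg
    omega
  have hxl : K.x (j + 1) ^ ℓ = K.x j := by
    have := K.x_pow (Nat.le_succ j) (show j + 1 ≤ h from hj)
    simpa using this
  set ζ := Fr F (d * ℓ ^ j) (K.x (j + 1)) / K.x (j + 1) with hζ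
  have h1 : Fr F (d * ℓ ^ j) (K.x (j + 1)) = ζ * K.x (j + 1) := by
    rw [hζ, div_mul_cancel₀ _ hx0]
  have hζl : ζ ^ ℓ = 1 := by
    rw [hζ, div_pow, ← map_pow, hxl, K.Fr_x hj.le, div_self]
    rw [← hxl]
    exact pow_ne_zero _ hx0
  have hζd : Fr F d ζ = ζ := by
    obtain ⟨c, hc⟩ := K.dvd (by omega)
    have hq : 1 ≤ Nat.card F ^ d := Nat.one_le_pow _ _ Nat.card_pos
    rw [Fr_apply, show Nat.card F ^ d = ℓ * c + 1 by omega, pow_succ, pow_mul, hζl, one_pow,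
      one_mul]
  refine ⟨ζ, hζd, hζl, fun h => ?_, fun k => ?_⟩
  · rw [h, one_mul, Fr_eq_self_iff, hdeg] at h1
    exact absurd (Nat.le_of_dvd hpos h1) (by omega)
  · induction k with
    | zero => simp [Fr_zero]
    | succ k ih =>
      rw [Nat.mul_succ, add_comm, Fr_add, ih, map_mul, map_pow, h1,
        Fr_of_dvd F hζd (Dvd.intro _ rfl), pow_succ]
      ring

end KummerField

section FrobeniusProducts

variable {F : Type*} [Field F] [Finite F] {E : Type*} [Field E] [Algebra F E]

/-- The cofactor of `f` in `frProd F a r f`. -/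
noncomputable def frCof (F : Type*) [Field F] [Finite F] [Algebra F E] (a r : ℕ) (f : E[X]) :
    E[X] := ∏ k ∈ Finset.range (r - 1), fr F (a * (k + 1)) f

/-- The sum of the first `r` powers of `fr F a`, applied to `g`. -/
noncomputable def frTrace (F : Type*) [Field F] [Finite F] [Algebra F E] (a r : ℕ) (g : E[X]) :
    E[X] := ∑ k ∈ Finset.range r, fr F (a * k) g

theorem frProd_eq_mul_frCof {a r : ℕ} (hr : 1 ≤ r) (f : E[X]) :
    frProd F a r f = f * frCof F a r f := by
  obtain ⟨r, rfl⟩ := Nat.exists_eq_add_of_le' hr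
  rw [frProd, frCof, Finset.prod_range_succ', mul_comm, Nat.mul_zero, fr_zero, Nat.add_sub_cancel]

theorem fr_frCof_of_fr {a r k : ℕ} {f : E[X]} (hf : fr F k f = f) :
    fr F k (frCof F a r f) = frCof F a r f := by
  rw [frCof, map_prod]
  exact Finset.prod_congr rfl fun i _ => by rw [← fr_add, add_comm, fr_add, hf]

theorem fr_frTrace_of_fr {a r k : ℕ} {f : E[X]} (hf : fr F k f = f) :
    fr F k (frTrace F a r f) = frTrace F a r f := by
  rw [frTrace, map_sum]
  exact Finset.sum_congr rfl fun i _ => by rw [← fr_add, add_comm, fr_add, hf]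

theorem fr_frTrace {a r : ℕ} {f : E[X]} (hr : 1 ≤ r) (hf : fr F (a * r) f = f) :
    fr F a (frTrace F a r f) = frTrace F a r f := by
  obtain ⟨r, rfl⟩ := Nat.exists_eq_add_of_le' hr
  rw [frTrace, map_sum, Finset.sum_range_succ, Finset.sum_range_succ']
  congr 1
  · exact Finset.sum_congr rfl fun k _ => by rw [← fr_add]; congr 2; rw [Nat.mul_succ, add_comm]
  · rw [← fr_add, Nat.mul_zero, fr_zero]
    rwa [Nat.mul_succ, add_comm] at hf

theorem natDegree_frCof_le (a r : ℕ) (f : E[X]) :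
    (frCof F a r f).natDegree ≤ (r - 1) * f.natDegree := by
  refine (natDegree_prod_le _ _).trans ?_
  simp

theorem natDegree_frTrace_lt {a r m : ℕ} {f : E[X]} (hf : f.natDegree < m) :
    (frTrace F a r f).natDegree < m := by
  refine lt_of_le_of_lt (natDegree_sum_le_of_forall_le (n := m - 1) _ _ fun i _ => ?_)
    (by omega : m - 1 < m)
  simp only [natDegree_fr]
  omega

theorem eval_frTrace_mul_frCof {a r : ℕ} (hr : 1 ≤ r) {f : E[X]} (hf : fr F (a * r) f = f) {v : E}
    (hv : f.eval v = 0) (c : E[X]) :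
    (frTrace F a r (c * frCof F a r f)).eval v = c.eval v * (frCof F a r f).eval v := by
  rw [frTrace, eval_finsetSum, Finset.sum_eq_single 0]
  · rw [Nat.mul_zero, fr_zero, eval_mul]
  · intro k hk hk0
    have hk := Finset.mem_range.1 hk
    rw [map_mul, eval_mul, frCof, map_prod, eval_prod]
    rw [Finset.prod_eq_zero (i := r - k - 1) (Finset.mem_range.2 (by omega)), mul_zero]
    rw [← fr_add, ← Nat.mul_add, show k + (r - k - 1 + 1) = r by omega, hf, hv]
  · intro h
    exact absurd (Finset.mem_range.2 (by omega)) h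

end FrobeniusProducts

section Products

variable {F : Type u} [Field F] [Finite F] {E : Type*} [Field E] [Algebra F E] {Ω : Type v}
  {ι : Type*} {b : Module.Basis ι F E} {M : ℕ → ℝ} {K : ℕ}

theorem pow_clog_le {r : ℕ} (hr : 1 ≤ r) : 2 ^ Nat.clog 2 r ≤ 2 * r := by
  rcases Nat.eq_or_lt_of_le hr with rfl | hr
  · simp
  · have h := Nat.pow_pred_clog_lt_self (b := 2) one_lt_two hr
    have h0 : 0 < Nat.clog 2 r := Nat.clog_pos one_lt_two hr
    obtain ⟨k, hk⟩ := Nat.exists_eq_succ_of_ne_zero h0.ne'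
    rw [hk] at h ⊢
    rw [pow_succ]
    simp only [Nat.pred_eq_sub_one, Nat.succ_eq_add_one, Nat.add_sub_cancel] at h
    omega

theorem FrobLevel.prod (hL : FrobLevel b M Ω K) (hM : IsMultiplicationTime F M) {r r' m : ℕ}
    (hm : 1 ≤ m) (hr' : 1 ≤ r') (hr : r ≤ r') {f : ℕ → Ω → E[X]}
    (hf : ∀ c, SmallPoly F K m (f c)) :
    Cost (⋃ c ∈ Finset.range r, KP b (f c)) (KP b (∏ c ∈ Finset.range r, f c))
      (Nat.clog 2 r' * (40 * M (K * (r' * m)))) := by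
  classical
  set k := Nat.clog 2 r' with hk
  have hrk : r ≤ 2 ^ k := hr.trans (Nat.le_pow_clog one_lt_two r')
  set g : ℕ → Ω → E[X] := fun c => if c < r then f c else fun _ => 1 with hg
  have hgs : ∀ c, SmallPoly F K m (g c) := by
    intro c
    simp only [hg]
    split_ifs
    · exact hf c
    · exact fun ω => ⟨map_one _, by simpa using Nat.pos_of_ne_zero (by omega)⟩
  have h := hL.treeProduct hM (n := fun _ => m) (fun _ => hm) hgs k k le_rfl
  have hprod : ∏ c ∈ block k 0, g c = ∏ c ∈ Finset.range r, f c := by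
    rw [block_root]
    refine (Finset.prod_subset (Finset.range_subset_range.2 hrk) fun c _ hc => ?_).symm.trans
      (Finset.prod_congr rfl fun c hc => ?_)
    · simp only [hg, if_neg (fun h => hc (Finset.mem_range.2 h))]
      rfl
    · simp only [hg, if_pos (Finset.mem_range.1 hc)]
  refine Cost.add_consts (h.mono ?_ ?_ ?_)
  · refine Set.iUnion₂_subset fun c _ => ?_
    simp only [hg]
    split_ifs with hc
    · exact (Set.subset_biUnion_of_mem (u := fun c => KP b (f c))
        (Finset.mem_range.2 hc)).trans Set.subset_union_left
    · exact (KP_const 1).trans Set.subset_union_right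
  · rw [← hprod]
    exact subset_treeSet le_rfl (by simp)
  · refine mul_le_mul_of_nonneg_left ?_ (Nat.cast_nonneg _)
    have h1 := pow_clog_le hr'
    have := hM.le_sq_mul (k := 2) (n := K * ∑ c ∈ Finset.range (2 ^ k), m) (m := K * (r' * m)) ?_
      (Nat.mul_pos hL.pos (Nat.mul_pos hr' hm)) ?_
    · push_cast at this
      simp only [Finset.sum_const, Finset.card_range, smul_eq_mul] at this ⊢
      linarith
    · simp only [Finset.sum_const, Finset.card_range, smul_eq_mul]
      exact Nat.mul_pos hL.pos (Nat.mul_pos (by positivity) hm)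
    · simp only [Finset.sum_const, Finset.card_range, smul_eq_mul]
      calc K * (2 ^ k * m) ≤ K * (2 * r' * m) :=
            Nat.mul_le_mul_left _ (Nat.mul_le_mul_right _ h1)
        _ = 2 * (K * (r' * m)) := by ring

omit [Finite F] in
theorem KP_eq_iUnion_KE (f : Ω → E[X]) : KP b f = ⋃ i, KE b fun ω => (f ω).coeff i := by
  ext x
  simp [KP, KE, Prod.exists]

theorem Cost.KP_of_coeff {S : Set (Ω → F)} {f : Ω → E[X]} {m : ℕ} {k : ℝ}
    (hf : ∀ ω, (f ω).natDegree < m)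
    (h : ∀ i, Cost S (KE b fun ω => (f ω).coeff i) k) : Cost S (KP b f) (m * k) := by
  refine ((Cost.biUnion (Finset.range m) _ (fun _ => k) fun i _ => h i).comp (l := 0)
    (Cost.of_subset_consts (T := KP b f) ?_ le_rfl)).mono subset_rfl subset_rfl (by simp)
  rintro _ ⟨⟨i, j⟩, rfl⟩
  by_cases hi : i < m
  · refine .inl (.inr ?_)
    simp only [Set.mem_iUnion, Finset.mem_range]
    exact ⟨i, hi, j, rfl⟩
  · refine .inr ⟨0, funext fun ω => ?_⟩
    simp only
    rw [coeff_eq_zero_of_natDegree_lt ((hf ω).trans_le (not_lt.1 hi))]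
    simp

end Products

namespace KummerField

variable {F : Type u} {E : Type*} [Field F] [Finite F] [Field E] [Algebra F E] {ℓ d h : ℕ}
  (K : KummerField F E ℓ d h) {Ω : Type v} {M : ℕ → ℝ}

include K in
theorem blockIndex_lt {j : ℕ} (hj : j ≤ h) (a : Fin d) (i : Fin (ℓ ^ j)) :
    ℓ ^ h * a + ℓ ^ (h - j) * i < d * ℓ ^ h := by
  have h1 : ℓ ^ (h - j) * (i + 1) ≤ ℓ ^ h := by
    calc ℓ ^ (h - j) * (i + 1) ≤ ℓ ^ (h - j) * ℓ ^ j := Nat.mul_le_mul_left _ i.2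
      _ = ℓ ^ h := by rw [← pow_add, Nat.sub_add_cancel hj]
  have h2 := Nat.mul_le_mul_left (ℓ ^ h) (show (a : ℕ) + 1 ≤ d from a.2)
  have h3 : 0 < ℓ ^ (h - j) := pow_pos K.prime.pos _
  rw [mul_comm d]
  rw [Nat.mul_add, mul_one] at h1 h2
  omega

/-- The index of `x 0 ^ a * x j ^ i` in the basis. -/
def blockIndex {j : ℕ} (hj : j ≤ h) (a : Fin d) (i : Fin (ℓ ^ j)) : Fin (d * ℓ ^ h) :=
  ⟨ℓ ^ h * a + ℓ ^ (h - j) * i, K.blockIndex_lt hj a i⟩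

theorem basis_blockIndex {j : ℕ} (hj : j ≤ h) (a : Fin d) (i : Fin (ℓ ^ j)) :
    K.basis (K.blockIndex hj a i) = K.x 0 ^ (a : ℕ) * K.x j ^ (i : ℕ) := by
  rw [K.basis_apply, x, x, blockIndex, Nat.sub_zero, pow_add, pow_mul, pow_mul]

theorem blockIndex_inj {j : ℕ} (hj : j ≤ h) {a a' : Fin d} {i i' : Fin (ℓ ^ j)} :
    K.blockIndex hj a i = K.blockIndex hj a' i' ↔ a = a' ∧ i = i' := by
  refine ⟨fun hai => ?_, by rintro ⟨rfl, rfl⟩; rfl⟩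
  have hl := K.prime.pos
  have h0 : ℓ ^ h = ℓ ^ (h - j) * ℓ ^ j := by rw [← pow_add, Nat.sub_add_cancel hj]
  have h1 := Fin.mk.inj hai
  rw [h0, mul_assoc, mul_assoc, ← Nat.mul_add, ← Nat.mul_add] at h1
  have h2 := Nat.eq_of_mul_eq_mul_left (pow_pos hl _) h1
  have h3 : (i : ℕ) = i' := by
    have := congrArg (· % ℓ ^ j) h2
    simpa [Nat.mul_add_mod, Nat.mod_eq_of_lt i.2, Nat.mod_eq_of_lt i'.2] using this
  refine ⟨Fin.ext ?_, Fin.ext h3⟩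
  rw [h3] at h2
  exact Nat.eq_of_mul_eq_mul_left (pow_pos hl j) (by omega)

/-- The coefficient of `x j ^ i` in an element of the `j`-th level. -/
noncomputable def digit {j : ℕ} (hj : j ≤ h) (i : Fin (ℓ ^ j)) (z : E) : E :=
  ∑ a : Fin d, K.basis.repr z (K.blockIndex hj a i) • K.x 0 ^ (a : ℕ)

include K in
theorem zero_lt_pow (j : ℕ) : 0 < ℓ ^ j := pow_pos K.prime.pos j

theorem Fr_x_zero : Fr F d (K.x 0) = K.x 0 := by
  have := K.Fr_x (Nat.zero_le h)
  rwa [pow_zero, mul_one] at this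

theorem Fr_digit {j : ℕ} (hj : j ≤ h) (i : Fin (ℓ ^ j)) (z : E) :
    Fr F d (K.digit hj i z) = K.digit hj i z := by
  simp [digit, K.Fr_x_zero]

theorem digit_add {j : ℕ} (hj : j ≤ h) (i : Fin (ℓ ^ j)) (y z : E) :
    K.digit hj i (y + z) = K.digit hj i y + K.digit hj i z := by
  simp only [digit, map_add, Finsupp.add_apply, add_smul, Finset.sum_add_distrib]

theorem digit_smul {j : ℕ} (hj : j ≤ h) (i : Fin (ℓ ^ j)) (c : F) (z : E) :
    K.digit hj i (c • z) = c • K.digit hj i z := by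
  simp only [digit, map_smul, Finsupp.smul_apply, smul_assoc, Finset.smul_sum]

theorem sum_digit {j : ℕ} (hj : j ≤ h) {z : E} (hz : Fr F (d * ℓ ^ j) z = z) :
    ∑ i : Fin (ℓ ^ j), K.digit hj i z * K.x j ^ (i : ℕ) = z := by
  classical
  refine Submodule.span_induction (p := fun z _ =>
    ∑ i : Fin (ℓ ^ j), K.digit hj i z * K.x j ^ (i : ℕ) = z) ?_ ?_ ?_ ?_ (K.mem_span_of_Fr hj hz)
  · rintro _ ⟨m, rfl⟩
    have hm : (m : ℕ) / ℓ ^ j < d := by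
      rw [Nat.div_lt_iff_lt_mul (K.zero_lt_pow j)]; exact m.2
    have hx : K.x j ^ (m : ℕ) = K.basis (K.blockIndex hj ⟨m / ℓ ^ j, hm⟩
        ⟨m % ℓ ^ j, Nat.mod_lt _ (K.zero_lt_pow j)⟩) := by
      rw [K.basis_blockIndex, ← K.x_pow (Nat.zero_le j) hj, Nat.sub_zero, ← pow_mul]
      simp only
      rw [← pow_add, Nat.div_add_mod]
    simp only [hx, digit, Module.Basis.repr_self, Finsupp.single_apply, K.blockIndex_inj]
    rw [Finset.sum_eq_single ⟨m % ℓ ^ j, Nat.mod_lt _ (K.zero_lt_pow j)⟩,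
      Finset.sum_eq_single ⟨m / ℓ ^ j, hm⟩]
    · rw [if_pos ⟨rfl, rfl⟩, one_smul, K.basis_blockIndex]
    · intro a _ ha
      rw [if_neg (fun h => ha h.1.symm), zero_smul]
    · simp
    · intro i _ hi
      rw [Finset.sum_eq_zero, zero_mul]
      intro a _
      rw [if_neg (fun h => hi h.2.symm), zero_smul]
    · simp
  · simp [digit]
  · intro y z _ _ hy hz
    simp only [K.digit_add, add_mul, Finset.sum_add_distrib, hy, hz]
  · intro c z _ hz
    simp only [K.digit_smul, smul_mul_assoc, ← Finset.smul_sum, hz]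

theorem repr_sum_mul {j : ℕ} (hj : j ≤ h) (n : Fin (d * ℓ ^ h)) :
    (∃ i n', ∀ γ : Fin (ℓ ^ j) → E, (∀ i, Fr F d (γ i) = γ i) →
      K.basis.repr (∑ i, γ i * K.x j ^ (i : ℕ)) n = K.basis.repr (γ i) n') ∨
    ∀ γ : Fin (ℓ ^ j) → E, (∀ i, Fr F d (γ i) = γ i) →
      K.basis.repr (∑ i, γ i * K.x j ^ (i : ℕ)) n = 0 := by
  classical
  have hspan : ∀ {y : E}, Fr F d y = y → y = ∑ a : Fin d,
      K.basis.repr y (K.blockIndex (Nat.zero_le h) a ⟨0, by simp⟩) • K.x 0 ^ (a : ℕ) := by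
    intro y hy
    have := K.sum_digit (Nat.zero_le h) (z := y) (by simpa using hy)
    rw [Finset.sum_eq_single ⟨0, by simp⟩] at this
    · simpa [digit] using this.symm
    · intro i _ hi
      exact absurd (Fin.ext (by have := i.2; simp at this; simpa using this)) hi
    · exact fun h => absurd (Finset.mem_univ _) h
  have key : ∀ {y : E}, Fr F d y = y → ∀ i : Fin (ℓ ^ j), K.basis.repr (y * K.x j ^ (i : ℕ)) n =
      ∑ a : Fin d, if K.blockIndex hj a i = n then
        K.basis.repr y (K.blockIndex (Nat.zero_le h) a ⟨0, by simp⟩) else 0 := by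
    intro y hy i
    conv_lhs => rw [hspan hy, Finset.sum_mul]
    rw [map_sum, Finsupp.finsetSum_apply]
    refine Finset.sum_congr rfl fun a _ => ?_
    rw [smul_mul_assoc, ← K.basis_blockIndex hj, map_smul, Finsupp.smul_apply,
      Module.Basis.repr_self, Finsupp.single_apply]
    split_ifs <;> simp
  by_cases hn : ∃ a i, K.blockIndex hj a i = n
  · obtain ⟨a, i, rfl⟩ := hn
    refine .inl ⟨i, K.blockIndex (Nat.zero_le h) a ⟨0, by simp⟩, fun γ hγ => ?_⟩
    rw [map_sum, Finsupp.finsetSum_apply, Finset.sum_eq_single i]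
    · simp [key (hγ i), K.blockIndex_inj]
    · intro i' _ hi'
      rw [key (hγ i')]
      refine Finset.sum_eq_zero fun a' _ => if_neg fun h => hi' ((K.blockIndex_inj hj).1 h).2
    · simp
  · refine .inr fun γ hγ => ?_
    rw [map_sum, Finsupp.finsetSum_apply]
    refine Finset.sum_eq_zero fun i _ => ?_
    rw [key (hγ i)]
    exact Finset.sum_eq_zero fun a _ => if_neg fun h => hn ⟨a, i, h⟩

theorem cost_Fr (hM : IsMultiplicationTime F M) {j : ℕ} (hj : j < h) (k : ℕ) {z : Ω → E}
    (hz : ∀ ω, Fr F (d * ℓ ^ (j + 1)) (z ω) = z ω) :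
    Cost (KE K.basis z) (KE K.basis fun ω => Fr F (d * ℓ ^ j * k) (z ω))
      (ℓ ^ (j + 1) * (10 * M d)) := by
  have hj' : j + 1 ≤ h := hj
  obtain ⟨ζ, hζd, -, -, hζ⟩ := K.exists_zeta hj
  have hL : FrobLevel K.basis M Ω d := by
    have := K.frobLevel (Ω := Ω) hM (Nat.zero_le h)
    rwa [pow_zero, mul_one] at this
  set γ : Ω → Fin (ℓ ^ (j + 1)) → E := fun ω i => K.digit hj' i (z ω) * ζ ^ (k * i) with hγ
  have hγd : ∀ ω i, Fr F d (γ ω i) = γ ω i := fun ω i => by simp [γ, K.Fr_digit, hζd]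
  have hsum : ∀ ω, Fr F (d * ℓ ^ j * k) (z ω) = ∑ i, γ ω i * K.x (j + 1) ^ (i : ℕ) := by
    intro ω
    conv_lhs => rw [← K.sum_digit hj' (hz ω), map_sum]
    refine Finset.sum_congr rfl fun i _ => ?_
    rw [map_mul, map_pow, hζ, mul_pow, ← pow_mul, mul_assoc (d), Fr_mul_of_fixed F (K.Fr_digit _ _ _),
      mul_assoc]
  have hdig : ∀ i, KE K.basis (fun ω => K.digit hj' i (z ω)) ⊆ KE K.basis z ∪ Consts F Ω := by
    rintro i _ ⟨n, rfl⟩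
    by_cases hn : ∃ a, K.blockIndex (Nat.zero_le h) a ⟨0, by simp⟩ = n
    · obtain ⟨a, rfl⟩ := hn
      refine .inl ⟨K.blockIndex hj' a i, funext fun ω => ?_⟩
      have hb : ∀ a : Fin d, K.x 0 ^ (a : ℕ) =
          K.basis (K.blockIndex (Nat.zero_le h) a ⟨0, by simp⟩) := fun a => by
        rw [K.basis_blockIndex]; simp
      simp only [digit, hb, map_sum, map_smul, Finsupp.finsetSum_apply, Finsupp.smul_apply,
        Module.Basis.repr_self, Finsupp.single_apply, K.blockIndex_inj]
      simp
    · refine .inr ⟨0, funext fun ω => ?_⟩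
      have hb : ∀ a : Fin d, K.x 0 ^ (a : ℕ) =
          K.basis (K.blockIndex (Nat.zero_le h) a ⟨0, by simp⟩) := fun a => by
        rw [K.basis_blockIndex]; simp
      simp only [digit, hb, map_sum, map_smul, Finsupp.finsetSum_apply, Finsupp.smul_apply,
        Module.Basis.repr_self, Finsupp.single_apply]
      refine (Finset.sum_eq_zero fun a _ => ?_).symm
      rw [if_neg fun h => hn ⟨a, h⟩, smul_zero]
  have hmul := Cost.biUnion (S := KE K.basis z ∪ Consts F Ω) Finset.univ
    (fun i : Fin (ℓ ^ (j + 1)) => KP K.basis fun ω => C (γ ω i)) (fun _ => 10 * M d) fun i _ => by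
      have := hL.mul 1 (fun ω => C (K.digit hj' i (z ω))) (fun _ => C (ζ ^ (k * (i : ℕ)))) le_rfl
        (SmallPoly.const fun ω => K.Fr_digit _ _ _) (SmallPoly.const fun ω => by simp [hζd])
      rw [mul_one] at this
      refine this.mono ?_ ?_ le_rfl
      · refine Set.union_subset ((KP_C _).trans ?_) ((KP_const _).trans Set.subset_union_right)
        exact Set.union_subset (hdig i) Set.subset_union_right
      · refine (Eq.subset ?_)
        congr 1
        funext ω
        simp [γ]
  refine Cost.add_consts ((hmul.comp (l := 0) (Cost.of_subset_consts ?_ le_rfl)).mono subset_rfl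
    subset_rfl ?_)
  · rintro _ ⟨n, rfl⟩
    simp only [hsum]
    rcases K.repr_sum_mul hj' n with ⟨i, n', hn⟩ | hn
    · refine .inl (.inr ?_)
      simp only [hn _ (hγd _), Set.mem_iUnion]
      exact ⟨i, Finset.mem_univ i, KE_subset_KP_C _ ⟨n', rfl⟩⟩
    · exact .inr ⟨0, funext fun ω => (hn _ (hγd ω)).symm⟩
  · simp

theorem cost_fr (hM : IsMultiplicationTime F M) {j m : ℕ} (hj : j < h) (hm : 1 ≤ m) (k : ℕ)
    {f : Ω → E[X]} (hf : SmallPoly F (d * ℓ ^ (j + 1)) m f) :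
    Cost (KP K.basis f) (KP K.basis fun ω => fr F (d * ℓ ^ j * k) (f ω))
      (10 * M (d * ℓ ^ (j + 1) * m)) := by
  refine (Cost.KP_of_coeff (m := m) (k := ℓ ^ (j + 1) * (10 * M d)) (fun ω => ?_)
    fun i => ?_).mono subset_rfl subset_rfl ?_
  · rw [natDegree_fr]; exact (hf ω).2
  · simp only [coeff_fr]
    refine (K.cost_Fr hM hj k fun ω => ?_).mono ?_ subset_rfl le_rfl
    · rw [← coeff_fr, (hf ω).1]
    · rw [KP_eq_iUnion_KE]
      exact Set.subset_iUnion (fun i => KE K.basis fun ω => (f ω).coeff i) i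
  · have := hM.nat_mul_le (k := m * ℓ ^ (j + 1)) (m := d) (N := d * ℓ ^ (j + 1) * m)
      (Nat.mul_pos hm (K.zero_lt_pow _)) K.d_pos (by apply le_of_eq; ring)
    push_cast at this
    linarith

/-- The cost of the norm cofactor for one step of the Kummer tower. -/
theorem cost_frCof (hM : IsMultiplicationTime F M) {j m : ℕ} (hj : j < h) (hm : 1 ≤ m)
    {f : Ω → E[X]} (hf : SmallPoly F (d * ℓ ^ (j + 1)) m f) :
    Cost (KP K.basis f) (KP K.basis fun ω => frCof F (d * ℓ ^ j) ℓ (f ω))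
      (Nat.clog 2 ℓ * (50 * M (d * ℓ ^ (j + 1) * (ℓ * m)))) := by
  have hL := K.frobLevel (Ω := Ω) hM (show j + 1 ≤ h from hj)
  have h1 := Cost.biUnion (S := KP K.basis f) (Finset.range (ℓ - 1))
    (fun c => KP K.basis fun ω => fr F (d * ℓ ^ j * (c + 1)) (f ω))
    (fun _ => 10 * M (d * ℓ ^ (j + 1) * m)) fun c _ => K.cost_fr hM hj hm (c + 1) hf
  have h2 := hL.prod hM (r := ℓ - 1) (r' := ℓ) hm K.prime.one_le (Nat.sub_le _ _)
    (f := fun c ω => fr F (d * ℓ ^ j * (c + 1)) (f ω)) fun c ω =>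
      ⟨by rw [← fr_add, add_comm, fr_add, (hf ω).1], by rw [natDegree_fr]; exact (hf ω).2⟩
  refine (h1.comp (h2.mono Set.subset_union_right subset_rfl le_rfl)).mono subset_rfl ?_ ?_
  · refine Eq.subset ?_
    congr 1
    funext ω
    rw [frCof, Finset.prod_apply]
  · have h3 := hM.nat_mul_le (k := ℓ) (m := d * ℓ ^ (j + 1) * m)
      (N := d * ℓ ^ (j + 1) * (ℓ * m)) K.prime.one_le (Nat.mul_pos hL.pos hm)
      (by apply le_of_eq; ring)
    have h4 : (1 : ℝ) ≤ Nat.clog 2 ℓ := by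
      exact_mod_cast Nat.clog_pos one_lt_two K.prime.two_le
    have h5 := hM.pos (n := d * ℓ ^ (j + 1) * m) (Nat.mul_pos hL.pos hm)
    have h6 := hM.pos (n := d * ℓ ^ (j + 1) * (ℓ * m))
      (Nat.mul_pos hL.pos (Nat.mul_pos K.prime.pos hm))
    have h7 : ((ℓ - 1 : ℕ) : ℝ) ≤ ℓ := Nat.cast_le.2 (Nat.sub_le _ _)
    simp only [Finset.sum_const, Finset.card_range, nsmul_eq_mul]
    nlinarith [mul_le_mul_of_nonneg_right h7 h5.le, mul_le_mul_of_nonneg_right h4 h6.le]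

theorem repr_trace {j : ℕ} (hj : j < h) {z : E} (hz : Fr F (d * ℓ ^ (j + 1)) z = z)
    (n : Fin (d * ℓ ^ h)) :
    K.basis.repr (∑ k ∈ Finset.range ℓ, Fr F (d * ℓ ^ j * k) z) n =
      if ℓ ^ (h - j) ∣ n then (ℓ : F) * K.basis.repr z n else 0 := by
  classical
  have hj' : j + 1 ≤ h := hj
  obtain ⟨ζ, hζd, hζl, hζ1, hζ⟩ := K.exists_zeta hj
  refine Submodule.span_induction (p := fun z _ =>
    K.basis.repr (∑ k ∈ Finset.range ℓ, Fr F (d * ℓ ^ j * k) z) n =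
      if ℓ ^ (h - j) ∣ n then (ℓ : F) * K.basis.repr z n else 0) ?_ (by simp) ?_ ?_
    (K.mem_span_of_Fr hj' hz)
  · rintro _ ⟨m, rfl⟩
    have hsum : ∑ k ∈ Finset.range ℓ, Fr F (d * ℓ ^ j * k) (K.x (j + 1) ^ (m : ℕ)) =
        (∑ k ∈ Finset.range ℓ, (ζ ^ (m : ℕ)) ^ k) * K.x (j + 1) ^ (m : ℕ) := by
      rw [Finset.sum_mul]
      refine Finset.sum_congr rfl fun k _ => ?_
      rw [map_pow, hζ, mul_pow, ← pow_mul, ← pow_mul, mul_comm k]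
    have hpow : ℓ ^ (h - j) = ℓ ^ (h - (j + 1)) * ℓ := by
      rw [← pow_succ]; congr 1; omega
    simp only [hsum]
    simp only [← K.basis_mul hj' m.2]
    by_cases hm : ℓ ∣ (m : ℕ)
    · obtain ⟨c, hc⟩ := hm
      have hζm : ζ ^ (m : ℕ) = 1 := by rw [hc, pow_mul, hζl, one_pow]
      simp only [hζm, one_pow, Finset.sum_const, Finset.card_range, nsmul_eq_mul, mul_one]
      rw [← nsmul_eq_mul, map_nsmul, Finsupp.smul_apply, Module.Basis.repr_self,
        Finsupp.single_apply]
      by_cases hn : (⟨ℓ ^ (h - (j + 1)) * m, K.index_lt hj' m.2⟩ : Fin (d * ℓ ^ h)) = n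
      · rw [if_pos hn, if_pos, nsmul_eq_mul]
        rw [← hn, hpow]
        exact Nat.mul_dvd_mul_left _ (Dvd.intro _ hc.symm)
      · simp [hn]
    · have h0 : ∑ k ∈ Finset.range ℓ, (ζ ^ (m : ℕ)) ^ k = 0 := by
        have h1 : ζ ^ (m : ℕ) ≠ 1 := by
          intro h1
          have h2 := orderOf_dvd_of_pow_eq_one h1
          have h3 := (Nat.dvd_prime K.prime).1 (orderOf_dvd_of_pow_eq_one hζl)
          rcases h3 with h3 | h3
          · exact hζ1 (orderOf_eq_one_iff.1 h3)
          · exact hm (h3 ▸ h2)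
        have h2 := geom_sum_mul (ζ ^ (m : ℕ)) ℓ
        rw [← pow_mul, mul_comm (m : ℕ), pow_mul, hζl, one_pow, sub_self] at h2
        exact (mul_eq_zero.1 h2).resolve_right (sub_ne_zero.2 h1)
      rw [h0, zero_mul, map_zero, Finsupp.zero_apply, Module.Basis.repr_self,
        Finsupp.single_apply]
      split_ifs with h1 h2
      · exfalso
        rw [← h2, hpow] at h1
        exact hm (Nat.dvd_of_mul_dvd_mul_left (K.zero_lt_pow _) h1)
      · simp
      · rfl
  · intro y z _ _ hy hz
    simp only [map_add, Finset.sum_add_distrib, Finsupp.add_apply, hy, hz]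
    split_ifs <;> ring
  · intro c z _ hz
    simp only [map_smul, ← Finset.smul_sum, Finsupp.smul_apply, hz]
    split_ifs <;> simp [mul_left_comm]

theorem cost_frTrace (hM : IsMultiplicationTime F M) {j m : ℕ} (hj : j < h)
    {f : Ω → E[X]} (hf : SmallPoly F (d * ℓ ^ (j + 1)) m f) :
    Cost (KP K.basis f) (KP K.basis fun ω => frTrace F (d * ℓ ^ j) ℓ (f ω))
      (m * (d * ℓ ^ j)) := by
  have hL := K.frobLevel (Ω := Ω) hM hj.le
  have hs : SmallPoly F (d * ℓ ^ j) m fun ω => frTrace F (d * ℓ ^ j) ℓ (f ω) := fun ω =>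
    ⟨fr_frTrace K.prime.one_le (by rw [mul_assoc, ← pow_succ]; exact (hf ω).1),
      natDegree_frTrace_lt (hf ω).2⟩
  refine (hL.coordwise (a := 1) hs fun i n => ?_).mono subset_rfl subset_rfl (by simp)
  have hc : ∀ ω, K.basis.repr ((frTrace F (d * ℓ ^ j) ℓ (f ω)).coeff i) n =
      if ℓ ^ (h - j) ∣ n then (ℓ : F) * K.basis.repr ((f ω).coeff i) n else 0 := by
    intro ω
    rw [frTrace, finsetSum_coeff]
    simp only [coeff_fr]
    exact K.repr_trace hj (by rw [← coeff_fr, (hf ω).1]) n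
  simp only [hc]
  split_ifs
  · exact Cost.const_mul _ (mem_KP f i n)
  · exact Cost.of_subset_consts (by rintro _ rfl; exact .inr (Consts.mem 0)) zero_le_one

end KummerField

theorem Cost.self_union {F : Type u} [Field F] {Ω : Type v} {S T : Set (Ω → F)} {k : ℝ}
    (h : Cost S T k) : Cost S (S ∪ T) k :=
  ((Cost.of_subset (T := S) subset_rfl le_rfl).union h).mono subset_rfl subset_rfl (by simp)

section Chain

variable (F : Type*) [Field F] [Finite F] {E : Type*} [Field E] [Algebra F E] (d ℓ : ℕ)

/-- The norm from the `J`-th level of the Kummer tower to its bottom. -/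
noncomputable def chainNorm : ℕ → E[X] → E[X]
  | 0, f => f
  | J + 1, f => chainNorm J (frProd F (d * ℓ ^ J) ℓ f)

/-- The cofactor of `f` in `chainNorm F d ℓ J f`. -/
noncomputable def chainCof : ℕ → E[X] → E[X]
  | 0, _ => 1
  | J + 1, f => chainCof J (frProd F (d * ℓ ^ J) ℓ f) * frCof F (d * ℓ ^ J) ℓ f

/-- The numerator over `chainNorm F d ℓ J f` of the trace of the fraction `c / f`. -/
noncomputable def chainTrace : ℕ → E[X] → E[X] → E[X]
  | 0, _, c => c
  | J + 1, f, c => chainTrace J (frProd F (d * ℓ ^ J) ℓ f)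
      (frTrace F (d * ℓ ^ J) ℓ (c * frCof F (d * ℓ ^ J) ℓ f))

variable {F d ℓ}

theorem fr_gcd {a c : ℕ} {f : E[X]} (ha : fr F a f = f) (hc : fr F c f = f) :
    fr F (a.gcd c) f = f := by
  rw [fr_eq_iff] at *
  exact fun i => Fr_gcd F (ha i) (hc i)

theorem chainNorm_eq_mul (hl : 1 ≤ ℓ) (J : ℕ) (f : E[X]) :
    chainNorm F d ℓ J f = f * chainCof F d ℓ J f := by
  induction J generalizing f with
  | zero => simp [chainNorm, chainCof]
  | succ J ih => rw [chainNorm, ih, chainCof, frProd_eq_mul_frCof hl]; ring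

theorem fr_frProd_level (hl : 1 ≤ ℓ) {J : ℕ} {f : E[X]} (hf : fr F (d * ℓ ^ (J + 1)) f = f) :
    fr F (d * ℓ ^ J) (frProd F (d * ℓ ^ J) ℓ f) = frProd F (d * ℓ ^ J) ℓ f :=
  fr_frProd hl (by rwa [mul_assoc, ← pow_succ])

theorem fr_frTrace_level (hl : 1 ≤ ℓ) {J : ℕ} {f : E[X]} (hf : fr F (d * ℓ ^ (J + 1)) f = f) :
    fr F (d * ℓ ^ J) (frTrace F (d * ℓ ^ J) ℓ f) = frTrace F (d * ℓ ^ J) ℓ f :=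
  fr_frTrace hl (by rwa [mul_assoc, ← pow_succ])

theorem fr_chainNorm (hl : 1 ≤ ℓ) (J : ℕ) {f : E[X]} (hf : fr F (d * ℓ ^ J) f = f) :
    fr F d (chainNorm F d ℓ J f) = chainNorm F d ℓ J f := by
  induction J generalizing f with
  | zero => simpa [chainNorm] using hf
  | succ J ih => exact ih (fr_frProd_level hl hf)

theorem fr_chainNorm_of_fr (J : ℕ) {t : ℕ} {f : E[X]} (hf : fr F t f = f) :
    fr F t (chainNorm F d ℓ J f) = chainNorm F d ℓ J f := by
  induction J generalizing f with
  | zero => exact hf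
  | succ J ih => exact ih (fr_frProd_of_fr hf)

theorem fr_chainCof_of_fr (J : ℕ) {t : ℕ} {f : E[X]} (hf : fr F t f = f) :
    fr F t (chainCof F d ℓ J f) = chainCof F d ℓ J f := by
  induction J generalizing f with
  | zero => simp [chainCof]
  | succ J ih => rw [chainCof, map_mul, ih (fr_frProd_of_fr hf), fr_frCof_of_fr hf]

theorem fr_chainTrace (hl : 1 ≤ ℓ) (J : ℕ) {f c : E[X]} (hf : fr F (d * ℓ ^ J) f = f)
    (hc : fr F (d * ℓ ^ J) c = c) :
    fr F d (chainTrace F d ℓ J f c) = chainTrace F d ℓ J f c := by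
  induction J generalizing f c with
  | zero => simpa [chainTrace] using hc
  | succ J ih =>
    exact ih (fr_frProd_level hl hf)
      (fr_frTrace_level hl (by rw [map_mul, hc, fr_frCof_of_fr hf]))

theorem fr_chainTrace_of_fr (J : ℕ) {t : ℕ} {f c : E[X]} (hf : fr F t f = f) (hc : fr F t c = c) :
    fr F t (chainTrace F d ℓ J f c) = chainTrace F d ℓ J f c := by
  induction J generalizing f c with
  | zero => exact hc
  | succ J ih =>
    exact ih (fr_frProd_of_fr hf) (fr_frTrace_of_fr (by rw [map_mul, hc, fr_frCof_of_fr hf]))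

theorem chainNorm_monic (J : ℕ) {f : E[X]} (hf : f.Monic) : (chainNorm F d ℓ J f).Monic := by
  induction J generalizing f with
  | zero => exact hf
  | succ J ih => exact ih (frProd_monic hf)

theorem natDegree_chainNorm (J : ℕ) {f : E[X]} (hf : f.Monic) :
    (chainNorm F d ℓ J f).natDegree = ℓ ^ J * f.natDegree := by
  induction J generalizing f with
  | zero => simp [chainNorm]
  | succ J ih => rw [chainNorm, ih (frProd_monic hf), natDegree_frProd hf, pow_succ, mul_assoc]

theorem natDegree_chainNorm_le (J : ℕ) {m : ℕ} {f : E[X]} (hf : f.natDegree ≤ m) :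
    (chainNorm F d ℓ J f).natDegree ≤ ℓ ^ J * m := by
  induction J generalizing f m with
  | zero => simpa [chainNorm] using hf
  | succ J ih =>
    rw [pow_succ, mul_assoc]
    exact ih ((natDegree_frProd_le _ _ _).trans (Nat.mul_le_mul_left _ hf))

theorem natDegree_mul_frCof_lt {a r m : ℕ} (hr : 1 ≤ r) {f c : E[X]} (hf : f.natDegree ≤ m)
    (hc : c.natDegree < m) : (c * frCof F a r f).natDegree < r * m := by
  have h1 := natDegree_mul_le (p := c) (q := frCof F a r f)
  have h2 := natDegree_frCof_le (F := F) a r f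
  have h3 := Nat.mul_le_mul_left (r - 1) hf
  have h4 : r * m = (r - 1) * m + m := by
    obtain ⟨r, rfl⟩ := Nat.exists_eq_add_of_le' hr
    rw [Nat.add_sub_cancel]; ring
  omega

theorem natDegree_chainTrace_lt (hl : 1 ≤ ℓ) (J : ℕ) {m : ℕ} {f c : E[X]} (hf : f.natDegree ≤ m)
    (hc : c.natDegree < m) : (chainTrace F d ℓ J f c).natDegree < ℓ ^ J * m := by
  induction J generalizing f c m with
  | zero => simpa [chainTrace] using hc
  | succ J ih =>
    rw [pow_succ, mul_assoc]
    exact ih ((natDegree_frProd_le _ _ _).trans (Nat.mul_le_mul_left _ hf))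
      (natDegree_frTrace_lt (natDegree_mul_frCof_lt hl hf hc))

theorem eval_chainNorm (hl : 1 ≤ ℓ) (J : ℕ) {f : E[X]} {v : E} (hv : f.eval v = 0) :
    (chainNorm F d ℓ J f).eval v = 0 := by
  rw [chainNorm_eq_mul hl, eval_mul, hv, zero_mul]

theorem eval_chainTrace (hl : 1 ≤ ℓ) (J : ℕ) {f c : E[X]} (hf : fr F (d * ℓ ^ J) f = f) {v : E}
    (hv : f.eval v = 0) :
    (chainTrace F d ℓ J f c).eval v = c.eval v * (chainCof F d ℓ J f).eval v := by
  induction J generalizing f c with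
  | zero => simp [chainTrace, chainCof]
  | succ J ih =>
    rw [chainTrace, ih (fr_frProd_level hl hf), chainCof, eval_mul,
      eval_frTrace_mul_frCof hl (by rwa [mul_assoc, ← pow_succ]) hv]
    · ring
    · rw [frProd_eq_mul_frCof hl, eval_mul, hv, zero_mul]

end Chain

namespace KummerField

variable {F : Type u} {E : Type*} [Field F] [Finite F] [Field E] [Algebra F E] {ℓ d h : ℕ}
  (K : KummerField F E ℓ d h) {Ω : Type v} {M : ℕ → ℝ}

/-- The norms of `f` and the cofactors, for all levels from the `J`-th on. -/
def chainSet : ℕ → (Ω → E[X]) → Set (Ω → F)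
  | 0, f => KP K.basis f
  | J + 1, f => KP K.basis f ∪ KP K.basis (fun ω => frCof F (d * ℓ ^ J) ℓ (f ω)) ∪
      chainSet J fun ω => frProd F (d * ℓ ^ J) ℓ (f ω)

theorem KP_chainNorm_subset (J : ℕ) (f : Ω → E[X]) :
    KP K.basis (fun ω => chainNorm F d ℓ J (f ω)) ⊆ K.chainSet J f := by
  induction J generalizing f with
  | zero => exact subset_rfl
  | succ J ih => exact (ih _).trans Set.subset_union_right

include K

theorem small_frProd {J m : ℕ} {f : Ω → E[X]} (hf : SmallPoly F (d * ℓ ^ (J + 1)) (m + 1) f) :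
    SmallPoly F (d * ℓ ^ J) (ℓ * m + 1) fun ω => frProd F (d * ℓ ^ J) ℓ (f ω) := fun ω =>
  ⟨fr_frProd_level K.prime.one_le (hf ω).1, Nat.lt_succ_of_le ((natDegree_frProd_le _ _ _).trans
    (Nat.mul_le_mul_left _ (Nat.lt_succ_iff.1 (hf ω).2)))⟩

omit K in
theorem small_frCof {J m : ℕ} {f : Ω → E[X]} (hf : SmallPoly F (d * ℓ ^ (J + 1)) (m + 1) f) :
    SmallPoly F (d * ℓ ^ (J + 1)) ((ℓ - 1) * m + 1) fun ω => frCof F (d * ℓ ^ J) ℓ (f ω) :=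
  fun ω => ⟨fr_frCof_of_fr (hf ω).1, Nat.lt_succ_of_le ((natDegree_frCof_le _ _ _).trans
    (Nat.mul_le_mul_left _ (Nat.lt_succ_iff.1 (hf ω).2)))⟩

theorem sub_one_mul_lt {m : ℕ} (hm : 1 ≤ m) : (ℓ - 1) * m < ℓ * m :=
  Nat.mul_lt_mul_of_pos_right (Nat.sub_lt K.prime.pos one_pos) hm

theorem one_le_clog : (1 : ℝ) ≤ Nat.clog 2 ℓ := by
  exact_mod_cast Nat.clog_pos one_lt_two K.prime.two_le

theorem cost_chainSet (hM : IsMultiplicationTime F M) (J : ℕ) :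
    ∀ {m : ℕ} {f : Ω → E[X]}, J ≤ h → 1 ≤ m → SmallPoly F (d * ℓ ^ J) (m + 1) f →
      Cost (KP K.basis f) (K.chainSet J f)
        (J * (240 * Nat.clog 2 ℓ * M (d * ℓ ^ J * (ℓ * m)))) := by
  induction J with
  | zero =>
    intro m f _ _ _
    exact Cost.of_subset subset_rfl (by simp)
  | succ J ih =>
    intro m f hJ hm hf
    have hl := K.prime.pos
    have hL := K.frobLevel (Ω := Ω) hM hJ
    have h1 := K.cost_frCof hM (show J < h from hJ) (m := 2 * m) (by omega)
      (hf.mono (by omega))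
    have hlm : m ≤ ℓ * m := Nat.le_mul_of_pos_left _ hl
    have h2 := hL.mul (2 * (ℓ * m)) _ _ (by omega) (hf.mono (by omega))
      ((small_frCof hf).mono (by have := K.sub_one_mul_lt hm; omega))
    have hfg : (fun ω => frProd F (d * ℓ ^ J) ℓ (f ω)) =
        f * fun ω => frCof F (d * ℓ ^ J) ℓ (f ω) :=
      funext fun ω => frProd_eq_mul_frCof hl _
    rw [← hfg] at h2
    have h3 := ih (by omega) (Nat.mul_pos hl hm) (K.small_frProd hf)
    have hC : d * ℓ ^ J * (ℓ * (ℓ * m)) = d * ℓ ^ (J + 1) * (ℓ * m) := by ring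
    rw [hC] at h3
    refine ((h1.trans h2).trans (h3.mono ?_ subset_rfl le_rfl)).self_union.mono subset_rfl ?_ ?_
    · exact Set.subset_union_right.trans Set.subset_union_right
    · rw [chainSet, Set.union_assoc]
      refine Set.union_subset Set.subset_union_left (Set.union_subset ?_ ?_)
      · exact Set.subset_union_left.trans (Set.subset_union_left.trans Set.subset_union_right)
      · exact Set.subset_union_right.trans Set.subset_union_right
    · have hpos : 1 ≤ d * ℓ ^ (J + 1) * (ℓ * m) := Nat.mul_pos hL.pos (Nat.mul_pos hl hm)
      have e1 := hM.le_sq_mul (k := 2) (n := d * ℓ ^ (J + 1) * (ℓ * (2 * m)))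
        (m := d * ℓ ^ (J + 1) * (ℓ * m))
        (Nat.mul_pos hL.pos (Nat.mul_pos hl (by omega))) hpos (le_of_eq (by ring))
      have e2 := hM.le_sq_mul (k := 2) (n := d * ℓ ^ (J + 1) * (2 * (ℓ * m)))
        (m := d * ℓ ^ (J + 1) * (ℓ * m))
        (Nat.mul_pos hL.pos (by omega)) hpos (le_of_eq (by ring))
      have hΛ := K.one_le_clog
      have hCp := hM.pos hpos
      push_cast at e1 e2 ⊢
      nlinarith [mul_le_mul_of_nonneg_left e1 (by linarith : (0 : ℝ) ≤ Nat.clog 2 ℓ),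
        mul_le_mul_of_nonneg_right hΛ hCp.le]

theorem cost_chainMoments (hM : IsMultiplicationTime F M) {φ : Ω → E[X] →ₗ[E] E}
    (hφ : ∀ a ω g, fr F a g = g → Fr F a (φ ω g) = φ ω g) {W : Ω → E[X]}
    (hW : ∀ ω, fr F d (W ω) = W ω) (J : ℕ) :
    ∀ {m : ℕ} {f : Ω → E[X]}, J ≤ h → 1 ≤ m → SmallPoly F (d * ℓ ^ J) (m + 1) f →
      Cost (K.chainSet J f ∪ KP K.basis fun ω => momentPoly (φ ω) (W ω) (ℓ ^ J * m))
        (KP K.basis fun ω => momentPoly (φ ω) (W ω * chainCof F d ℓ J (f ω)) m)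
        (J * (10 * M (d * ℓ ^ J * (ℓ * m)))) := by
  induction J with
  | zero =>
    intro m f _ _ _
    refine Cost.of_subset ?_ (by simp)
    simp [chainCof]
  | succ J ih =>
    intro m f hJ hm hf
    have hl := K.prime.pos
    have hL := K.frobLevel (Ω := Ω) hM hJ
    have h3 := ih (by omega) (Nat.mul_pos hl hm) (K.small_frProd hf)
    have hC : d * ℓ ^ J * (ℓ * (ℓ * m)) = d * ℓ ^ (J + 1) * (ℓ * m) := by ring
    have hp : ℓ ^ J * (ℓ * m) = ℓ ^ (J + 1) * m := by ring
    rw [hC, hp] at h3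
    have h4 := hL.middleProduct (φ := φ) (p := ℓ * m) (p' := m) (u := (ℓ - 1) * m) (n := ℓ * m)
      (W := fun ω => W ω * chainCof F d ℓ J (frProd F (d * ℓ ^ J) ℓ (f ω))) (hφ _)
      (fun ω => ?_) (small_frCof hf) ?_ le_rfl (K.sub_one_mul_lt hm)
    · refine ((h3.mono ?_ subset_rfl le_rfl).comp (h4.mono ?_ subset_rfl le_rfl)).mono subset_rfl
        ?_ ?_
      · exact Set.union_subset_union_left _ Set.subset_union_right
      · refine Set.union_subset Set.subset_union_right (Set.Subset.trans ?_ Set.subset_union_left)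
        refine Set.Subset.trans ?_ Set.subset_union_left
        exact Set.subset_union_right.trans Set.subset_union_left
      · simp only [chainCof, mul_assoc]
        exact subset_rfl
      · push_cast; linarith
    · rw [map_mul, fr_of_dvd F (hW ω) (Dvd.intro _ rfl), fr_chainCof_of_fr _ (fr_frProd_of_fr (hf ω).1)]
    · have : (ℓ - 1) * m + m = ℓ * m := by
        obtain ⟨r, hr⟩ := Nat.exists_eq_add_of_le' (show 1 ≤ ℓ from hl)
        rw [hr, Nat.add_sub_cancel]; ring
      omega

theorem cost_chainCof_mul (hM : IsMultiplicationTime F M) {g : Ω → E[X]} (hg : SmallPoly F d 1 g)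
    (J : ℕ) : ∀ {f : Ω → E[X]}, J ≤ h → SmallPoly F (d * ℓ ^ J) 1 f →
      Cost (K.chainSet J f ∪ KP K.basis g)
        (KP K.basis fun ω => g ω * chainCof F d ℓ J (f ω)) (J * (10 * M (d * ℓ ^ J))) ∧
      SmallPoly F (d * ℓ ^ J) 1 fun ω => g ω * chainCof F d ℓ J (f ω) := by
  induction J with
  | zero =>
    intro f _ _
    refine ⟨Cost.of_subset ?_ (by simp), ?_⟩
    · simp [chainCof]
    · simpa [chainCof] using hg
  | succ J ih =>
    intro f hJ hf
    have hL := K.frobLevel (Ω := Ω) hM hJ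
    obtain ⟨h1, h2⟩ := ih (by omega) (K.small_frProd (m := 0) hf)
    have hdvd : d * ℓ ^ J ∣ d * ℓ ^ (J + 1) := Nat.mul_dvd_mul_left _ (pow_dvd_pow _ (by omega))
    have h2 := h2.of_dvd hdvd
    have hc := small_frCof (m := 0) hf
    simp only [Nat.mul_zero, zero_add] at hc
    have h3 := hL.mul 1 _ _ le_rfl h2 hc
    have heq : (fun ω => g ω * chainCof F d ℓ (J + 1) (f ω)) =
        (fun ω => g ω * chainCof F d ℓ J (frProd F (d * ℓ ^ J) ℓ (f ω))) *
          fun ω => frCof F (d * ℓ ^ J) ℓ (f ω) := by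
      funext ω
      simp [chainCof, mul_assoc]
    rw [heq]
    refine ⟨((h1.mono ?_ subset_rfl le_rfl).comp (h3.mono ?_ subset_rfl le_rfl)).mono subset_rfl
      subset_rfl ?_, h2.mul hc le_rfl⟩
    · exact Set.union_subset_union_left _ Set.subset_union_right
    · refine Set.union_subset Set.subset_union_right (Set.Subset.trans ?_ Set.subset_union_left)
      refine Set.Subset.trans ?_ Set.subset_union_left
      exact Set.subset_union_right.trans Set.subset_union_left
    · have hpos : 1 ≤ d * ℓ ^ J := Nat.mul_pos K.d_pos (K.zero_lt_pow J)
      have := hM.mono hpos (Nat.le_of_dvd hL.pos hdvd)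
      have hJ0 : (0 : ℝ) ≤ J := Nat.cast_nonneg J
      rw [mul_one]
      push_cast
      nlinarith

theorem cost_chainTrace (hM : IsMultiplicationTime F M) (J : ℕ) :
    ∀ {m : ℕ} {f c : Ω → E[X]}, J ≤ h → 1 ≤ m → SmallPoly F (d * ℓ ^ J) (m + 1) f →
      SmallPoly F (d * ℓ ^ J) m c →
      Cost (K.chainSet J f ∪ KP K.basis c)
        (KP K.basis fun ω => chainTrace F d ℓ J (f ω) (c ω))
        (J * (11 * M (d * ℓ ^ J * (ℓ * m)))) := by
  induction J with
  | zero =>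
    intro m f c _ _ _ _
    refine Cost.of_subset ?_ (by simp)
    simp [chainTrace]
  | succ J ih =>
    intro m f c hJ hm hf hc
    have hl := K.prime.pos
    have hL := K.frobLevel (Ω := Ω) hM hJ
    have hlm : m ≤ ℓ * m := Nat.le_mul_of_pos_left _ hl
    have hlm' := K.sub_one_mul_lt hm
    have h1 := hL.mul (ℓ * m) _ _ (by omega) (hc.mono hlm)
      ((small_frCof hf).mono (by omega))
    have hs : SmallPoly F (d * ℓ ^ (J + 1)) (ℓ * m)
        (c * fun ω => frCof F (d * ℓ ^ J) ℓ (f ω)) := fun ω =>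
      ⟨by simp only [Pi.mul_apply]; rw [map_mul, (hc ω).1, fr_frCof_of_fr (hf ω).1],
        natDegree_mul_frCof_lt hl (Nat.lt_succ_iff.1 (hf ω).2) (hc ω).2⟩
    have h2 := K.cost_frTrace hM (show J < h from hJ) hs
    have h3 := ih (m := ℓ * m) (by omega) (Nat.mul_pos hl hm) (K.small_frProd hf)
      (c := fun ω => frTrace F (d * ℓ ^ J) ℓ (c ω * frCof F (d * ℓ ^ J) ℓ (f ω)))
      fun ω => ⟨fr_frTrace_level hl (hs ω).1, natDegree_frTrace_lt (hs ω).2⟩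
    have hC : d * ℓ ^ J * (ℓ * (ℓ * m)) = d * ℓ ^ (J + 1) * (ℓ * m) := by ring
    rw [hC] at h3
    refine (((h1.mono ?_ subset_rfl le_rfl).comp (h2.mono Set.subset_union_right subset_rfl
      le_rfl)).comp (h3.mono ?_ subset_rfl le_rfl)).mono subset_rfl subset_rfl ?_
    · refine Set.union_subset Set.subset_union_right (Set.Subset.trans ?_ Set.subset_union_left)
      exact Set.subset_union_right.trans Set.subset_union_left
    · exact Set.union_subset_union_left _ (Set.subset_union_right.trans Set.subset_union_left)
    · have e1 := hM.le_self (d * ℓ ^ (J + 1) * (ℓ * m))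
        (Nat.mul_pos hL.pos (Nat.mul_pos hl hm))
      have e2 : ((ℓ * m : ℕ) : ℝ) * (d * ℓ ^ J) ≤ ((d * ℓ ^ (J + 1) * (ℓ * m) : ℕ) : ℝ) := by
        have : ℓ * m * (d * ℓ ^ J) ≤ d * ℓ ^ (J + 1) * (ℓ * m) := by
          rw [mul_comm]
          exact Nat.mul_le_mul_right _ (Nat.mul_le_mul_left _ (Nat.pow_le_pow_right hl (by omega)))
        exact_mod_cast this
      push_cast at e1 e2 ⊢
      linarith

theorem frobLevel_base (hM : IsMultiplicationTime F M) : FrobLevel K.basis M Ω d := by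
  have := K.frobLevel (Ω := Ω) hM (Nat.zero_le h)
  rwa [pow_zero, mul_one] at this

/-- The bound for the costs at the bottom of the Kummer tower, for `e` conjugates of degree `m`. -/
theorem base_bound (hM : IsMultiplicationTime F M) {e m : ℕ} (he : 1 ≤ e) (hm : 1 ≤ m) {k : ℕ}
    (hk : 1 ≤ k) : M (d * (k * (e * m))) ≤ (k : ℝ) ^ 2 * M (ℓ ^ 2 * (e * m)) := by
  have hem : 1 ≤ e * m := Nat.mul_pos he hm
  refine hM.le_sq_mul (Nat.mul_pos K.d_pos (Nat.mul_pos hk hem))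
    (Nat.mul_pos (pow_pos K.prime.pos _) hem) ?_
  calc d * (k * (e * m)) = k * (d * (e * m)) := by ring
    _ ≤ k * (ℓ ^ 2 * (e * m)) := Nat.mul_le_mul_left _ (Nat.mul_le_mul_right _
        (K.le.trans (Nat.le_self_pow two_ne_zero _)))

theorem cost_fr_base (hM : IsMultiplicationTime F M) {m : ℕ} (k : ℕ) {f : Ω → E[X]}
    (hf : SmallPoly F d m f) :
    Cost (KP K.basis f) (KP K.basis fun ω => fr F k (f ω)) (m * d * (2 * d)) := by
  refine (K.frobLevel_base hM).linearMap (K.frobLevel_base hM) hf (fun ω => ?_)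
    (Fr F k : E →ₐ[F] E).toLinearMap fun ω i => by simp
  exact ⟨by rw [← fr_add, add_comm, fr_add, (hf ω).1], by rw [natDegree_fr]; exact (hf ω).2⟩

omit K in
theorem small_frCof_base {e m : ℕ} {f : Ω → E[X]} (hf : SmallPoly F d (m + 1) f) :
    SmallPoly F d ((e - 1) * m + 1) fun ω => frCof F 1 e (f ω) := fun ω =>
  ⟨fr_frCof_of_fr (hf ω).1, Nat.lt_succ_of_le ((natDegree_frCof_le _ _ _).trans
    (Nat.mul_le_mul_left _ (Nat.lt_succ_iff.1 (hf ω).2)))⟩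

theorem cost_base (hM : IsMultiplicationTime F M) {e m : ℕ} (he : 1 ≤ e) (hed : e ≤ d) (hm : 1 ≤ m)
    {f : Ω → E[X]} (hf : SmallPoly F d (m + 1) f) :
    Cost (KP K.basis f) (KP K.basis (fun ω => frCof F 1 e (f ω)) ∪
      KP K.basis (fun ω => frProd F 1 e (f ω))) (210 * Nat.clog 2 ℓ * M (ℓ ^ 2 * (e * m))) := by
  have hL := K.frobLevel_base (Ω := Ω) hM
  have hem : 1 ≤ e * m := Nat.mul_pos he hm
  have h1 := Cost.biUnion (S := KP K.basis f) (Finset.range (e - 1))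
    (fun c => KP K.basis fun ω => fr F (1 * (c + 1)) (f ω))
    (fun _ => (m + 1 : ℕ) * d * (2 * d)) fun c _ => K.cost_fr_base hM (1 * (c + 1)) hf
  have h2 := hL.prod hM (r := e - 1) (r' := e) (m := 2 * m) (by omega) he (Nat.sub_le _ _)
    (f := fun c ω => fr F (1 * (c + 1)) (f ω)) fun c ω =>
      ⟨by rw [← fr_add, add_comm, fr_add, (hf ω).1], by
        rw [natDegree_fr]; exact (hf ω).2.trans_le (by omega)⟩
  have hcof : (∏ c ∈ Finset.range (e - 1), fun ω => fr F (1 * (c + 1)) (f ω)) =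
      fun ω => frCof F 1 e (f ω) := by
    funext ω
    rw [frCof, Finset.prod_apply]
  rw [hcof] at h2
  have hle : (e - 1) * m ≤ e * m := Nat.mul_le_mul_right _ (Nat.sub_le _ _)
  have hle' : m ≤ e * m := Nat.le_mul_of_pos_left _ he
  have h3 := hL.mul (2 * (e * m)) _ _ (by omega) (hf.mono (by omega))
    ((small_frCof_base (e := e) hf).mono (by omega))
  have hfg : (fun ω => frProd F 1 e (f ω)) = f * fun ω => frCof F 1 e (f ω) :=
    funext fun ω => frProd_eq_mul_frCof he _
  rw [← hfg] at h3
  refine ((h1.comp (h2.mono Set.subset_union_right subset_rfl le_rfl)).trans h3).mono subset_rfl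
    subset_rfl ?_
  have b1 := K.base_bound hM he hm (k := 2) (by norm_num)
  have b2 := hM.le_self (ℓ ^ 2 * (e * m)) (Nat.mul_pos (pow_pos K.prime.pos _) hem)
  have b3 : (Nat.clog 2 e : ℝ) ≤ Nat.clog 2 ℓ :=
    Nat.cast_le.2 (Nat.clog_mono_right 2 (hed.trans K.le))
  have b4 := K.one_le_clog
  have b5 : (((e - 1) * ((m + 1) * d * (2 * d)) : ℕ) : ℝ) ≤ ((4 * (ℓ ^ 2 * (e * m)) : ℕ) : ℝ) := by
    refine Nat.cast_le.2 ?_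
    calc (e - 1) * ((m + 1) * d * (2 * d)) ≤ e * ((2 * m) * d * (2 * d)) := by
          refine Nat.mul_le_mul (Nat.sub_le _ _) (Nat.mul_le_mul_right _ (Nat.mul_le_mul_right _ ?_))
          omega
      _ = 4 * (d * d * (e * m)) := by ring
      _ ≤ 4 * (ℓ ^ 2 * (e * m)) := Nat.mul_le_mul_left _ (Nat.mul_le_mul_right _
          (by rw [pow_two]; exact Nat.mul_le_mul K.le K.le))
  have b6 : d * (e * (2 * m)) = d * (2 * (e * m)) := by ring
  simp only [Finset.sum_const, Finset.card_range, nsmul_eq_mul]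
  rw [b6]
  push_cast at b1 b2 b5 ⊢
  have b7 : 0 ≤ M (ℓ ^ 2 * (e * m)) := (hM.pos (Nat.mul_pos (pow_pos K.prime.pos _) hem)).le
  have b8 : (Nat.clog 2 e : ℝ) * (40 * M (d * (2 * (e * m)))) ≤
      Nat.clog 2 ℓ * (40 * (2 ^ 2 * M (ℓ ^ 2 * (e * m)))) := by
    refine mul_le_mul b3 (by linarith) ?_ (by linarith)
    exact mul_nonneg (by norm_num)
      (hM.pos (Nat.mul_pos K.d_pos (by omega))).le
  nlinarith [mul_le_mul_of_nonneg_right b4 b7]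

theorem cost_baseMoments (hM : IsMultiplicationTime F M) {φ : Ω → E[X] →ₗ[E] E}
    (hφ : ∀ a ω g, fr F a g = g → Fr F a (φ ω g) = φ ω g) {W : Ω → E[X]}
    (hW : ∀ ω, fr F 1 (W ω) = W ω) {e m : ℕ} (he : 1 ≤ e) (hm : 1 ≤ m) {f : Ω → E[X]}
    (hf : SmallPoly F d (m + 1) f) :
    Cost (KP K.basis (fun ω => momentPoly (φ ω) (W ω) (e * m)) ∪
        KP K.basis fun ω => frCof F 1 e (f ω))
      (KP K.basis fun ω => momentPoly (φ ω) (W ω * frCof F 1 e (f ω)) m)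
      (10 * M (ℓ ^ 2 * (e * m))) := by
  have hL := K.frobLevel_base (Ω := Ω) hM
  have hem : (e - 1) * m + m = e * m := by
    obtain ⟨r, hr⟩ := Nat.exists_eq_add_of_le' he
    rw [hr, Nat.add_sub_cancel]; ring
  refine (hL.middleProduct (n := e * m) (hφ _) (fun ω => fr_of_dvd F (hW ω) (one_dvd _))
    (small_frCof_base hf) (by omega) le_rfl (by omega)).mono subset_rfl subset_rfl ?_
  have := K.base_bound hM he hm le_rfl
  rw [one_mul] at this
  push_cast at this
  linarith

theorem cost_baseTrace (hM : IsMultiplicationTime F M) {e m : ℕ} (he : 1 ≤ e) (hm : 1 ≤ m)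
    {f c : Ω → E[X]} (hf : SmallPoly F d (m + 1) f) (hfe : ∀ ω, fr F e (f ω) = f ω)
    (hc : SmallPoly F d m c) (hce : ∀ ω, fr F e (c ω) = c ω) :
    Cost (KP K.basis c ∪ KP K.basis fun ω => frCof F 1 e (f ω))
      (KP K.basis fun ω => frTrace F 1 e (c ω * frCof F 1 e (f ω)))
      (12 * M (ℓ ^ 2 * (e * m))) := by
  have hL := K.frobLevel_base (Ω := Ω) hM
  have hL1 := K.frobLevel_one (Ω := Ω) hM
  have hem : (e - 1) * m + m = e * m := by
    obtain ⟨r, hr⟩ := Nat.exists_eq_add_of_le' he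
    rw [hr, Nat.add_sub_cancel]; ring
  have h1 := hL.mul (e * m) _ _ (by omega) (hc.mono (by omega))
    ((small_frCof_base (e := e) hf).mono (by omega))
  have hs : SmallPoly F d (e * m) (c * fun ω => frCof F 1 e (f ω)) := fun ω =>
    ⟨by simp only [Pi.mul_apply]; rw [map_mul, (hc ω).1, fr_frCof_of_fr (hf ω).1],
      natDegree_mul_frCof_lt he (Nat.lt_succ_iff.1 (hf ω).2) (hc ω).2⟩
  have h2 := hL.linearMap hL1 hs (g := fun ω => frTrace F 1 e (c ω * frCof F 1 e (f ω)))
    (fun ω => ⟨?_, natDegree_frTrace_lt (hs ω).2⟩)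
    (∑ k ∈ Finset.range e, (Fr F (1 * k) : E →ₐ[F] E).toLinearMap) fun ω i => ?_
  · refine (h1.comp (h2.mono Set.subset_union_right subset_rfl le_rfl)).mono subset_rfl
      subset_rfl ?_
    have b1 := K.base_bound hM he hm le_rfl
    have b2 := hM.le_self (ℓ ^ 2 * (e * m)) (Nat.mul_pos (pow_pos K.prime.pos _) (by omega))
    have b3 : ((e * m * d : ℕ) : ℝ) ≤ ((ℓ ^ 2 * (e * m) : ℕ) : ℝ) := by
      refine Nat.cast_le.2 ?_
      rw [mul_comm]
      exact Nat.mul_le_mul_right _ (K.le.trans (Nat.le_self_pow two_ne_zero _))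
    rw [one_mul] at b1
    push_cast at b1 b2 b3 ⊢
    linarith
  · exact fr_frTrace he (by rw [one_mul, map_mul, hce, fr_frCof_of_fr (hfe ω)])
  · rw [frTrace, finsetSum_coeff, LinearMap.sum_apply]
    exact Finset.sum_congr rfl fun k _ => by rw [coeff_fr]; rfl

/-- Inversion of elements of the bottom of the Kummer tower. -/
theorem cost_baseInverse (hM : IsMultiplicationTime F M) {e : ℕ} (he : 1 ≤ e)
    {y : Ω → E} (hyd : ∀ ω, Fr F d (y ω) = y ω) (hye : ∀ ω, Fr F e (y ω) = y ω)
    (hy0 : ∀ ω, y ω ≠ 0) :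
    Cost (KP K.basis (fun ω => frCof F 1 e (C (y ω))) ∪
        KP K.basis (fun ω => frProd F 1 e (C (y ω))))
      (KP K.basis fun ω => C (y ω)⁻¹) (M (ℓ ^ 2 * e)) := by
  have := K.finiteDimensional
  have hL := K.frobLevel_base (Ω := Ω) hM
  have hpos : 0 < d * ℓ ^ h := Nat.mul_pos K.d_pos (pow_pos K.prime.pos h)
  have hfr : ∀ ω, ∃ a : F, frProd F 1 e (C (y ω)) = C (algebraMap F E a) := by
    intro ω
    obtain ⟨g, hg⟩ := exists_map_of_fr_one (fr_frProd (F := F) (a := 1) he (f := C (y ω))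
      (by rw [one_mul, fr_C, hye]))
    have hd : (frProd F 1 e (C (y ω))).natDegree = 0 :=
      Nat.le_zero.1 ((natDegree_frProd_le _ _ _).trans (by simp))
    refine ⟨g.coeff 0, ?_⟩
    rw [eq_C_of_natDegree_eq_zero hd, ← hg, coeff_map]
  choose a ha using hfr
  have ha0 : ∀ ω, a ω ≠ 0 := by
    intro ω h0
    have h1 := ha ω
    rw [h0, map_zero, map_zero, frProd, Finset.prod_eq_zero_iff] at h1
    obtain ⟨k, -, hk⟩ := h1
    rw [fr_C, C_eq_zero] at hk
    exact hy0 ω ((map_eq_zero _).1 hk)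
  have haK : a = fun ω => K.basis.repr ((frProd F 1 e (C (y ω))).coeff 0) ⟨0, hpos⟩ := by
    funext ω
    rw [ha ω, coeff_C_zero, K.repr_algebraMap_zero]
  have hinv : ∀ ω, (y ω)⁻¹ = (a ω)⁻¹ • (frCof F 1 e (C (y ω))).coeff 0 := by
    intro ω
    have h1 := frProd_eq_mul_frCof (F := F) (a := 1) he (C (y ω))
    have h2 := congrArg (fun p => coeff p 0) h1
    simp only [ha ω, coeff_C_zero, coeff_C_mul] at h2
    rw [inv_eq_iff_eq_inv, eq_comm, inv_eq_iff_eq_inv]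
    refine eq_inv_of_mul_eq_one_right ?_
    rw [mul_smul_comm, ← h2, Algebra.smul_def, ← map_mul, inv_mul_cancel₀ (ha0 ω), map_one]
  refine (hL.coordwise (m := 1) (a := 1) (SmallPoly.const fun ω => by rw [map_inv₀, hyd])
    fun i j => ?_).mono subset_rfl subset_rfl ?_
  · rcases i with _ | i
    · have h1 : (fun ω => K.basis.repr ((C (y ω)⁻¹ : E[X]).coeff 0) j) =
          fun ω => K.basis.repr ((frCof F 1 e (C (y ω))).coeff 0) j / a ω := by
        funext ω
        rw [coeff_C_zero, hinv, map_smul, Finsupp.smul_apply, smul_eq_mul, div_eq_inv_mul]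
      rw [h1]
      refine Cost.div (.inl ⟨(0, j), rfl⟩) (.inr ?_) ha0
      rw [haK]
      exact ⟨(0, ⟨0, hpos⟩), rfl⟩
    · refine Cost.of_subset_consts ?_ zero_le_one
      rintro _ rfl
      exact .inr ⟨0, by simp⟩
  · have b1 := hM.le_self (ℓ ^ 2 * e) (Nat.mul_pos (pow_pos K.prime.pos _) he)
    have b2 : ((d : ℕ) : ℝ) ≤ ((ℓ ^ 2 * e : ℕ) : ℝ) := Nat.cast_le.2
      ((K.le.trans (Nat.le_self_pow two_ne_zero _)).trans (Nat.le_mul_of_pos_right _ he))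
    push_cast at b1 b2 ⊢
    linarith

end KummerField

section NewtonInverse

variable {E : Type*} [Field E]

theorem coeff_inv_newton (φ : PowerSeries E) (h0 : PowerSeries.constantCoeff φ ≠ 0)
    {n i : ℕ} (hi : i < 2 * n) :
    PowerSeries.coeff i (φ⁻¹ : PowerSeries E) = ((PowerSeries.trunc n φ⁻¹ : E[X]) *
      (2 - PowerSeries.trunc (2 * n) φ * (PowerSeries.trunc n φ⁻¹ : E[X]))).coeff i := by
  have key : ∀ (ψ : PowerSeries E) (m : ℕ), ∃ U : PowerSeries E,
      ψ = ((PowerSeries.trunc m ψ : E[X]) : PowerSeries E) + PowerSeries.X ^ m * U := by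
    intro ψ m
    have : PowerSeries.X ^ m ∣ ψ - ((PowerSeries.trunc m ψ : E[X]) : PowerSeries E) := by
      rw [PowerSeries.X_pow_dvd_iff]
      intro j hj
      rw [map_sub, PowerSeries.coeff_coe_trunc_of_lt hj, sub_self]
    obtain ⟨U, hU⟩ := this
    exact ⟨U, by rw [← hU]; ring⟩
  obtain ⟨U, hU⟩ := key φ⁻¹ n
  obtain ⟨W, hW⟩ := key φ (2 * n)
  have h1 := PowerSeries.mul_inv_cancel φ h0
  set V := PowerSeries.trunc n φ⁻¹
  set R := PowerSeries.trunc (2 * n) φ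
  have h2 : φ⁻¹ = ((V * (2 - R * V) : E[X]) : PowerSeries E) +
      PowerSeries.X ^ (2 * n) * (φ * U ^ 2 - W * (V : PowerSeries E) ^ 2) := by
    have hV : (V : PowerSeries E) = φ⁻¹ - PowerSeries.X ^ n * U := by rw [hU]; ring
    have hR : (R : PowerSeries E) = φ - PowerSeries.X ^ (2 * n) * W := by rw [hW]; ring
    have e : ((V * (2 - R * V) : E[X]) : PowerSeries E) =
        (V : PowerSeries E) * (2 - R * V) := by
      rw [Polynomial.coe_mul, Polynomial.coe_sub, Polynomial.coe_mul]
      congr 2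
      exact map_ofNat (Polynomial.coeToPowerSeries.ringHom (R := E)) 2
    rw [e, hR]
    have h3 : φ * (V : PowerSeries E) = 1 - φ * (PowerSeries.X ^ n * U) := by
      rw [hV, mul_sub, h1]
    have h4 : (V : PowerSeries E) * (2 - (φ - PowerSeries.X ^ (2 * n) * W) * (V : PowerSeries E)) =
        (V : PowerSeries E) + (V : PowerSeries E) * (1 - φ * (V : PowerSeries E)) + PowerSeries.X ^ (2 * n) * (W * (V : PowerSeries E) ^ 2) := by ring
    rw [h4, h3]
    have h5 : (V : PowerSeries E) * (1 - (1 - φ * (PowerSeries.X ^ n * U))) =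
        (φ * (V : PowerSeries E)) * (PowerSeries.X ^ n * U) := by ring
    rw [h5, h3, hV, pow_mul']
    ring
  conv_lhs => rw [h2]
  rw [map_add, coeff_coe, PowerSeries.coeff_X_pow_mul', if_neg (by omega), add_zero]

end NewtonInverse

section PowerSums

variable {E : Type*} [Field E]

/-- The sum of the values of a polynomial at the points of `ρ`. -/
noncomputable def evalSum (ρ : Finset E) : E[X] →ₗ[E] E := ∑ r ∈ ρ, leval r

theorem evalSum_apply (ρ : Finset E) (g : E[X]) : evalSum ρ g = ∑ r ∈ ρ, g.eval r := by
  simp [evalSum, LinearMap.sum_apply, leval_apply]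

theorem coeff_momentPoly_mul_reflect (ρ : Finset E) {i : ℕ} (hi : i < ρ.card) :
    (momentPoly (evalSum ρ) 1 ρ.card * reflect ρ.card (∏ r ∈ ρ, (X - C r))).coeff i =
      (reflect (ρ.card - 1) (derivative (∏ r ∈ ρ, (X - C r)))).coeff i := by
  classical
  set T := ∏ r ∈ ρ, (X - C r) with hT
  set t := ρ.card with ht
  have hdeg : T.natDegree = t := natDegree_finsetProd_X_sub_C_eq_card ρ _
  have hder : derivative T = ∑ r ∈ ρ, T /ₘ (X - C r) := by
    rw [hT, derivative_prod_finset]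
    refine Finset.sum_congr rfl fun r hr => ?_
    rw [derivative_X_sub_C, mul_one, ← Finset.mul_prod_erase ρ _ hr,
      mul_divByMonic_cancel_left _ (monic_X_sub_C r)]
  rw [coeff_reflect, revAt_le (by omega), hder, finsetSum_coeff, coeff_mul,
    Finset.Nat.sum_antidiagonal_eq_sum_range_succ fun a c =>
      (momentPoly (evalSum ρ) 1 t).coeff a * (reflect t T).coeff c]
  simp only [coeff_divByMonic_X_sub_C, hdeg]
  rw [Finset.sum_congr rfl (g := fun k => ∑ r ∈ ρ, r ^ k * T.coeff (t - i + k)) fun k hk => ?_]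
  · rw [Finset.sum_comm]
    refine Finset.sum_congr rfl fun r _ => ?_
    rw [show t - 1 - i + 1 = t - i by omega, ← Finset.Ico_add_one_right_eq_Icc,
      Finset.sum_Ico_eq_sum_range, show t + 1 - (t - i) = i.succ by omega]
    exact Finset.sum_congr rfl fun k _ => by rw [Nat.add_sub_cancel_left]
  · have hk := Finset.mem_range.1 hk
    rw [coeff_momentPoly, if_pos (by omega), coeff_reflect, revAt_le (by omega), evalSum_apply,
      Finset.sum_mul]
    refine Finset.sum_congr rfl fun r _ => ?_
    rw [one_mul, eval_pow, eval_X]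
    congr 2
    omega

theorem constantCoeff_reflect_prod (ρ : Finset E) : PowerSeries.constantCoeff
    ((reflect ρ.card (∏ r ∈ ρ, (X - C r)) : E[X]) : PowerSeries E) = 1 := by
  rw [← PowerSeries.coeff_zero_eq_constantCoeff_apply, coeff_coe, coeff_reflect,
    revAt_le (Nat.zero_le _), Nat.sub_zero]
  have := (monic_prod_X_sub_C (fun r => r) ρ).coeff_natDegree
  rwa [natDegree_finsetProd_X_sub_C_eq_card ρ] at this

theorem coeff_momentPoly_eq_mul_inv (ρ : Finset E) {i : ℕ} (hi : i < ρ.card) :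
    (momentPoly (evalSum ρ) 1 ρ.card).coeff i =
      (reflect (ρ.card - 1) (derivative (∏ r ∈ ρ, (X - C r))) * PowerSeries.trunc ρ.card
        ((reflect ρ.card (∏ r ∈ ρ, (X - C r)) : E[X]) : PowerSeries E)⁻¹).coeff i := by
  have h0 := constantCoeff_reflect_prod ρ
  set R : PowerSeries E := ((reflect ρ.card (∏ r ∈ ρ, (X - C r)) : E[X]) : PowerSeries E)
  set A := momentPoly (evalSum ρ) 1 ρ.card
  set G := reflect (ρ.card - 1) (derivative (∏ r ∈ ρ, (X - C r)))
  have h1 : PowerSeries.X ^ ρ.card ∣ (A : PowerSeries E) * R - (G : PowerSeries E) := by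
    rw [PowerSeries.X_pow_dvd_iff]
    intro j hj
    rw [map_sub, ← coe_mul, coeff_coe, coeff_coe, coeff_momentPoly_mul_reflect ρ hj, sub_self]
  obtain ⟨U, hU⟩ := h1
  have h2 : (A : PowerSeries E) = (G : PowerSeries E) * R⁻¹ +
      PowerSeries.X ^ ρ.card * (U * R⁻¹) := by
    rw [← mul_assoc, ← hU, ← add_mul, add_sub_cancel, mul_assoc,
      PowerSeries.mul_inv_cancel R (by rw [h0]; exact one_ne_zero), mul_one]
  have h3 := congrArg (PowerSeries.coeff i) h2
  rw [map_add, PowerSeries.coeff_X_pow_mul', if_neg (by omega), add_zero, coeff_coe] at h3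
  rw [h3, PowerSeries.coeff_mul, coeff_mul]
  refine Finset.sum_congr rfl fun x hx => ?_
  rw [coeff_coe, ← coeff_coe (PowerSeries.trunc _ _), PowerSeries.coeff_coe_trunc_of_lt]
  have := Finset.HasAntidiagonal.mem_antidiagonal.1 hx
  omega

variable (F : Type*) [Field F] [Finite F] [Algebra F E]

theorem Fr_evalSum {ρ : Finset E} (hρ : fr F 1 (∏ r ∈ ρ, (X - C r)) = ∏ r ∈ ρ, (X - C r)) (a : ℕ)
    {g : E[X]} (hg : fr F a g = g) : Fr F a (evalSum ρ g) = evalSum ρ g := by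
  classical
  have hmem : ∀ r ∈ ρ, Fr F a r ∈ ρ := by
    intro r hr
    have h1 : (∏ r ∈ ρ, (X - C r)).eval r = 0 := by
      rw [eval_prod]
      exact Finset.prod_eq_zero hr (by simp)
    have h2 := eval_fr F a (∏ r ∈ ρ, (X - C r)) r
    rw [fr_of_dvd F hρ (one_dvd a), h1, map_zero, eval_prod, Finset.prod_eq_zero_iff] at h2
    obtain ⟨r', hr', h⟩ := h2
    rw [eval_sub, eval_X, eval_C, sub_eq_zero] at h
    rwa [h]
  have himg : ρ.image (Fr F a : E → E) = ρ :=
    Finset.eq_of_subset_of_card_le (Finset.image_subset_iff.2 hmem)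
      (Finset.card_image_of_injective _ (Fr_injective F a)).ge
  rw [evalSum_apply, map_sum]
  conv_rhs => rw [← himg, Finset.sum_image fun _ _ _ _ h => Fr_injective F a h]
  refine Finset.sum_congr rfl fun r _ => ?_
  rw [← eval_fr, hg]

end PowerSums

section PowerSumsCost

variable {F : Type u} [Field F] [Finite F] {E : Type*} [Field E] [Algebra F E] {Ω : Type v}
  {ι : Type*} {b : Module.Basis ι F E} {M : ℕ → ℝ} {K : ℕ}

theorem Fr_coeff_inv {R : PowerSeries E} (h0 : PowerSeries.constantCoeff R ≠ 0)
    (hR : ∀ i, Fr F K (PowerSeries.coeff i R) = PowerSeries.coeff i R) (i : ℕ) :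
    Fr F K (PowerSeries.coeff i R⁻¹) = PowerSeries.coeff i R⁻¹ := by
  have h1 : PowerSeries.map (Fr F K : E →ₐ[F] E).toRingHom R = R := by
    ext i; simpa using hR i
  have h2 : PowerSeries.map (Fr F K : E →ₐ[F] E).toRingHom R⁻¹ = R⁻¹ := by
    rw [PowerSeries.eq_inv_iff_mul_eq_one h0]
    conv_lhs => rw [← h1]
    rw [h1, ← map_one (PowerSeries.map (Fr F K : E →ₐ[F] E).toRingHom),
      ← PowerSeries.inv_mul_cancel R h0, map_mul, h1]
  conv_rhs => rw [← h2]
  simp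

theorem SmallPoly.trunc {R : Ω → PowerSeries E} {n : ℕ} (hn : 1 ≤ n)
    (hR : ∀ ω i, Fr F K (PowerSeries.coeff i (R ω)) = PowerSeries.coeff i (R ω)) :
    SmallPoly F K n fun ω => PowerSeries.trunc n (R ω) := by
  refine fun ω => ⟨?_, ?_⟩
  · rw [fr_eq_iff]
    intro i
    rw [PowerSeries.coeff_trunc]
    split_ifs
    · exact hR ω i
    · simp
  · obtain ⟨n, rfl⟩ := Nat.exists_eq_add_of_le' hn
    exact PowerSeries.natDegree_trunc_lt _ _

/-- Inversion of power series by Newton's iteration. -/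
theorem FrobLevel.truncInverse (hL : FrobLevel b M Ω K) (hM : IsMultiplicationTime F M)
    {R : Ω → E[X]} (hR : ∀ ω, fr F K (R ω) = R ω)
    (h0 : ∀ ω, PowerSeries.constantCoeff (R ω : PowerSeries E) = 1) (k : ℕ) :
    Cost (KP b R) (KP b fun ω => PowerSeries.trunc (2 ^ k) (R ω : PowerSeries E)⁻¹)
      (21 * M (K * 2 ^ (k + 1))) := by
  have h0' : ∀ ω, PowerSeries.constantCoeff (R ω : PowerSeries E) ≠ 0 := fun ω => by
    rw [h0]; exact one_ne_zero
  have hRc : ∀ ω i, Fr F K (PowerSeries.coeff i (R ω : PowerSeries E)) =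
      PowerSeries.coeff i (R ω : PowerSeries E) := fun ω i => by
    rw [coeff_coe]; exact (fr_eq_iff F).1 (hR ω) i
  have hIc := fun ω => Fr_coeff_inv (h0' ω) (hRc ω)
  suffices h : Cost (KP b R) (KP b fun ω => PowerSeries.trunc (2 ^ k) (R ω : PowerSeries E)⁻¹)
      (21 * ∑ j ∈ Finset.range k, M (K * 2 ^ (j + 1))) by
    refine h.mono subset_rfl subset_rfl ?_
    have hs : ∑ j ∈ Finset.range k, M (K * 2 ^ (j + 1)) ≤ M (K * 2 ^ (k + 1)) := by
      rcases Nat.eq_zero_or_pos k with rfl | hk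
      · simpa using (hM.pos (Nat.mul_pos hL.pos two_pos)).le
      refine hM.sum_le _ (Finset.nonempty_range_iff.2 hk.ne')
        (fun j _ => Nat.mul_pos hL.pos (pow_pos two_pos _)) ?_
      rw [← Finset.mul_sum]
      refine Nat.mul_le_mul_left _ ?_
      simp only [pow_succ]
      rw [← Finset.sum_mul, Nat.geomSum_eq le_rfl]
      exact Nat.mul_le_mul_right _ ((Nat.div_le_self _ _).trans (Nat.sub_le _ _))
    linarith
  induction k with
  | zero =>
    refine Cost.of_subset_consts (Set.Subset.trans (Eq.subset ?_)
      ((KP_const (b := b) (C (1 : E))).trans Set.subset_union_right)) (by simp)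
    congr 1
    funext ω
    ext i
    rw [PowerSeries.coeff_trunc, coeff_C]
    by_cases hi : i = 0
    · subst hi
      simp [h0]
    · rw [if_neg (by omega), if_neg hi]
  | succ k ih =>
    have hp : 2 ^ (k + 1) = 2 * 2 ^ k := pow_succ' 2 k
    have hp0 : 1 ≤ 2 ^ (k + 1) := Nat.pow_pos two_pos
    have hVs := (SmallPoly.trunc (K := K) (n := 2 ^ k) (Nat.pow_pos two_pos) hIc).mono
      (show 2 ^ k ≤ 2 ^ (k + 1) by omega)
    have hRs := SmallPoly.trunc (K := K) hp0 hRc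
    have hRK : KP b (fun ω => (PowerSeries.trunc (2 ^ (k + 1)) (R ω : PowerSeries E))) ⊆
        KP b R ∪ Consts F Ω := KP_subset_of_coeff fun i => by
      by_cases hi : i < 2 ^ (k + 1)
      · exact .inl ⟨i, fun ω => by rw [PowerSeries.coeff_trunc, if_pos hi, coeff_coe]⟩
      · exact .inr ⟨0, fun ω => by rw [PowerSeries.coeff_trunc, if_neg hi]⟩
    have h1 := hL.mul _ _ _ hp0 hRs hVs
    set V := fun ω => (PowerSeries.trunc (2 ^ k) (R ω : PowerSeries E)⁻¹ : E[X]) with hV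
    set R' := fun ω => PowerSeries.trunc (2 ^ (k + 1)) (R ω : PowerSeries E) with hR'
    have hWc : ∀ ω i, Fr F K (PowerSeries.coeff i ((2 - R' ω * V ω : E[X]) : PowerSeries E)) =
        PowerSeries.coeff i ((2 - R' ω * V ω : E[X]) : PowerSeries E) := fun ω i => by
      rw [coeff_coe]
      refine (fr_eq_iff F).1 ?_ i
      rw [map_sub, map_mul, (hRs ω).1, (hVs ω).1, map_ofNat]
    have hWs := SmallPoly.trunc (K := K) hp0 hWc
    have h2 : Cost (KP b (R' * V)) (KP b fun ω =>
        PowerSeries.trunc (2 ^ (k + 1)) ((2 - R' ω * V ω : E[X]) : PowerSeries E))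
        ((2 ^ (k + 1) : ℕ) * K * 1) := by
      refine hL.coordwise hWs fun i j => Cost.add_consts ?_
      by_cases hi : i < 2 ^ (k + 1)
      · refine (Cost.sub (.inr (Consts.mem (b.repr ((2 : E[X]).coeff i) j)))
          (.inl (mem_KP (R' * V) i j))).mono subset_rfl ?_ le_rfl
        rintro _ rfl
        funext ω
        rw [PowerSeries.coeff_trunc, if_pos hi, coeff_coe, coeff_sub, map_sub]
        rfl
      · refine Cost.of_subset ?_ zero_le_one
        rintro _ rfl
        refine .inr ⟨0, funext fun ω => ?_⟩
        rw [PowerSeries.coeff_trunc, if_neg hi, map_zero]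
        rfl
    have h3 := hL.mul _ _ _ hp0 hVs hWs
    have h4 : KP b (fun ω => (PowerSeries.trunc (2 ^ (k + 1)) (R ω : PowerSeries E)⁻¹ : E[X])) ⊆
        KP b (V * fun ω => PowerSeries.trunc (2 ^ (k + 1))
          ((2 - R' ω * V ω : E[X]) : PowerSeries E)) ∪ Consts F Ω := by
      refine KP_subset_of_coeff fun i => ?_
      by_cases hi : i < 2 ^ (k + 1)
      · refine .inl ⟨i, fun ω => ?_⟩
        rw [PowerSeries.coeff_trunc, if_pos hi,
          coeff_inv_newton _ (h0' ω) (hp ▸ hi), Pi.mul_apply, ← hp, coeff_mul,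
          coeff_mul]
        refine Finset.sum_congr rfl fun x hx => ?_
        have := Finset.HasAntidiagonal.mem_antidiagonal.1 hx
        refine congrArg₂ _ rfl ?_
        rw [PowerSeries.coeff_trunc, if_pos (by omega), coeff_coe]
      · exact .inr ⟨0, fun ω => by rw [PowerSeries.coeff_trunc, if_neg hi]⟩
    have h1' : Cost (KP b R ∪ KP b V) (KP b (R' * V)) (10 * M (K * 2 ^ (k + 1))) := by
      refine Cost.add_consts (h1.mono ?_ subset_rfl le_rfl)
      exact Set.union_subset (hRK.trans (Set.union_subset_union_left _ Set.subset_union_left))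
        (Set.subset_union_right.trans Set.subset_union_left)
    refine (ih.comp ((h1'.comp (h2.mono Set.subset_union_right subset_rfl le_rfl)).comp
      ((h3.mono ?_ subset_rfl le_rfl).comp (Cost.of_subset_consts (k := 0)
        (h4.trans (Set.union_subset_union_left _ Set.subset_union_right)) le_rfl)))).mono
      subset_rfl subset_rfl ?_
    · exact Set.union_subset (Set.subset_union_right.trans Set.subset_union_left)
        Set.subset_union_right
    · have := hM.le_self (K * 2 ^ (k + 1)) (Nat.mul_pos hL.pos hp0)
      rw [Finset.sum_range_succ]
      push_cast at this ⊢
      linarith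

/-- The power sums of the roots of a polynomial from its coefficients. -/
theorem FrobLevel.powerSums (hL : FrobLevel b M Ω 1) (hM : IsMultiplicationTime F M)
    {ρ : Ω → Finset E} {t : ℕ} (ht : 1 ≤ t) (hρ : ∀ ω, (ρ ω).card = t)
    (hfr : ∀ ω, fr F 1 (∏ r ∈ ρ ω, (X - C r)) = ∏ r ∈ ρ ω, (X - C r)) :
    Cost (KP b fun ω => ∏ r ∈ ρ ω, (X - C r))
      (KP b fun ω => momentPoly (evalSum (ρ ω)) 1 t) (400 * M t) := by
  set T : Ω → E[X] := fun ω => ∏ r ∈ ρ ω, (X - C r) with hT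
  have hdeg : ∀ ω, (T ω).natDegree = t := fun ω => by
    rw [hT, natDegree_finsetProd_X_sub_C_eq_card, hρ]
  set R : Ω → E[X] := fun ω => reflect t (T ω) with hR
  have hRK : KP b R ⊆ KP b T ∪ Consts F Ω :=
    KP_subset_of_coeff fun i => .inl ⟨revAt t i, fun ω => coeff_reflect _ _ _⟩
  have hRfr : ∀ ω, fr F 1 (R ω) = R ω := fun ω => by rw [hR, fr_reflect, hfr]
  have h0 : ∀ ω, PowerSeries.constantCoeff (R ω : PowerSeries E) = 1 := fun ω => by
    have := constantCoeff_reflect_prod (ρ ω)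
    rwa [hρ] at this
  have h1 := hL.truncInverse hM hRfr h0 (Nat.clog 2 t)
  have hct : t ≤ 2 ^ Nat.clog 2 t := Nat.le_pow_clog one_lt_two t
  have hIK : KP b (fun ω => (PowerSeries.trunc t (R ω : PowerSeries E)⁻¹ : E[X])) ⊆
      KP b (fun ω => (PowerSeries.trunc (2 ^ Nat.clog 2 t) (R ω : PowerSeries E)⁻¹ : E[X])) ∪
        Consts F Ω := KP_subset_of_coeff fun i => by
    by_cases hi : i < t
    · exact .inl ⟨i, fun ω => by
        rw [PowerSeries.coeff_trunc, if_pos hi, PowerSeries.coeff_trunc, if_pos (by omega)]⟩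
    · exact .inr ⟨0, fun ω => by rw [PowerSeries.coeff_trunc, if_neg hi]⟩
  have hIs : SmallPoly F 1 t fun ω => PowerSeries.trunc t (R ω : PowerSeries E)⁻¹ := by
    refine SmallPoly.trunc ht fun ω => Fr_coeff_inv (by rw [h0]; exact one_ne_zero) fun i => ?_
    rw [coeff_coe]
    exact (fr_eq_iff F).1 (hRfr ω) i
  have hDs : SmallPoly F 1 t fun ω => derivative (T ω) := fun ω => by
    refine ⟨(fr_eq_iff F).2 fun i => ?_, ?_⟩
    · rw [coeff_derivative, map_mul, (fr_eq_iff F).1 (hfr ω), map_add, map_natCast, map_one]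
    · have := natDegree_derivative_lt (p := T ω) (by rw [hdeg]; omega)
      rwa [hdeg] at this
  have h2 : Cost (KP b T) (KP b fun ω => derivative (T ω)) (t * (1 : ℕ) * 1) := by
    refine hL.coordwise hDs fun i j =>
      (Cost.const_mul ((i + 1 : ℕ) : F) (mem_KP T (i + 1) j)).mono subset_rfl ?_ le_rfl
    rintro _ rfl
    funext ω
    have : (T ω).coeff (i + 1) * ((i : E) + 1) = ((i + 1 : ℕ) : F) • (T ω).coeff (i + 1) := by
      rw [Algebra.smul_def, map_natCast]
      push_cast
      ring
    rw [coeff_derivative, this, map_smul, Finsupp.smul_apply, smul_eq_mul]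
  have hGK : KP b (fun ω => reflect (t - 1) (derivative (T ω))) ⊆
      KP b (fun ω => derivative (T ω)) ∪ Consts F Ω :=
    KP_subset_of_coeff fun i => .inl ⟨revAt (t - 1) i, fun ω => coeff_reflect _ _ _⟩
  have hGs : SmallPoly F 1 t fun ω => reflect (t - 1) (derivative (T ω)) := fun ω =>
    ⟨by rw [fr_reflect, (hDs ω).1], (natDegree_reflect_le.trans
      (max_le le_rfl (Nat.le_sub_one_of_lt (hDs ω).2))).trans_lt (by omega)⟩
  have h3 := hL.mul t _ _ ht hGs hIs
  have h4 : KP b (fun ω => momentPoly (evalSum (ρ ω)) 1 t) ⊆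
      KP b ((fun ω => reflect (t - 1) (derivative (T ω))) *
        fun ω => PowerSeries.trunc t (R ω : PowerSeries E)⁻¹) ∪ Consts F Ω := by
    refine KP_subset_of_coeff fun i => ?_
    by_cases hi : i < t
    · refine .inl ⟨i, fun ω => ?_⟩
      have := coeff_momentPoly_eq_mul_inv (ρ ω) (i := i) (by rwa [hρ])
      rwa [hρ] at this
    · exact .inr ⟨0, fun ω => by rw [coeff_momentPoly, if_neg hi]⟩
  have hR0 : Cost (KP b T) (KP b R) 0 := Cost.of_subset_consts hRK le_rfl
  have hI : Cost (KP b T) (KP b fun ω => (PowerSeries.trunc t (R ω : PowerSeries E)⁻¹ : E[X]))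
      (0 + 21 * M (1 * 2 ^ (Nat.clog 2 t + 1)) + 0) :=
    (hR0.comp (h1.mono Set.subset_union_right subset_rfl le_rfl)).comp
      (Cost.of_subset_consts
        (hIK.trans (Set.union_subset_union_left _ Set.subset_union_right)) le_rfl)
  have hG : Cost (KP b T) (KP b fun ω => reflect (t - 1) (derivative (T ω)))
      (t * (1 : ℕ) * 1 + 0) :=
    h2.comp (Cost.of_subset_consts
      (hGK.trans (Set.union_subset_union_left _ Set.subset_union_right)) le_rfl)
  refine ((hG.union hI).comp ((h3.mono Set.subset_union_right subset_rfl le_rfl).comp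
    (Cost.of_subset_consts (k := 0) (h4.trans (Set.union_subset_union_left _
      Set.subset_union_right)) le_rfl))).mono subset_rfl subset_rfl ?_
  have e1 : 2 ^ (Nat.clog 2 t + 1) ≤ 4 * t := by
    rcases Nat.lt_or_ge 1 t with h | h
    · have := Nat.pow_pred_clog_lt_self one_lt_two h
      have hc : 1 ≤ Nat.clog 2 t := Nat.clog_pos one_lt_two h
      rw [show Nat.clog 2 t + 1 = (Nat.clog 2 t).pred + 2 by
        rw [Nat.pred_eq_sub_one]; omega, pow_add]
      omega
    · interval_cases t
      simp
  have e2 := hM.le_sq_mul (Nat.pow_pos two_pos) ht e1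
  have e3 := hM.le_self t ht
  rw [one_mul, one_mul]
  push_cast at e2 ⊢
  nlinarith

end PowerSumsCost

section Element

variable (F : Type*) [Field F] [Finite F] {E : Type*} [Field E] [Algebra F E] (d ℓ J e : ℕ)

/-- The product of the conjugates of `X - v`, if `v` has degree `ℓ ^ J * e`. -/
noncomputable def conjProd (v : E) : E[X] := frProd F 1 e (chainNorm F d ℓ J (X - C v))

/-- The product of the conjugates of `X - v` other than `X - v` itself. -/
noncomputable def conjCof (v : E) : E[X] :=
  frCof F 1 e (chainNorm F d ℓ J (X - C v)) * chainCof F d ℓ J (X - C v)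

/-- The numerator over `conjProd` of the sum of the conjugates of the fraction `c / (X - v)`. -/
noncomputable def conjTrace (v c : E) : E[X] :=
  frTrace F 1 e (chainTrace F d ℓ J (X - C v) (C c) * frCof F 1 e (chainNorm F d ℓ J (X - C v)))

variable {F d ℓ J e}

theorem fr_X_sub_C {k : ℕ} {v : E} (hv : Fr F k v = v) : fr F k (X - C v) = X - C v := by
  rw [map_sub, fr_X, fr_C, hv]

theorem conjProd_eq_mul (hl : 1 ≤ ℓ) (he : 1 ≤ e) (v : E) :
    conjProd F d ℓ J e v = conjCof F d ℓ J e v * (X - C v) := by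
  rw [conjProd, frProd_eq_mul_frCof he, conjCof]
  conv_lhs => enter [1]; rw [chainNorm_eq_mul hl]
  ring

theorem conjProd_monic (v : E) : (conjProd F d ℓ J e v).Monic :=
  frProd_monic (chainNorm_monic J (monic_X_sub_C v))

theorem natDegree_conjProd (v : E) : (conjProd F d ℓ J e v).natDegree = ℓ ^ J * e := by
  rw [conjProd, natDegree_frProd (chainNorm_monic J (monic_X_sub_C v)),
    natDegree_chainNorm J (monic_X_sub_C v), natDegree_X_sub_C, mul_one, mul_comm]

section Fixed

variable [FiniteDimensional F E] (hl : 1 ≤ ℓ) {v : E} (hg : d.gcd (ℓ ^ J * e) = e)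
  (ht : (minpoly F v).natDegree = ℓ ^ J * e)

include hg in
theorem dvd_of_gcd_eq : e ∣ d := by
  rw [← hg]
  exact Nat.gcd_dvd_left _ _

include hg ht

theorem Fr_level : Fr F (d * ℓ ^ J) v = v := by
  rw [Fr_eq_self_iff, ht, mul_comm]
  exact Nat.mul_dvd_mul_right (dvd_of_gcd_eq hg) _

omit hg in
theorem Fr_degree : Fr F (ℓ ^ J * e) v = v := by
  rw [← ht]
  exact Fr_natDegree_minpoly v

include hl

theorem fr_chainNorm_X_sub_C (k : ℕ) :
    fr F k (chainNorm F d ℓ J (X - C v)) = chainNorm F d ℓ J (X - C v) ↔ e ∣ k := by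
  have h1 := fr_chainNorm hl J (fr_X_sub_C (Fr_level hg ht))
  have h2 := fr_chainNorm_of_fr (d := d) (ℓ := ℓ) J (fr_X_sub_C (Fr_degree ht))
  have h3 := fr_gcd h1 h2
  rw [hg] at h3
  refine ⟨fun h => ?_, fun h => fr_of_dvd F h3 h⟩
  have he0 : 0 < e := by
    have := minpoly.natDegree_pos (Algebra.IsIntegral.isIntegral (R := F) v)
    rw [ht] at this
    exact Nat.pos_of_mul_pos_left this
  have hk := fr_gcd h3 h
  have hk0 : 0 < e.gcd k := Nat.gcd_pos_of_pos_left _ he0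
  have hle := natDegree_minpoly_le (F := F) (v := v) (m := ℓ ^ J) (k := e.gcd k)
    (f := frProd F 1 (e.gcd k) (chainNorm F d ℓ J (X - C v))) (fr_frProd hk0 (by rwa [one_mul]))
    (frProd_monic (chainNorm_monic J (monic_X_sub_C v))) (by
      rw [frProd_eq_mul_frCof hk0, eval_mul, eval_chainNorm hl J (by simp), zero_mul]) (by
      rw [natDegree_frProd (chainNorm_monic J (monic_X_sub_C v)),
        natDegree_chainNorm J (monic_X_sub_C v), natDegree_X_sub_C, mul_one, mul_comm])
  rw [ht] at hle
  have := Nat.le_of_mul_le_mul_left hle (Nat.pow_pos hl)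
  rw [← Nat.dvd_antisymm (Nat.gcd_dvd_left e k) (by
    rw [Nat.le_antisymm (Nat.gcd_le_left k he0) this])]
  exact Nat.gcd_dvd_right e k

omit hg hl [Finite F] in
theorem one_le_of_natDegree : 1 ≤ e := by
  have := minpoly.natDegree_pos (Algebra.IsIntegral.isIntegral (R := F) v)
  rw [ht] at this
  exact Nat.pos_of_mul_pos_left this

theorem conjProd_eq_minpoly : conjProd F d ℓ J e v = (minpoly F v).map (algebraMap F E) := by
  have he := one_le_of_natDegree ht
  obtain ⟨g, hgm⟩ := exists_map_of_fr_one (F := F) (f := conjProd F d ℓ J e v)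
    (fr_frProd he (by rw [one_mul]; exact (fr_chainNorm_X_sub_C hl hg ht e).2 dvd_rfl))
  have hmon := conjProd_monic (F := F) (d := d) (ℓ := ℓ) (J := J) (e := e) v
  have hdeg := natDegree_conjProd (F := F) (d := d) (ℓ := ℓ) (J := J) (e := e) v
  have hroot : (conjProd F d ℓ J e v).eval v = 0 := by
    rw [conjProd_eq_mul hl he]; simp
  rw [← hgm] at hmon hdeg hroot ⊢
  rw [natDegree_map] at hdeg
  rw [eval_map_algebraMap] at hroot
  have hgmon : g.Monic := monic_of_injective (algebraMap F E).injective hmon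
  rw [eq_of_monic_of_dvd_of_natDegree_le (minpoly.monic (Algebra.IsIntegral.isIntegral v)) hgmon
    (minpoly.dvd F v hroot) (by rw [hdeg, ht])]

omit hg ht hl [FiniteDimensional F E] in
theorem fr_conjCof {k : ℕ} (hk : Fr F k v = v) :
    fr F k (conjCof F d ℓ J e v) = conjCof F d ℓ J e v := by
  rw [conjCof, map_mul, fr_frCof_of_fr (fr_chainNorm_of_fr J (fr_X_sub_C hk)),
    fr_chainCof_of_fr J (fr_X_sub_C hk)]

theorem fr_chainTrace_gcd {c : E} (hc : Fr F (ℓ ^ J * e) c = c) :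
    fr F d (chainTrace F d ℓ J (X - C v) (C c)) = chainTrace F d ℓ J (X - C v) (C c) ∧
    fr F e (chainTrace F d ℓ J (X - C v) (C c)) = chainTrace F d ℓ J (X - C v) (C c) := by
  have h1 := fr_chainTrace (c := C c) hl J (fr_X_sub_C (Fr_level hg ht)) (by
    rw [fr_C, Fr_of_dvd F hc]
    rw [mul_comm]
    exact Nat.mul_dvd_mul_right (dvd_of_gcd_eq hg) _)
  have h2 := fr_chainTrace_of_fr (d := d) (ℓ := ℓ) (c := C c) J (fr_X_sub_C (Fr_degree ht))
    (by rw [fr_C, hc])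
  have h3 := fr_gcd h1 h2
  rw [hg] at h3
  exact ⟨h1, h3⟩

theorem fr_conjTrace {c : E} (hc : Fr F (ℓ ^ J * e) c = c) :
    fr F 1 (conjTrace F d ℓ J e v c) = conjTrace F d ℓ J e v c := by
  rw [conjTrace]
  refine fr_frTrace (one_le_of_natDegree ht) ?_
  rw [one_mul, map_mul, (fr_chainTrace_gcd hl hg ht hc).2,
    fr_frCof_of_fr ((fr_chainNorm_X_sub_C hl hg ht e).2 dvd_rfl)]

omit hg in
theorem natDegree_conjTrace_lt (c : E) : (conjTrace F d ℓ J e v c).natDegree < ℓ ^ J * e := by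
  rw [conjTrace]
  refine natDegree_frTrace_lt ?_
  rw [mul_comm (ℓ ^ J)]
  refine natDegree_mul_frCof_lt (one_le_of_natDegree ht) ?_ ?_
  · rw [natDegree_chainNorm J (monic_X_sub_C v), natDegree_X_sub_C, mul_one]
  · have := natDegree_chainTrace_lt (F := F) (d := d) hl J (m := 1) (f := X - C v) (c := C c)
      (by simp) (by simp)
    rwa [mul_one] at this

theorem eval_conjTrace (c : E) :
    (conjTrace F d ℓ J e v c).eval v = c * (conjCof F d ℓ J e v).eval v := by
  rw [conjTrace, eval_frTrace_mul_frCof (one_le_of_natDegree ht) (by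
    rw [one_mul]; exact (fr_chainNorm_X_sub_C hl hg ht e).2 dvd_rfl)
    (eval_chainNorm hl J (by simp)), eval_chainTrace hl J (fr_X_sub_C (Fr_level hg ht)) (by simp),
    conjCof, eval_mul, eval_C]
  ring

end Fixed

end Element

namespace KummerField

variable {F : Type u} {E : Type*} [Field F] [Finite F] [Field E] [Algebra F E] {ℓ d h : ℕ}
  (K : KummerField F E ℓ d h) {Ω : Type v} {M : ℕ → ℝ} {J e : ℕ} {v : Ω → E}

include K

theorem level_bound (hM : IsMultiplicationTime F M) (he : 1 ≤ e) {k m : ℕ} (hm : 1 ≤ m)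
    (hk : m ≤ k * ℓ) : M (d * ℓ ^ J * m) ≤ (k : ℝ) ^ 2 * M (ℓ ^ 2 * (ℓ ^ J * e)) := by
  have hl := K.prime.pos
  have hlJ : 0 < ℓ ^ J := Nat.pow_pos hl
  refine hM.le_sq_mul (Nat.mul_pos (Nat.mul_pos K.d_pos hlJ) hm)
    (Nat.mul_pos (Nat.pow_pos hl) (Nat.mul_pos hlJ he)) ?_
  calc d * ℓ ^ J * m ≤ ℓ * ℓ ^ J * (k * ℓ) := Nat.mul_le_mul (Nat.mul_le_mul_right _ K.le) hk
    _ = k * (ℓ ^ 2 * ℓ ^ J) := by ring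
    _ ≤ k * (ℓ ^ 2 * (ℓ ^ J * e)) := by
      refine Nat.mul_le_mul_left _ (Nat.mul_le_mul_left _ ?_)
      exact Nat.le_mul_of_pos_right _ he

theorem cost_X_sub_C (hM : IsMultiplicationTime F M) (hJ : J ≤ h)
    (hv : ∀ ω, Fr F (d * ℓ ^ J) (v ω) = v ω) :
    Cost (KE K.basis v) (KP K.basis fun ω => X - C (v ω)) (2 * (d * ℓ ^ J)) := by
  have hs : SmallPoly F (d * ℓ ^ J) 2 fun ω => X - C (v ω) := fun ω =>
    ⟨fr_X_sub_C (hv ω), by simp⟩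
  refine ((K.frobLevel (Ω := Ω) hM hJ).coordwise hs (a := 1) (S := KE K.basis v)
    fun i j => ?_).mono subset_rfl subset_rfl (by push_cast; linarith)
  rcases i with _ | i
  · refine (Cost.const_mul (-1) (Set.mem_range_self j)).mono subset_rfl ?_ le_rfl
    rintro _ rfl
    funext ω
    simp
  · refine Cost.of_subset_consts ?_ zero_le_one
    rintro _ rfl
    refine .inr ⟨K.basis.repr (coeff X (i + 1)) j, funext fun ω => ?_⟩
    simp

variable (J e v) in
/-- The norms of `X - v` and their cofactors. -/
def conjSet : Set (Ω → F) :=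
  K.chainSet J (fun ω => X - C (v ω)) ∪
    (KP K.basis (fun ω => frCof F 1 e (chainNorm F d ℓ J (X - C (v ω)))) ∪
      KP K.basis (fun ω => conjProd F d ℓ J e (v ω)))

omit K in
theorem small_X_sub_C (hv : ∀ ω, Fr F (d * ℓ ^ J) (v ω) = v ω) :
    SmallPoly F (d * ℓ ^ J) (1 + 1) fun ω => X - C (v ω) := fun ω =>
  ⟨fr_X_sub_C (hv ω), by simp⟩

theorem small_chainNorm (hv : ∀ ω, Fr F (d * ℓ ^ J) (v ω) = v ω) :
    SmallPoly F d (ℓ ^ J + 1) fun ω => chainNorm F d ℓ J (X - C (v ω)) := fun ω =>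
  ⟨fr_chainNorm K.prime.pos J (fr_X_sub_C (hv ω)), by
    rw [natDegree_chainNorm J (monic_X_sub_C _), natDegree_X_sub_C, mul_one]; omega⟩

theorem cost_chainSet_X_sub_C (hM : IsMultiplicationTime F M) (hJ : J ≤ h) (he : 1 ≤ e)
    (hv : ∀ ω, Fr F (d * ℓ ^ J) (v ω) = v ω) :
    Cost (KE K.basis v) (K.chainSet J fun ω => X - C (v ω))
      ((242 * (J + 1)) * (Nat.clog 2 ℓ * M (ℓ ^ 2 * (ℓ ^ J * e)))) := by
  have h1 := K.cost_X_sub_C hM hJ hv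
  have h2 := K.cost_chainSet hM J hJ le_rfl (small_X_sub_C hv)
  refine (h1.comp (h2.mono Set.subset_union_right subset_rfl le_rfl)).mono subset_rfl subset_rfl ?_
  have b1 := K.level_bound hM (J := J) he (k := 1) (m := ℓ * 1) (Nat.mul_pos K.prime.pos one_pos)
    (by omega)
  have b2 := K.level_bound hM (J := J) he (k := 1) (m := 1) le_rfl (by have := K.prime.pos; omega)
  have b3 := hM.le_self (d * ℓ ^ J * 1)
    (Nat.mul_pos (Nat.mul_pos K.d_pos (K.zero_lt_pow J)) one_pos)
  have b4 := K.one_le_clog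
  have hJ0 : (0 : ℝ) ≤ J := Nat.cast_nonneg J
  set B := M (ℓ ^ 2 * (ℓ ^ J * e))
  have hB : 0 ≤ B := by
    refine le_trans ?_ (b3.trans (b2.trans (by simp)))
    positivity
  have b5 : (1 : ℝ) * B ≤ Nat.clog 2 ℓ * B := mul_le_mul_of_nonneg_right b4 hB
  have b6 : (J : ℝ) * (240 * Nat.clog 2 ℓ * M (d * ℓ ^ J * (ℓ * 1))) ≤
      J * (240 * Nat.clog 2 ℓ * B) := by
    refine mul_le_mul_of_nonneg_left (mul_le_mul_of_nonneg_left (by simpa using b1) ?_) hJ0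
    linarith
  push_cast at b2 b3
  nlinarith [mul_nonneg hJ0 (hB.trans (by linarith : B ≤ Nat.clog 2 ℓ * B))]

theorem cost_conjSet (hM : IsMultiplicationTime F M) (hJ : J ≤ h) (he : 1 ≤ e) (hed : e ≤ d)
    (hv : ∀ ω, Fr F (d * ℓ ^ J) (v ω) = v ω) :
    Cost (KE K.basis v) (K.conjSet J e v)
      ((452 * (J + 1)) * (Nat.clog 2 ℓ * M (ℓ ^ 2 * (ℓ ^ J * e)))) := by
  have h1 := K.cost_chainSet_X_sub_C hM hJ he hv
  have h2 := K.cost_base hM he hed (K.zero_lt_pow J) (K.small_chainNorm hv)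
  refine (h1.trans (h2.mono ?_ subset_rfl le_rfl)).mono subset_rfl subset_rfl ?_
  · exact (K.KP_chainNorm_subset J _).trans Set.subset_union_right
  · have hJ0 : (0 : ℝ) ≤ J := Nat.cast_nonneg J
    have hB : 0 ≤ Nat.clog 2 ℓ * M (ℓ ^ 2 * (ℓ ^ J * e)) := mul_nonneg (Nat.cast_nonneg _)
      (hM.pos (Nat.mul_pos (K.zero_lt_pow 2) (Nat.mul_pos (K.zero_lt_pow J) he))).le
    rw [mul_comm e]
    nlinarith [mul_nonneg hJ0 hB]

section Up

variable (hg : d.gcd (ℓ ^ J * e) = e) (ht : ∀ ω, (minpoly F (v ω)).natDegree = ℓ ^ J * e)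

include hg ht

/-- The value at `v` of the cofactor, from the moments of the product. -/
theorem cost_conjMoment (hM : IsMultiplicationTime F M) (hJ : J ≤ h) (he : 1 ≤ e)
    {φ : Ω → E[X] →ₗ[E] E} (hφ : ∀ a ω g, fr F a g = g → Fr F a (φ ω g) = φ ω g) {W : Ω → E[X]}
    (hW : ∀ ω, fr F 1 (W ω) = W ω) :
    Cost (K.conjSet J e v ∪ KP K.basis fun ω => momentPoly (φ ω) (W ω) (ℓ ^ J * e))
      (KE K.basis fun ω => φ ω (W ω * conjCof F d ℓ J e (v ω)))
      ((10 * (J + 1)) * M (ℓ ^ 2 * (ℓ ^ J * e))) := by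
  have := K.finiteDimensional
  have hv : ∀ ω, Fr F (d * ℓ ^ J) (v ω) = v ω := fun ω => Fr_level hg (ht ω)
  have h1 := K.cost_baseMoments hM hφ hW he (K.zero_lt_pow J) (K.small_chainNorm hv)
  have hW' : ∀ ω, fr F d (W ω * frCof F 1 e (chainNorm F d ℓ J (X - C (v ω)))) =
      W ω * frCof F 1 e (chainNorm F d ℓ J (X - C (v ω))) := fun ω => by
    rw [map_mul, fr_of_dvd F (hW ω) (one_dvd _), fr_frCof_of_fr (K.small_chainNorm hv ω).1]
  have h2 := K.cost_chainMoments hM hφ hW' J hJ le_rfl (small_X_sub_C hv)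
  rw [mul_one] at h2
  refine ((h1.mono ?_ subset_rfl le_rfl).comp (h2.mono ?_ subset_rfl le_rfl)).mono subset_rfl
    ?_ ?_
  · rw [mul_comm e]
    refine Set.union_subset Set.subset_union_right (Set.Subset.trans ?_ Set.subset_union_left)
    exact Set.subset_union_left.trans Set.subset_union_right
  · exact Set.union_subset_union_left _ (Set.subset_union_left.trans Set.subset_union_left)
  · rintro _ ⟨j, rfl⟩
    refine ⟨(0, j), funext fun ω => ?_⟩
    simp only [coeff_momentPoly, if_pos one_pos, pow_zero, mul_one, conjCof, mul_assoc]
  · have b1 := K.level_bound hM (J := J) he (k := 1) (m := ℓ * 1)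
      (Nat.mul_pos K.prime.pos one_pos) (by omega)
    have hJ0 : (0 : ℝ) ≤ J := Nat.cast_nonneg J
    rw [mul_comm e]
    have := mul_le_mul_of_nonneg_left b1 hJ0
    push_cast at this
    linarith

omit ht in
/-- Inversion in the field generated by `v`. -/
theorem cost_inverse (hM : IsMultiplicationTime F M) (hJ : J ≤ h) (he : 1 ≤ e) {z : Ω → E}
    (hz : ∀ ω, Fr F (ℓ ^ J * e) (z ω) = z ω) (hz0 : ∀ ω, z ω ≠ 0) :
    Cost (KE K.basis z) (KE K.basis fun ω => (z ω)⁻¹)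
      ((500 * (J + 1)) * (Nat.clog 2 ℓ * M (ℓ ^ 2 * (ℓ ^ J * e)))) := by
  have hed := dvd_of_gcd_eq hg
  have hl : 1 ≤ ℓ := K.prime.pos
  have hzd : ∀ ω, Fr F (d * ℓ ^ J) (z ω) = z ω := fun ω => by
    refine Fr_of_dvd F (hz ω) ?_
    rw [mul_comm]
    exact Nat.mul_dvd_mul_right hed _
  have hs : SmallPoly F (d * ℓ ^ J) 1 fun ω => C (z ω) := SmallPoly.const hzd
  have h1 := K.cost_chainSet hM J hJ le_rfl (hs.mono (by omega : 1 ≤ 1 + 1))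
  have hy : ∀ ω, ∃ y : E, chainNorm F d ℓ J (C (z ω)) = C y := fun ω =>
    ⟨_, eq_C_of_natDegree_eq_zero (Nat.le_zero.1 ((natDegree_chainNorm_le J (m := 0)
      (by simp)).trans (by simp)))⟩
  choose y hy using hy
  have hyz : ∀ ω, y ω ≠ 0 := by
    intro ω h0
    have h3 := hy ω
    rw [h0, map_zero] at h3
    have : ∀ (J : ℕ) (f : E[X]), f ≠ 0 → chainNorm F d ℓ J f ≠ 0 := by
      intro J
      induction J with
      | zero => exact fun f hf => hf
      | succ J ih =>
        refine fun f hf => ih _ (Finset.prod_ne_zero_iff.2 fun k _ => ?_)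
        intro h0
        refine hf (Polynomial.ext fun i => ?_)
        have := congrArg (fun p => coeff p i) h0
        simpa using this
    exact this J _ (by simpa using hz0 ω) h3
  have hyd : ∀ ω, Fr F d (y ω) = y ω := fun ω => by
    have := fr_chainNorm hl J (hs ω).1
    rw [hy, fr_C] at this
    exact C_injective this
  have hye : ∀ ω, Fr F e (y ω) = y ω := fun ω => by
    have h3 := fr_chainNorm_of_fr (F := F) (d := d) (ℓ := ℓ) J (f := C (z ω)) (t := ℓ ^ J * e)
      (by rw [fr_C, hz])
    rw [hy, fr_C] at h3
    have := Fr_gcd F (hyd ω) (C_injective h3)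
    rwa [hg] at this
  have h2 := K.cost_base hM he (Nat.le_of_dvd K.d_pos hed) le_rfl
    ((SmallPoly.const hyd).mono (by omega : 1 ≤ 1 + 1))
  have h3 := K.cost_baseInverse hM he hyd hye hyz
  obtain ⟨h4, -⟩ := K.cost_chainCof_mul hM
    (SmallPoly.const (F := F) (z := fun ω => (y ω)⁻¹) fun ω => by rw [map_inv₀, hyd]) J hJ hs
  have hfin : (fun ω => C (y ω)⁻¹ * chainCof F d ℓ J (C (z ω))) = fun ω => C (z ω)⁻¹ := by
    funext ω
    have h5 := chainNorm_eq_mul (F := F) (d := d) hl J (C (z ω))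
    rw [hy] at h5
    have h6 : (C (z ω)⁻¹ : E[X]) * C (z ω) = 1 := by rw [← C_mul, inv_mul_cancel₀ (hz0 ω), C_1]
    have h7 : (C (y ω)⁻¹ : E[X]) * C (y ω) = 1 := by rw [← C_mul, inv_mul_cancel₀ (hyz ω), C_1]
    calc C (y ω)⁻¹ * chainCof F d ℓ J (C (z ω))
        = C (z ω)⁻¹ * (C (y ω)⁻¹ * (C (z ω) * chainCof F d ℓ J (C (z ω)))) := by
          rw [mul_left_comm (C (y ω)⁻¹), ← mul_assoc (C (z ω)⁻¹), h6, one_mul]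
      _ = C (z ω)⁻¹ := by rw [← h5, h7, mul_one]
  rw [hfin] at h4
  have hyK : KP K.basis (fun ω => C (y ω)) ⊆ K.chainSet J fun ω => C (z ω) := by
    have := K.KP_chainNorm_subset J fun ω => C (z ω)
    simpa only [hy] using this
  have h0 : Cost (KE K.basis z) (KP K.basis fun ω => C (z ω)) 0 :=
    Cost.of_subset_consts (KP_C z) le_rfl
  have h01 := h0.comp (h1.mono Set.subset_union_right subset_rfl le_rfl)
  have h23 := h2.comp (h3.mono Set.subset_union_right subset_rfl le_rfl)
  have h234 := (h23.mono hyK subset_rfl le_rfl).comp h4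
  refine (h01.comp (h234.mono Set.subset_union_right subset_rfl le_rfl)).mono subset_rfl
    (KE_subset_KP_C _) ?_
  have b1 := K.level_bound hM (J := J) he (k := 1) (m := ℓ * 1) (Nat.mul_pos K.prime.pos one_pos)
    (by omega)
  have b2 := K.level_bound hM (J := J) he (k := 1) (m := 1) le_rfl (by omega)
  have hlJ := K.zero_lt_pow J
  have b3 : M (ℓ ^ 2 * e) ≤ M (ℓ ^ 2 * (ℓ ^ J * e)) :=
    hM.mono (Nat.mul_pos (K.zero_lt_pow 2) he)
      (Nat.mul_le_mul_left _ (Nat.le_mul_of_pos_left _ hlJ))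
  have b4 := K.one_le_clog
  have hJ0 : (0 : ℝ) ≤ J := Nat.cast_nonneg J
  simp only [mul_one, Nat.cast_one, one_pow, one_mul] at *
  set B := M (ℓ ^ 2 * (ℓ ^ J * e))
  have hB : 0 ≤ B := (hM.pos (Nat.mul_pos (K.zero_lt_pow 2) (Nat.mul_pos hlJ he))).le
  have b5 : B ≤ Nat.clog 2 ℓ * B := by
    simpa using mul_le_mul_of_nonneg_right b4 hB
  have b6 : (J : ℝ) * (240 * Nat.clog 2 ℓ * M (d * ℓ ^ J * ℓ)) ≤
      J * (240 * Nat.clog 2 ℓ * B) :=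
    mul_le_mul_of_nonneg_left (mul_le_mul_of_nonneg_left b1 (by linarith)) hJ0
  have b7 : (210 * Nat.clog 2 ℓ * M (ℓ ^ 2 * e)) ≤ 210 * Nat.clog 2 ℓ * B :=
    mul_le_mul_of_nonneg_left b3 (by linarith)
  have b8 : (J : ℝ) * (10 * M (d * ℓ ^ J)) ≤ J * (10 * (Nat.clog 2 ℓ * B)) :=
    mul_le_mul_of_nonneg_left (by linarith) hJ0
  have b9 := mul_nonneg hJ0 (hB.trans b5)
  nlinarith

/-- The numerator of the trace of `c / (X - v)`. -/
theorem cost_conjTrace (hM : IsMultiplicationTime F M) (hJ : J ≤ h) (he : 1 ≤ e) {c : Ω → E}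
    (hc : ∀ ω, Fr F (ℓ ^ J * e) (c ω) = c ω) :
    Cost (K.conjSet J e v ∪ KE K.basis c) (KP K.basis fun ω => conjTrace F d ℓ J e (v ω) (c ω))
      ((12 * (J + 1)) * M (ℓ ^ 2 * (ℓ ^ J * e))) := by
  have := K.finiteDimensional
  have hl : 1 ≤ ℓ := K.prime.pos
  have hv : ∀ ω, Fr F (d * ℓ ^ J) (v ω) = v ω := fun ω => Fr_level hg (ht ω)
  have hcs : SmallPoly F (d * ℓ ^ J) 1 fun ω => C (c ω) := SmallPoly.const fun ω => by
    refine Fr_of_dvd F (hc ω) ?_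
    rw [mul_comm]
    exact Nat.mul_dvd_mul_right (dvd_of_gcd_eq hg) _
  have h1 := K.cost_chainTrace hM J hJ le_rfl (small_X_sub_C hv) hcs
  have hfr := fun ω => fr_chainTrace_gcd hl hg (ht ω) (hc ω)
  have h2 := K.cost_baseTrace hM he (K.zero_lt_pow J) (K.small_chainNorm hv)
    (fun ω => (fr_chainNorm_X_sub_C hl hg (ht ω) e).2 dvd_rfl)
    (c := fun ω => chainTrace F d ℓ J (X - C (v ω)) (C (c ω)))
    (fun ω => ⟨(hfr ω).1, by
      have := natDegree_chainTrace_lt (F := F) (d := d) hl J (m := 1) (f := X - C (v ω))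
        (c := C (c ω)) (by simp) (by simp)
      rwa [mul_one] at this⟩) fun ω => (hfr ω).2
  refine (Cost.add_consts ((h1.mono ?_ subset_rfl le_rfl).comp
    (h2.mono ?_ subset_rfl le_rfl))).mono subset_rfl subset_rfl ?_
  · refine Set.union_subset ?_ ((KP_C c).trans (Set.union_subset_union_left _
      Set.subset_union_right))
    exact Set.subset_union_left.trans (Set.subset_union_left.trans Set.subset_union_left)
  · refine Set.union_subset Set.subset_union_right (Set.Subset.trans ?_ Set.subset_union_left)
    exact Set.subset_union_left.trans (Set.subset_union_right.trans
      (Set.subset_union_left.trans Set.subset_union_left))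
  · have b1 := K.level_bound hM (J := J) he (k := 1) (m := ℓ * 1)
      (Nat.mul_pos K.prime.pos one_pos) (by omega)
    have hJ0 : (0 : ℝ) ≤ J := Nat.cast_nonneg J
    rw [mul_comm e]
    have := mul_le_mul_of_nonneg_left b1 hJ0
    have hB := mul_nonneg hJ0
      (hM.pos (Nat.mul_pos (K.zero_lt_pow 2) (Nat.mul_pos (K.zero_lt_pow J) he))).le
    push_cast at this
    linarith

end Up

end KummerField

section RootSet

variable {E : Type*} [Field E]

theorem evalSum_eq_eval {ρ : Finset E} {G : E[X]} {v : E}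
    (h : G * (X - C v) = ∏ r ∈ ρ, (X - C r)) :
    evalSum ρ G = G.eval v ∧ G.eval v ≠ 0 := by
  classical
  have hv : v ∈ ρ := by
    have h1 := congrArg (eval v) h
    rw [eval_mul, eval_sub, eval_X, eval_C, sub_self, mul_zero, eval_prod, eq_comm,
      Finset.prod_eq_zero_iff] at h1
    obtain ⟨r, hr, h1⟩ := h1
    rw [eval_sub, eval_X, eval_C, sub_eq_zero] at h1
    rwa [h1]
  have hG : G = ∏ r ∈ ρ.erase v, (X - C r) := by
    rw [← Finset.prod_erase_mul _ _ hv] at h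
    exact mul_right_cancel₀ (X_sub_C_ne_zero v) h
  constructor
  · rw [evalSum_apply, Finset.sum_eq_single_of_mem v hv]
    intro r hr hrv
    rw [hG, eval_prod]
    exact Finset.prod_eq_zero (Finset.mem_erase.2 ⟨hrv, hr⟩) (by simp)
  · rw [hG, eval_prod, Finset.prod_ne_zero_iff]
    intro r hr
    rw [eval_sub, eval_X, eval_C, sub_ne_zero]
    exact (Finset.mem_erase.1 hr).1.symm

theorem exists_rootSet (F : Type*) [Field F] [Finite F] [Algebra F E] [FiniteDimensional F E]
    {ι : Type*} [Fintype ι] {v : ι → E} (hv : ∀ i j, i ≠ j → minpoly F (v i) ≠ minpoly F (v j)) :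
    ∃ ρ : Finset E, ∏ r ∈ ρ, (X - C r) = ∏ i, (minpoly F (v i)).map (algebraMap F E) := by
  classical
  have := Module.finite_of_finite F (M := E)
  have hint : ∀ i, IsIntegral F (v i) := fun i => Algebra.IsIntegral.isIntegral _
  have hsep : (∏ i, minpoly F (v i)).Separable := by
    refine separable_prod (fun i j hij => ?_) fun i =>
      PerfectField.separable_of_irreducible (minpoly.irreducible (hint i))
    refine (minpoly.irreducible (hint i)).coprime_iff_not_dvd.2 fun hd => hv i j hij ?_
    exact eq_of_monic_of_associated (minpoly.monic (hint i)) (minpoly.monic (hint j))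
      ((minpoly.irreducible (hint i)).associated_of_dvd (minpoly.irreducible (hint j)) hd)
  set T := ∏ i, (minpoly F (v i)).map (algebraMap F E) with hT
  have hTm : T = (∏ i, minpoly F (v i)).map (algebraMap F E) := (Polynomial.map_prod _ _ _).symm
  have hspl : T.Splits := Splits.prod fun i _ => IsGalois.splits F (v i)
  have hmon : T.Monic := monic_prod_of_monic _ _ fun i _ => (minpoly.monic (hint i)).map _
  have hnd : T.roots.Nodup := nodup_roots (by rw [hTm]; exact hsep.map)
  refine ⟨T.roots.toFinset, ?_⟩
  conv_rhs => rw [hspl.eq_prod_roots_of_monic hmon]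
  rw [Finset.prod_eq_multiset_prod, Multiset.toFinset_val, hnd.dedup]

end RootSet

section Interpolation

variable (F : Type*) [Field F] [Finite F] {E : Type*} [Field E] [Algebra F E] (d ℓ : ℕ) {s : ℕ}
  (J e : Fin s → ℕ) (v w : Fin s → E)

/-- The product of the conjugates of all `X - v i`. -/
noncomputable def interpProd : E[X] := ∏ i, conjProd F d ℓ (J i) (e i) (v i)

/-- The product of the conjugates of all `X - v j` with `j ≠ i`. -/
noncomputable def otherProd (i : Fin s) : E[X] :=
  ∏ j ∈ Finset.univ.erase i, conjProd F d ℓ (J j) (e j) (v j)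

/-- The value at `v i` of the derivative of `interpProd`. -/
noncomputable def interpWeight (i : Fin s) : E :=
  (otherProd F d ℓ J e v i * conjCof F d ℓ (J i) (e i) (v i)).eval (v i)

/-- The numerator of the trace of `w i * (interpWeight i)⁻¹ / (X - v i)`. -/
noncomputable def interpNum (i : Fin s) : E[X] :=
  conjTrace F d ℓ (J i) (e i) (v i) (w i * (interpWeight F d ℓ J e v i)⁻¹)

/-- The interpolation polynomial. -/
noncomputable def interpPoly : E[X] :=
  ∑ i, interpNum F d ℓ J e v w i * otherProd F d ℓ J e v i

theorem otherProd_mul (i : Fin s) :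
    otherProd F d ℓ J e v i * conjProd F d ℓ (J i) (e i) (v i) = interpProd F d ℓ J e v :=
  Finset.prod_erase_mul _ _ (Finset.mem_univ i)

theorem natDegree_interpProd : (interpProd F d ℓ J e v).natDegree = ∑ i, ℓ ^ J i * e i := by
  rw [interpProd, natDegree_prod_of_monic _ _ fun i _ => conjProd_monic _]
  exact Finset.sum_congr rfl fun i _ => natDegree_conjProd _

variable {F d ℓ J e v w} [FiniteDimensional F E] (hl : 1 ≤ ℓ)
  (hg : ∀ i, d.gcd (ℓ ^ J i * e i) = e i)
  (ht : ∀ i, (minpoly F (v i)).natDegree = ℓ ^ J i * e i)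
  (hv : ∀ i j, i ≠ j → minpoly F (v i) ≠ minpoly F (v j))
  (hw : ∀ i, w i ∈ Algebra.adjoin F {v i})

omit [FiniteDimensional F E] in
theorem Fr_of_mem_adjoin {k : ℕ} {x y : E} (hx : Fr F k x = x) (hy : y ∈ Algebra.adjoin F {x}) :
    Fr F k y = y := by
  refine Algebra.adjoin_induction (p := fun y _ => Fr F k y = y) ?_ ?_ ?_ ?_ hy
  · rintro _ rfl
    exact hx
  · intro r
    simp
  · intro a c _ _ ha hc
    rw [map_add, ha, hc]
  · intro a c _ _ ha hc
    rw [map_mul, ha, hc]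

include hl hg ht

theorem fr_one_conjProd (i : Fin s) :
    fr F 1 (conjProd F d ℓ (J i) (e i) (v i)) = conjProd F d ℓ (J i) (e i) (v i) := by
  rw [conjProd_eq_minpoly hl (hg i) (ht i), fr_map]

theorem fr_otherProd (k : ℕ) (i : Fin s) :
    fr F k (otherProd F d ℓ J e v i) = otherProd F d ℓ J e v i := by
  rw [otherProd, map_prod]
  exact Finset.prod_congr rfl fun j _ =>
    fr_of_dvd F (fr_one_conjProd hl hg ht j) (one_dvd _)

theorem fr_interpProd : fr F 1 (interpProd F d ℓ J e v) = interpProd F d ℓ J e v := by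
  rw [interpProd, map_prod]
  exact Finset.prod_congr rfl fun j _ => fr_one_conjProd hl hg ht j

theorem interpProd_eq : interpProd F d ℓ J e v =
    ∏ i, (minpoly F (v i)).map (algebraMap F E) :=
  Finset.prod_congr rfl fun i _ => conjProd_eq_minpoly hl (hg i) (ht i)

omit hg in
theorem interpProd_eq_mul (i : Fin s) :
    otherProd F d ℓ J e v i * conjCof F d ℓ (J i) (e i) (v i) * (X - C (v i)) =
      interpProd F d ℓ J e v := by
  rw [mul_assoc, ← conjProd_eq_mul hl (one_le_of_natDegree (ht i)), otherProd_mul]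

theorem Fr_interpWeight (i : Fin s) : Fr F (ℓ ^ J i * e i) (interpWeight F d ℓ J e v i) =
    interpWeight F d ℓ J e v i := by
  rw [interpWeight]
  conv_lhs => rw [← eval_fr, map_mul, fr_otherProd hl hg ht, fr_conjCof (Fr_degree (ht i)),
    Fr_degree (ht i)]

omit hl hg ht [FiniteDimensional F E] in
theorem natDegree_otherProd (i : Fin s) :
    (otherProd F d ℓ J e v i).natDegree + ℓ ^ J i * e i = ∑ j, ℓ ^ J j * e j := by
  rw [otherProd, natDegree_prod_of_monic _ _ fun i _ => conjProd_monic _,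
    Finset.sum_congr rfl fun j _ => natDegree_conjProd (F := F) (d := d) (v j),
    Finset.sum_erase_add _ _ (Finset.mem_univ i)]

omit hg in
theorem degree_interpPoly_lt :
    (interpPoly F d ℓ J e v w).degree < ((∑ i, ℓ ^ J i * e i : ℕ) : WithBot ℕ) := by
  refine (degree_sum_le _ _).trans_lt ((Finset.sup_lt_iff (WithBot.bot_lt_coe _)).2 fun i _ => ?_)
  have h1 := natDegree_conjTrace_lt (d := d) hl (ht i)
    (w i * (interpWeight F d ℓ J e v i)⁻¹)
  have h2 := natDegree_otherProd (F := F) (d := d) (ℓ := ℓ) (J := J) (e := e) (v := v) i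
  refine degree_le_natDegree.trans_lt (Nat.cast_lt.2 ?_)
  refine natDegree_mul_le.trans_lt ?_
  rw [interpNum]
  omega

include hv

theorem interpWeight_ne_zero (i : Fin s) : interpWeight F d ℓ J e v i ≠ 0 := by
  obtain ⟨ρ, hρ⟩ := exists_rootSet F hv
  exact (evalSum_eq_eval (ρ := ρ) (by rw [interpProd_eq_mul hl ht, hρ, interpProd_eq hl hg ht])).2

include hw

omit hv in
theorem Fr_interpCoeff (i : Fin s) :
    Fr F (ℓ ^ J i * e i) (w i * (interpWeight F d ℓ J e v i)⁻¹) =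
      w i * (interpWeight F d ℓ J e v i)⁻¹ := by
  rw [map_mul, map_inv₀, Fr_interpWeight hl hg ht, Fr_of_mem_adjoin (Fr_degree (ht i)) (hw i)]

omit hv in
theorem fr_interpNum (i : Fin s) :
    fr F 1 (interpNum F d ℓ J e v w i) = interpNum F d ℓ J e v w i :=
  fr_conjTrace hl (hg i) (ht i) (Fr_interpCoeff hl hg ht hw i)

omit hv in
theorem fr_interpPoly : fr F 1 (interpPoly F d ℓ J e v w) = interpPoly F d ℓ J e v w := by
  rw [interpPoly, map_sum]
  exact Finset.sum_congr rfl fun i _ => by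
    rw [map_mul, fr_interpNum hl hg ht hw, fr_otherProd hl hg ht]

omit hw in
theorem eval_interpPoly (i : Fin s) : (interpPoly F d ℓ J e v w).eval (v i) = w i := by
  have h0 := interpWeight_ne_zero hl hg ht hv i
  have he := one_le_of_natDegree (ht i)
  rw [interpPoly, eval_finsetSum, Finset.sum_eq_single_of_mem i (Finset.mem_univ i)]
  · rw [interpNum, eval_mul, eval_conjTrace hl (hg i) (ht i), mul_assoc,
      mul_comm (eval _ (conjCof _ _ _ _ _ _)), ← eval_mul, ← interpWeight, mul_assoc,
      inv_mul_cancel₀ h0, mul_one]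
  · intro j _ hj
    rw [eval_mul, otherProd, eval_prod,
      Finset.prod_eq_zero (Finset.mem_erase.2 ⟨hj.symm, Finset.mem_univ i⟩), mul_zero]
    rw [conjProd_eq_mul hl he]
    simp

end Interpolation

namespace KummerField

variable {F : Type u} {E : Type*} [Field F] [Finite F] [Field E] [Algebra F E] {ℓ d h : ℕ}
  (K : KummerField F E ℓ d h) {Ω : Type v} {M : ℕ → ℝ}

/-- The numerator of the trace of `w / (z * (X - v))`, where `z` is the value at `v` of the cofactor
of `X - v`. -/
theorem cost_element (hM : IsMultiplicationTime F M) {J e : ℕ} {v w : Ω → E}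
    (hg : d.gcd (ℓ ^ J * e) = e) (ht : ∀ ω, (minpoly F (v ω)).natDegree = ℓ ^ J * e)
    (hJ : J ≤ h) (he : 1 ≤ e)
    {φ : Ω → E[X] →ₗ[E] E} (hφ : ∀ a ω g, fr F a g = g → Fr F a (φ ω g) = φ ω g) {W : Ω → E[X]}
    (hW : ∀ ω, fr F 1 (W ω) = W ω) {z : Ω → E}
    (hz : ∀ ω, φ ω (W ω * conjCof F d ℓ J e (v ω)) = z ω) (hz0 : ∀ ω, z ω ≠ 0)
    (hzf : ∀ ω, Fr F (ℓ ^ J * e) (z ω) = z ω) (hwf : ∀ ω, Fr F (ℓ ^ J * e) (w ω) = w ω) :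
    Cost (K.conjSet J e v ∪ KP K.basis (fun ω => momentPoly (φ ω) (W ω) (ℓ ^ J * e)) ∪
        KE K.basis w)
      (KP K.basis fun ω => conjTrace F d ℓ J e (v ω) (w ω * (z ω)⁻¹))
      ((532 * (J + 1)) * (Nat.clog 2 ℓ * M (ℓ ^ 2 * (ℓ ^ J * e)))) := by
  have hed := dvd_of_gcd_eq hg
  have hlev : ∀ y : E, Fr F (ℓ ^ J * e) y = y → Fr F (d * ℓ ^ J) y = y := fun y hy => by
    refine Fr_of_dvd F hy ?_
    rw [mul_comm]
    exact Nat.mul_dvd_mul_right hed _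
  have h1 := K.cost_conjMoment hg ht hM hJ he hφ hW
  simp only [hz] at h1
  have h2 := K.cost_inverse hg hM hJ he hzf hz0
  have h3 := (K.frobLevel (Ω := Ω) hM hJ).mul 1 _ _ le_rfl
    (SmallPoly.const fun ω => hlev _ (hwf ω))
    (SmallPoly.const (z := fun ω => (z ω)⁻¹) fun ω => by rw [map_inv₀, hlev _ (hzf ω)])
  have h3' : Cost (KE K.basis w ∪ KE K.basis fun ω => (z ω)⁻¹)
      (KE K.basis fun ω => w ω * (z ω)⁻¹) (10 * M (d * ℓ ^ J * 1)) := by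
    refine Cost.add_consts (h3.mono ?_ ?_ le_rfl)
    · exact Set.union_subset ((KP_C _).trans (Set.union_subset_union_left _ Set.subset_union_left))
        ((KP_C _).trans (Set.union_subset_union_left _ Set.subset_union_right))
    · have := KE_subset_KP_C (b := K.basis) fun ω => w ω * (z ω)⁻¹
      simp only [C_mul] at this
      exact this
  have h4 := K.cost_conjTrace hg ht hM hJ he (c := fun ω => w ω * (z ω)⁻¹) fun ω => by
    rw [map_mul, map_inv₀, hwf, hzf]
  set S := K.conjSet J e v ∪ KP K.basis (fun ω => momentPoly (φ ω) (W ω) (ℓ ^ J * e)) ∪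
    KE K.basis w
  have h12 : Cost S (KE K.basis fun ω => (z ω)⁻¹) _ :=
    (h1.mono Set.subset_union_left subset_rfl le_rfl).comp
      (h2.mono Set.subset_union_right subset_rfl le_rfl)
  have h123 := h12.comp (h3'.mono (Set.union_subset_union_left _ Set.subset_union_right)
    subset_rfl le_rfl)
  refine (h123.comp (h4.mono (Set.union_subset_union_left _
    (Set.subset_union_left.trans Set.subset_union_left)) subset_rfl le_rfl)).mono subset_rfl
    subset_rfl ?_
  have b2 := K.level_bound hM (J := J) he (k := 1) (m := 1) le_rfl (by have := K.prime.pos; omega)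
  have b4 := K.one_le_clog
  have hJ0 : (0 : ℝ) ≤ J := Nat.cast_nonneg J
  simp only [Nat.cast_one, one_pow, one_mul] at b2
  set B := M (ℓ ^ 2 * (ℓ ^ J * e))
  have hB : 0 ≤ B := (hM.pos (Nat.mul_pos (K.zero_lt_pow 2) (Nat.mul_pos (K.zero_lt_pow J) he))).le
  have b5 : B ≤ Nat.clog 2 ℓ * B := by
    simpa using mul_le_mul_of_nonneg_right b4 hB
  have b6 := mul_le_mul_of_nonneg_left b5 (by linarith : (0 : ℝ) ≤ 22 * (J + 1))
  have b7 := mul_nonneg hJ0 (hB.trans b5)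
  nlinarith

end KummerField

/-- The extension by `y` of a finite sequence. -/
def extFin {α : Type*} {s : ℕ} (x : Fin s → α) (y : α) (c : ℕ) : α :=
  if hc : c < s then x ⟨c, hc⟩ else y

section ExtFin

variable {α : Type*} {s : ℕ}

theorem extFin_val (x : Fin s → α) (y : α) (i : Fin s) : extFin x y i = x i := by
  simp [extFin]

theorem extFin_of_le (x : Fin s → α) (y : α) {c : ℕ} (hc : s ≤ c) : extFin x y c = y := by
  simp [extFin, not_lt.2 hc]

@[to_additive]
theorem prod_range_extFin {R : Type*} [CommMonoid R] (f : ℕ → R) {N : ℕ} (hN : s ≤ N)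
    (hf : ∀ c, s ≤ c → f c = 1) : ∏ c ∈ Finset.range N, f c = ∏ i : Fin s, f i := by
  rw [← Finset.prod_range]
  refine (Finset.prod_subset (Finset.range_subset_range.2 hN) fun c _ hc => hf c ?_).symm
  simpa using hc

end ExtFin

namespace KummerField

variable {F : Type u} {E : Type*} [Field F] [Finite F] [Field E] [Algebra F E] {ℓ d h : ℕ}
  (K : KummerField F E ℓ d h) {Ω : Type v} {M : ℕ → ℝ}

/-- The polynomials `interpProd` and `interpPoly` from the elements `v i` and `w i`. -/
theorem cost_interpolation (hM : IsMultiplicationTime F M) {s : ℕ} (hs : 1 ≤ s) {J e : Fin s → ℕ}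
    (hJ : ∀ i, J i ≤ h) (hg : ∀ i, d.gcd (ℓ ^ J i * e i) = e i) {v w : Fin s → Ω → E}
    (ht : ∀ ω i, (minpoly F (v i ω)).natDegree = ℓ ^ J i * e i) (he : ∀ i, 1 ≤ e i)
    (hv : ∀ ω i j, i ≠ j → minpoly F (v i ω) ≠ minpoly F (v j ω))
    (hw : ∀ ω i, w i ω ∈ Algebra.adjoin F {v i ω}) :
    Cost (⋃ i ∈ Finset.univ, (KE K.basis (v i) ∪ KE K.basis (w i)))
      (KP K.basis (fun ω => interpProd F d ℓ J e fun i => v i ω) ∪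
        KP K.basis (fun ω => interpPoly F d ℓ J e (fun i => v i ω) fun i => w i ω))
      (460 * (Nat.clog 2 s + 1) * M (∑ i, ℓ ^ J i * e i) +
        984 * ∑ i, (J i + 1) * (Nat.clog 2 ℓ * M (ℓ ^ 2 * (ℓ ^ J i * e i)))) := by
  classical
  have := K.finiteDimensional
  have hl : 1 ≤ ℓ := K.prime.pos
  have hL := K.frobLevel_one (Ω := Ω) hM
  set τ : Fin s → ℕ := fun i => ℓ ^ J i * e i with hτ
  set t := ∑ i, τ i with ht0
  set k := Nat.clog 2 s with hk
  have hsk : s ≤ 2 ^ k := Nat.le_pow_clog one_lt_two s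
  have hτ1 : ∀ i, 1 ≤ τ i := fun i => Nat.mul_pos (K.zero_lt_pow _) (he i)
  have hst : s ≤ t := by
    have := Finset.sum_le_sum fun i (_ : i ∈ Finset.univ) => hτ1 i
    simpa using this
  set f : ℕ → Ω → E[X] :=
    extFin (fun i ω => conjProd F d ℓ (J i) (e i) (v i ω)) fun _ => 1 with hf
  set g : ℕ → Ω → E[X] := extFin (fun i ω => interpNum F d ℓ J e (fun i => v i ω)
    (fun i => w i ω) i) fun _ => 0 with hgdef
  set n : ℕ → ℕ := extFin (fun i => τ i + 1) 1 with hn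
  have hcases : ∀ c, (∃ i : Fin s, (i : ℕ) = c) ∨ s ≤ c := fun c => by
    rcases Nat.lt_or_ge c s with hc | hc
    · exact .inl ⟨⟨c, hc⟩, rfl⟩
    · exact .inr hc
  have hn1 : ∀ c, 1 ≤ n c := fun c => by
    rcases hcases c with ⟨i, rfl⟩ | hc
    · rw [hn, extFin_val]; omega
    · rw [hn, extFin_of_le _ _ hc]
  have hfs : ∀ c, SmallPoly F 1 (n c) (f c) := fun c => by
    rcases hcases c with ⟨i, rfl⟩ | hc
    · rw [hn, hf, extFin_val, extFin_val]
      refine fun ω => ⟨fr_one_conjProd (v := fun i => v i ω) hl hg (ht ω) i, ?_⟩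
      rw [natDegree_conjProd]
      exact Nat.lt_succ_self _
    · rw [hn, hf, extFin_of_le _ _ hc, extFin_of_le _ _ hc]
      exact fun ω => ⟨map_one _, by simp⟩
  have hgs : ∀ c, SmallPoly F 1 (n c) (g c) := fun c => by
    rcases hcases c with ⟨i, rfl⟩ | hc
    · rw [hn, hgdef, extFin_val, extFin_val]
      refine fun ω => ⟨fr_interpNum (v := fun i => v i ω) hl hg (ht ω) (hw ω) i, ?_⟩
      exact (natDegree_conjTrace_lt hl (ht ω i) _).trans (Nat.lt_succ_self _)
    · rw [hn, hgdef, extFin_of_le _ _ hc, extFin_of_le _ _ hc]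
      exact fun ω => ⟨map_zero _, by simp⟩
  have hN1 : ∑ c ∈ Finset.range (2 ^ k), (n c - 1) = t := by
    rw [sum_range_extFin (fun c => n c - 1) hsk fun c hc => by
      simp [hn, extFin_of_le _ _ hc]]
    exact Finset.sum_congr rfl fun i _ => by rw [hn, extFin_val]; omega
  have hN : ∑ c ∈ Finset.range (2 ^ k), n c ≤ 3 * t := by
    have h1 : ∑ c ∈ Finset.range (2 ^ k), n c =
        ∑ c ∈ Finset.range (2 ^ k), (n c - 1) + 2 ^ k := by
      have h0 : ∑ _c ∈ Finset.range (2 ^ k), 1 = 2 ^ k := by simp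
      conv_rhs => enter [2]; rw [← h0]
      rw [← Finset.sum_add_distrib]
      exact Finset.sum_congr rfl fun c _ => by have := hn1 c; omega
    have h3 := pow_clog_le hs
    rw [← hk] at h3
    omega
  have ht1 : 1 ≤ t := hs.trans hst
  have hMN : M (1 * ∑ c ∈ Finset.range (2 ^ k), n c) ≤ 9 * M t := by
    rw [one_mul]
    refine (hM.le_sq_mul (k := 3) ?_ ht1 hN).trans_eq (by norm_num)
    exact (hn1 0).trans (Finset.single_le_sum (f := n) (fun _ _ => Nat.zero_le _)
      (Finset.mem_range.2 (Nat.pow_pos two_pos)))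
  have hfω : ∀ (i : Fin s) ω, f i ω = conjProd F d ℓ (J i) (e i) (v i ω) := fun i ω => by
    rw [hf, extFin_val]
  have hprod : ∀ ω, ∏ c ∈ Finset.range (2 ^ k), f c ω = interpProd F d ℓ J e fun i => v i ω :=
    fun ω => by
      rw [prod_range_extFin (fun c => f c ω) hsk fun c hc => by rw [hf, extFin_of_le _ _ hc]]
      exact Finset.prod_congr rfl fun i _ => hfω i ω
  have hother : ∀ (i : Fin s) ω, ∏ c ∈ (Finset.range (2 ^ k)).erase i, f c ω =
      otherProd F d ℓ J e (fun i => v i ω) i := fun i ω => by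
    refine mul_right_cancel₀ (b := conjProd F d ℓ (J i) (e i) (v i ω)) (conjProd_monic _).ne_zero ?_
    rw [otherProd_mul, ← hprod, ← hfω,
      Finset.prod_erase_mul _ _ (Finset.mem_range.2 (i.2.trans_le hsk))]
  have hfrac : fracNum f g (Finset.range (2 ^ k)) =
      fun ω => interpPoly F d ℓ J e (fun i => v i ω) fun i => w i ω := by
    funext ω
    rw [fracNum, Finset.sum_apply, interpPoly, sum_range_extFin
      (fun c => (g c * ∏ c' ∈ (Finset.range (2 ^ k)).erase c, f c') ω) hsk fun c hc => by
        rw [hgdef, extFin_of_le _ _ hc]; exact zero_mul _]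
    refine Finset.sum_congr rfl fun i _ => ?_
    rw [Pi.mul_apply, Finset.prod_apply, hother, hgdef, extFin_val]
  choose ρ hρ using fun ω => exists_rootSet F (hv ω)
  have hρT : ∀ ω, ∏ r ∈ ρ ω, (X - C r) = interpProd F d ℓ J e fun i => v i ω := fun ω => by
    rw [hρ, interpProd_eq hl hg (ht ω)]
  have hρc : ∀ ω, (ρ ω).card = t := fun ω => by
    rw [← natDegree_finsetProd_X_sub_C_eq_card (ρ ω) fun r => r, hρT, natDegree_interpProd]
  have hρf : ∀ ω, fr F 1 (∏ r ∈ ρ ω, (X - C r)) = ∏ r ∈ ρ ω, (X - C r) := fun ω => by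
    rw [hρT, fr_interpProd hl hg (ht ω)]
  have hφ : ∀ a ω g, fr F a g = g → Fr F a (evalSum (ρ ω) g) = evalSum (ρ ω) g :=
    fun a ω g hg => Fr_evalSum F (hρf ω) a hg
  have c1 := Cost.biUnion (S := ⋃ i ∈ Finset.univ, (KE K.basis (v i) ∪ KE K.basis (w i)))
    Finset.univ (fun i => K.conjSet (J i) (e i) (v i))
    (fun i => (452 * (J i + 1)) * (Nat.clog 2 ℓ * M (ℓ ^ 2 * (ℓ ^ J i * e i)))) fun i _ => (K.cost_conjSet hM (hJ i) (he i)
      (Nat.le_of_dvd K.d_pos (dvd_of_gcd_eq (hg i)))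
      (fun ω => Fr_level (hg i) (ht ω i))).mono (Set.subset_union_left.trans
        (Set.subset_biUnion_of_mem (u := fun i => KE K.basis (v i) ∪ KE K.basis (w i))
          (Finset.mem_univ i))) subset_rfl le_rfl
  set S₀ := ⋃ i ∈ Finset.univ, (KE K.basis (v i) ∪ KE K.basis (w i)) with hS₀
  set S₁ := ⋃ i ∈ Finset.univ, K.conjSet (J i) (e i) (v i) with hS₁
  have c2 : Cost S₁ (treeSet K.basis f k k)
      (k * (10 * M (1 * ∑ c ∈ Finset.range (2 ^ k), n c))) := by
    refine Cost.add_consts ((hL.treeProduct hM hn1 hfs k k le_rfl).mono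
      (Set.iUnion₂_subset fun c _ => ?_) subset_rfl le_rfl)
    rcases hcases c with ⟨i, rfl⟩ | hc
    · rw [hf, extFin_val]
      exact (Set.subset_union_right.trans Set.subset_union_right).trans
        ((Set.subset_biUnion_of_mem (u := fun i => K.conjSet (J i) (e i) (v i))
          (Finset.mem_univ i)).trans Set.subset_union_left)
    · rw [hf, extFin_of_le _ _ hc]
      exact (KP_const (b := K.basis) (1 : E[X])).trans Set.subset_union_right
  have hroot : KP K.basis (fun ω => interpProd F d ℓ J e fun i => v i ω) ⊆
      treeSet K.basis f k k := by
    have := subset_treeSet (b := K.basis) (f := f) (k := k) (i := k) (i' := k) (a := 0) le_rfl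
      (by simp)
    rw [block_root] at this
    refine Set.Subset.trans (Eq.subset ?_) this
    congr 1
    funext ω
    rw [Finset.prod_apply, hprod]
  have c3 : Cost (treeSet K.basis f k k) (KP K.basis fun ω => momentPoly (evalSum (ρ ω)) 1 t)
      (400 * M t) :=
    (hL.powerSums hM ht1 hρc hρf).mono (by simp only [hρT]; exact hroot) subset_rfl le_rfl
  have c4 := hL.treeMoments hM (φ := fun ω => evalSum (ρ ω)) (fun ω g => hφ 1 ω g) hn1 hfs k k le_rfl
  rw [hN1] at c4
  have c4' : Cost (treeSet K.basis f k k ∪ KP K.basis fun ω => momentPoly (evalSum (ρ ω)) 1 t)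
      (⋃ i ∈ Finset.univ, KP K.basis fun ω => momentPoly (evalSum (ρ ω))
        (otherProd F d ℓ J e (fun i => v i ω) i) (τ i))
      (k * (20 * M (1 * ∑ c ∈ Finset.range (2 ^ k), n c))) := by
    refine c4.mono subset_rfl (Set.iUnion₂_subset fun i _ => ?_) le_rfl
    refine Set.Subset.trans (Eq.subset ?_) (Set.subset_biUnion_of_mem (u := fun a => KP K.basis
      fun ω => momentPoly (evalSum (ρ ω)) (∏ c ∈ Finset.range (2 ^ k) \ block (k - k) a, f c ω)
        (∑ c ∈ block (k - k) a, (n c - 1))) (Finset.mem_range.2 (i.2.trans_le hsk)))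
    congr 1
    funext ω
    rw [Nat.sub_self, block_zero, Finset.sdiff_singleton_eq_erase, hother, Finset.sum_singleton,
      hn, extFin_val, Nat.add_sub_cancel]
  set S₂ := ⋃ i ∈ Finset.univ, KP K.basis fun ω => momentPoly (evalSum (ρ ω))
    (otherProd F d ℓ J e (fun i => v i ω) i) (τ i) with hS₂
  have c5 := Cost.biUnion (S := S₁ ∪ S₂ ∪ S₀) Finset.univ
    (fun i => KP K.basis fun ω => interpNum F d ℓ J e (fun i => v i ω) (fun i => w i ω) i)
    (fun i => (532 * (J i + 1)) * (Nat.clog 2 ℓ * M (ℓ ^ 2 * (ℓ ^ J i * e i))))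
    fun i _ => (K.cost_element hM (hg i) (fun ω => ht ω i) (hJ i) (he i) hφ
      (fun ω => fr_otherProd (v := fun i => v i ω) hl hg (ht ω) 1 i)
      (z := fun ω => interpWeight F d ℓ J e (fun i => v i ω) i)
      (fun ω => (evalSum_eq_eval (by rw [interpProd_eq_mul hl (ht ω), hρT])).1)
      (fun ω => interpWeight_ne_zero hl hg (ht ω) (hv ω) i)
      (fun ω => Fr_interpWeight hl hg (ht ω) i)
      (fun ω => Fr_of_mem_adjoin (Fr_degree (ht ω i)) (hw ω i))).mono ?_ subset_rfl le_rfl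
  swap
  · refine Set.union_subset_union (Set.union_subset_union ?_ ?_) ?_
    · exact Set.subset_biUnion_of_mem (u := fun i => K.conjSet (J i) (e i) (v i))
        (Finset.mem_univ i)
    · exact Set.subset_biUnion_of_mem (u := fun i => KP K.basis fun ω =>
        momentPoly (evalSum (ρ ω)) (otherProd F d ℓ J e (fun i => v i ω) i) (τ i))
        (Finset.mem_univ i)
    · exact Set.subset_union_right.trans (Set.subset_biUnion_of_mem
        (u := fun i => KE K.basis (v i) ∪ KE K.basis (w i)) (Finset.mem_univ i))
  have c6 := hL.treeFractions hM hn1 hfs hgs k k le_rfl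
  set S₃ := ⋃ i ∈ Finset.univ, KP K.basis fun ω => interpNum F d ℓ J e (fun i => v i ω)
    (fun i => w i ω) i with hS₃
  have c6' : Cost (treeSet K.basis f k k ∪ S₃)
      (KP K.basis fun ω => interpPoly F d ℓ J e (fun i => v i ω) fun i => w i ω)
      (k * (21 * M (1 * ∑ c ∈ Finset.range (2 ^ k), n c))) := by
    refine Cost.add_consts (c6.mono (Set.union_subset (Set.subset_union_left.trans
      Set.subset_union_left) (Set.iUnion₂_subset fun c _ => ?_)) ?_ le_rfl)
    · rcases hcases c with ⟨i, rfl⟩ | hc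
      · rw [hgdef, extFin_val]
        exact (Set.subset_biUnion_of_mem (u := fun i => KP K.basis fun ω =>
          interpNum F d ℓ J e (fun i => v i ω) (fun i => w i ω) i) (Finset.mem_univ i)).trans
          (Set.subset_union_right.trans Set.subset_union_left)
      · rw [hgdef, extFin_of_le _ _ hc]
        exact (KP_const (b := K.basis) (0 : E[X])).trans Set.subset_union_right
    · rw [Nat.sub_self, pow_zero, Finset.range_one, Finset.set_biUnion_singleton, block_root, hfrac]
  have c12 := c1.trans (c2.mono Set.subset_union_right subset_rfl le_rfl)
  have c34 := c3.comp c4'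
  have c14 := c12.trans (c34.mono (Set.subset_union_right.trans Set.subset_union_right)
    subset_rfl le_rfl)
  have c15 := c14.trans (c5.mono (Set.union_subset (Set.union_subset (by grind) (by grind))
    (by grind)) subset_rfl le_rfl)
  have c16 := c15.trans (c6'.mono (by grind) subset_rfl le_rfl)
  refine c16.mono subset_rfl (Set.union_subset (hroot.trans (by grind)) (by grind)) ?_
  have hk0 : (0 : ℝ) ≤ k := Nat.cast_nonneg k
  have hMt := (hM.pos ht1).le
  have hkM := mul_le_mul_of_nonneg_left hMN hk0
  simp only [mul_assoc, ← Finset.mul_sum]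
  nlinarith

end KummerField

section Loop

variable {F : Type u} [Field F] [Finite F] {Ω : Type v} [Finite Ω] {out : Ω → List F}
  {bound : Ω → ℝ}

/-- A loop that computes the values `T 1, T 2, …` at the cost `a` each, until it finds the
number `ε ω`, which is recognized by the zeros in `T (ε ω)`. -/
theorem Win.of_search {X : Set Ω} {S : Set (Ω → F)} {c a : ℝ} {T : ℕ → Set (Ω → F)} {ε : Ω → ℕ}
    {D : ℕ} (hε : ∀ ω, 1 ≤ ε ω ∧ ε ω ≤ D) (hT : ∀ k, Cost S (T k) a) {P : ℕ → Ω → Prop}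
    (hP : ∀ k ω ω', (∀ f ∈ T k, f ω = 0 ↔ f ω' = 0) → (P k ω ↔ P k ω'))
    (hPε : ∀ k ω, 1 ≤ k → k ≤ ε ω → (P k ω ↔ ε ω = k))
    (h : ∀ e, 1 ≤ e → Win out bound (X ∩ {ω | ε ω = e}) S (c + e * a)) : Win out bound X S c := by
  have key : ∀ n k, k + n = D → Win out bound (X ∩ {ω | k + 1 ≤ ε ω}) S (c + k * a) := by
    intro n
    induction n with
    | zero =>
      intro k hk
      refine Win.of_empty.mono_set (X := ∅) (fun ω hω => ?_) subset_rfl le_rfl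
      have h1 := (hε ω).2
      have h2 : k + 1 ≤ ε ω := hω.2
      omega
    | succ n ih =>
      intro k hk
      refine hT (k + 1) _ _ _ _ _ subset_rfl (Win.of_forall_pattern (Set.toFinite _) (P (k + 1))
        (fun ω ω' hω => propext (hP _ _ _ fun f hf => hω f (.inr hf))) fun p => ?_)
      by_cases hp : p
      · refine (h (k + 1) (by omega)).mono_set ?_ Set.subset_union_left ?_
        · rintro ω ⟨⟨hω, hk⟩, rfl⟩
          exact ⟨hω, (hPε _ _ (by omega) hk).1 hp⟩
        · push_cast; linarith
      · refine (ih (k + 1) (by omega)).mono_set ?_ Set.subset_union_left ?_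
        · rintro ω ⟨⟨hω, hk⟩, rfl⟩
          refine ⟨hω, lt_of_le_of_ne hk fun h => hp ((hPε _ _ (by omega) hk).2 h.symm)⟩
        · push_cast; linarith
  exact (key D 0 (by omega)).mono_set (fun ω hω => ⟨hω, (hε ω).1⟩) subset_rfl (by simp)

theorem Win.of_searches {ι : Type*} (I : Finset ι) {S : Set (Ω → F)} {a : ι → ℝ}
    {T : ι → ℕ → Set (Ω → F)} {ε : ι → Ω → ℕ} {D : ℕ} (hε : ∀ i ω, 1 ≤ ε i ω ∧ ε i ω ≤ D)
    (hT : ∀ i k, Cost S (T i k) (a i)) {P : ι → ℕ → Ω → Prop}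
    (hP : ∀ i k ω ω', (∀ f ∈ T i k, f ω = 0 ↔ f ω' = 0) → (P i k ω ↔ P i k ω'))
    (hPε : ∀ i k ω, 1 ≤ k → k ≤ ε i ω → (P i k ω ↔ ε i ω = k)) : ∀ {X : Set Ω} {c : ℝ},
    (∀ e : ι → ℕ, (∀ i, 1 ≤ e i) →
      Win out bound (X ∩ {ω | ∀ i ∈ I, ε i ω = e i}) S (c + ∑ i ∈ I, e i * a i)) →
    Win out bound X S c := by
  classical
  induction I using Finset.induction_on with
  | empty =>
    intro X c h
    refine (h (fun _ => 1) fun _ => le_rfl).mono_set (fun ω hω => ⟨hω, by simp⟩) subset_rfl (by simp)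
  | insert i I hi ih =>
    intro X c h
    refine Win.of_search (hε i) (hT i) (hP i) (hPε i) fun k hk => ih fun e he => ?_
    refine (h (Function.update e i k) fun j => ?_).mono_set ?_ subset_rfl ?_
    · by_cases hj : j = i
      · subst hj; simpa using hk
      · simpa [hj] using he j
    · rintro ω ⟨⟨hω, hωk⟩, hωI⟩
      refine ⟨hω, fun j hj => ?_⟩
      by_cases hji : j = i
      · subst hji; simpa using hωk
      · rw [Function.update_of_ne hji]
        exact hωI j ((Finset.mem_insert.1 hj).resolve_left hji)
    · have hsum : ∑ j ∈ I, (Function.update e i k j : ℝ) * a j = ∑ j ∈ I, e j * a j :=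
        Finset.sum_congr rfl fun j hj => by
          rw [Function.update_of_ne (ne_of_mem_of_not_mem hj hi)]
      rw [Finset.sum_insert hi, Function.update_self, hsum]
      linarith

end Loop

/-- The levels of a Kummer tower that contain an element of degree `t`. -/
theorem exists_level {d ℓ h t : ℕ} (hd : 1 ≤ d) (hl : ℓ.Prime) (ht : t ∣ d * ℓ ^ h) :
    ∃ J e, J ≤ h ∧ t = ℓ ^ J * e ∧ d.gcd t = e ∧ ∀ j, t ∣ d * ℓ ^ j ↔ J ≤ j := by
  have he : 0 < d.gcd t := Nat.gcd_pos_of_pos_left _ hd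
  obtain ⟨d', t', hco, hd', ht'⟩ := Nat.exists_coprime d t
  have hdvd : ∀ j, t ∣ d * ℓ ^ j ↔ t' ∣ ℓ ^ j := fun j => by
    generalize d.gcd t = g at *
    rw [hd', ht', mul_right_comm, Nat.mul_dvd_mul_iff_right he]
    exact hco.symm.dvd_mul_left
  obtain ⟨J, hJ, hJt⟩ := (Nat.dvd_prime_pow hl).1 ((hdvd h).1 ht)
  refine ⟨J, d.gcd t, hJ, by rw [← hJt]; exact ht', rfl, fun j => ?_⟩
  rw [hdvd, hJt, Nat.pow_dvd_pow_iff_le_right hl.one_lt]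

namespace KummerField

variable {F : Type u} {E : Type*} [Field F] [Finite F] [Field E] [Algebra F E] {ℓ d h : ℕ}
  (K : KummerField F E ℓ d h) {Ω : Type v} {M : ℕ → ℝ} {out : Ω → List F} {bound : Ω → ℝ}

include K

theorem win_interpolation (hM : IsMultiplicationTime F M) {s : ℕ} (hs : 1 ≤ s) {J e : Fin s → ℕ}
    (hJ : ∀ i, J i ≤ h) (hg : ∀ i, d.gcd (ℓ ^ J i * e i) = e i) {v w : Fin s → Ω → E}
    (ht : ∀ ω i, (minpoly F (v i ω)).natDegree = ℓ ^ J i * e i) (he : ∀ i, 1 ≤ e i)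
    (hv : ∀ ω i j, i ≠ j → minpoly F (v i ω) ≠ minpoly F (v j ω))
    (hw : ∀ ω i, w i ω ∈ Algebra.adjoin F {v i ω}) {T L : Ω → F[X]}
    (hT : ∀ ω, (T ω).map (algebraMap F E) = interpProd F d ℓ J e fun i => v i ω)
    (hL : ∀ ω, (L ω).map (algebraMap F E) =
      interpPoly F d ℓ J e (fun i => v i ω) fun i => w i ω)
    (hout : ∀ ω, out ω = _root_.coeffList (∑ i, ℓ ^ J i * e i + 1) (T ω) ++
      _root_.coeffList (∑ i, ℓ ^ J i * e i) (L ω)) {c : ℝ}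
    (hb : ∀ ω, c + (460 * (Nat.clog 2 s + 1) * M (∑ i, ℓ ^ J i * e i) +
        984 * ∑ i, (J i + 1) * (Nat.clog 2 ℓ * M (ℓ ^ 2 * (ℓ ^ J i * e i)))) ≤ bound ω) :
    Win out bound Set.univ (⋃ i ∈ Finset.univ, (KE K.basis (v i) ∪ KE K.basis (w i))) c := by
  have hpos : 0 < d * ℓ ^ h := Nat.mul_pos K.d_pos (K.zero_lt_pow h)
  refine K.cost_interpolation hM hs hJ hg ht he hv hw _ _ _ _ _ subset_rfl ?_
  have hcoeff : ∀ {f : Ω → E[X]} {g : Ω → F[X]}, (∀ ω, (g ω).map (algebraMap F E) = f ω) → ∀ i,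
      (fun ω => (g ω).coeff i) ∈ KP K.basis f := fun {f g} hfg i => by
    refine ⟨(i, ⟨0, hpos⟩), funext fun ω => ?_⟩
    simp only
    rw [← hfg, coeff_map, K.repr_algebraMap_zero]
  set t := ∑ i, ℓ ^ J i * e i
  refine .output ((List.range (t + 1)).map (fun i ω => (T ω).coeff i) ++
    (List.range t).map (fun i ω => (L ω).coeff i)) ?_ ?_ fun ω _ => hb ω
  · intro f hf
    rcases List.mem_append.1 hf with hf | hf
    · obtain ⟨i, -, rfl⟩ := List.mem_map.1 hf
      exact .inr (.inl (hcoeff hT i))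
    · obtain ⟨i, -, rfl⟩ := List.mem_map.1 hf
      exact .inr (.inr (hcoeff hL i))
  · intro ω _
    rw [hout]
    simp [_root_.coeffList, Function.comp_def]

/-- The search for the degrees over the prime field of the bottom parts of the elements `v i`. -/
theorem win_search [Finite Ω] (hM : IsMultiplicationTime F M) {s : ℕ} {J : Fin s → ℕ}
    (hJ : ∀ i, J i ≤ h) {ε : Fin s → Ω → ℕ} (hg : ∀ i ω, d.gcd (ℓ ^ J i * ε i ω) = ε i ω)
    {v : Fin s → Ω → E} (ht : ∀ ω i, (minpoly F (v i ω)).natDegree = ℓ ^ J i * ε i ω)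
    {S : Set (Ω → F)} (hS : ∀ i, KE K.basis (v i) ⊆ S)
    (H : ∀ e : Fin s → ℕ, (∀ i, 1 ≤ e i) → Win out bound {ω | ∀ i, ε i ω = e i} S
      (248 * ∑ i, (J i + 1) * (Nat.clog 2 ℓ * M (ℓ ^ 2 * (ℓ ^ J i * e i))))) :
    Win out bound Set.univ S 0 := by
  have := K.finiteDimensional
  have hl : 1 ≤ ℓ := K.prime.pos
  have hε : ∀ i ω, 1 ≤ ε i ω ∧ ε i ω ≤ d := fun i ω =>
    ⟨one_le_of_natDegree (ht ω i), Nat.le_of_dvd K.d_pos (dvd_of_gcd_eq (hg i ω))⟩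
  have hv : ∀ i ω, Fr F (d * ℓ ^ J i) (v i ω) = v i ω := fun i ω => Fr_level (hg i ω) (ht ω i)
  have c1 := Cost.biUnion (S := S) Finset.univ (fun i => K.chainSet (J i) fun ω => X - C (v i ω))
    (fun i => (242 * (J i + 1)) * (Nat.clog 2 ℓ * M (ℓ ^ 2 * (ℓ ^ J i * 1)))) fun i _ =>
      (K.cost_chainSet_X_sub_C hM (hJ i) le_rfl (hv i)).mono (hS i) subset_rfl le_rfl
  refine c1 _ _ _ _ _ subset_rfl ?_
  set S₁ := ⋃ i ∈ Finset.univ, K.chainSet (J i) fun ω => X - C (v i ω) with hS₁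
  have hT : ∀ (i : Fin s) (k : ℕ), Cost (S ∪ S₁) (KP K.basis
      ((fun ω => fr F k (chainNorm F d ℓ (J i) (X - C (v i ω)))) -
        fun ω => chainNorm F d ℓ (J i) (X - C (v i ω))))
      ((ℓ ^ J i + 1 : ℕ) * d * (2 * d) + (ℓ ^ J i + 1 : ℕ) * d) := fun i k => by
    have hs := K.small_chainNorm (hv i)
    have h1 := K.cost_fr_base hM k hs
    have h2 := (K.frobLevel_base (Ω := Ω) hM).sub
      (f := fun ω => fr F k (chainNorm F d ℓ (J i) (X - C (v i ω)))) (fun ω =>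
      ⟨by rw [← fr_add, add_comm, fr_add, (hs ω).1], by rw [natDegree_fr]; exact (hs ω).2⟩) hs
    refine (h1.comp (h2.mono (Set.union_comm _ _).subset subset_rfl le_rfl)).mono ?_ subset_rfl
      le_rfl
    exact (K.KP_chainNorm_subset (J i) fun ω => X - C (v i ω)).trans
      ((Set.subset_biUnion_of_mem (u := fun i => K.chainSet (J i) fun ω => X - C (v i ω))
        (Finset.mem_univ i)).trans Set.subset_union_right)
  refine Win.of_searches Finset.univ hε hT (P := fun i k ω =>
    fr F k (chainNorm F d ℓ (J i) (X - C (v i ω))) = chainNorm F d ℓ (J i) (X - C (v i ω)))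
    (fun i k ω ω' hω => ?_) (fun i k ω hk1 hk => ?_) fun e he => ?_
  · have key : ∀ ω, fr F k (chainNorm F d ℓ (J i) (X - C (v i ω))) =
        chainNorm F d ℓ (J i) (X - C (v i ω)) ↔ ∀ f ∈ KP K.basis
      ((fun ω => fr F k (chainNorm F d ℓ (J i) (X - C (v i ω)))) -
        fun ω => chainNorm F d ℓ (J i) (X - C (v i ω))), f ω = 0 := fun ω => by
      rw [← sub_eq_zero]
      constructor
      · rintro h0 _ ⟨⟨a, b⟩, rfl⟩
        simp [h0]
      · intro h0
        refine Polynomial.ext fun a => K.basis.repr.injective (Finsupp.ext fun b => ?_)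
        rw [coeff_zero, map_zero]
        exact h0 _ ⟨(a, b), rfl⟩
    rw [key, key]
    exact forall₂_congr hω
  · rw [fr_chainNorm_X_sub_C hl (hg i ω) (ht ω i)]
    exact ⟨fun hd => Nat.le_antisymm (Nat.le_of_dvd (by omega) hd) hk, fun h => h ▸ dvd_rfl⟩
  · refine (H e he).mono_set (fun ω hω i => hω.2 i (Finset.mem_univ i)) Set.subset_union_left ?_
    rw [zero_add, ← Finset.sum_add_distrib, Finset.mul_sum]
    refine Finset.sum_le_sum fun i _ => ?_
    have hlJ := K.zero_lt_pow (J i)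
    have b1 : M (ℓ ^ 2 * (ℓ ^ J i * 1)) ≤ M (ℓ ^ 2 * (ℓ ^ J i * e i)) :=
      hM.mono (Nat.mul_pos (K.zero_lt_pow 2) (Nat.mul_pos hlJ one_pos))
        (Nat.mul_le_mul_left _ (Nat.mul_le_mul_left _ (he i)))
    have b2 := hM.le_self (ℓ ^ 2 * (ℓ ^ J i * e i))
      (Nat.mul_pos (K.zero_lt_pow 2) (Nat.mul_pos hlJ (he i)))
    have b3 : e i * ((ℓ ^ J i + 1) * d * (2 * d) + (ℓ ^ J i + 1) * d) ≤
        6 * (ℓ ^ 2 * (ℓ ^ J i * e i)) := by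
      calc e i * ((ℓ ^ J i + 1) * d * (2 * d) + (ℓ ^ J i + 1) * d)
          ≤ e i * ((2 * ℓ ^ J i) * ℓ * (2 * ℓ) + (2 * ℓ ^ J i) * ℓ * ℓ) := by
            refine Nat.mul_le_mul_left _ (Nat.add_le_add ?_ ?_)
            · exact Nat.mul_le_mul (Nat.mul_le_mul (by omega) K.le) (Nat.mul_le_mul_left _ K.le)
            · exact (Nat.mul_le_mul (by omega) K.le).trans (Nat.le_mul_of_pos_right _ hl)
        _ = 6 * (ℓ ^ 2 * (ℓ ^ J i * e i)) := by ring
    have b4 : ((e i : ℕ) : ℝ) * ((ℓ ^ J i + 1 : ℕ) * d * (2 * d) + (ℓ ^ J i + 1 : ℕ) * d) ≤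
        6 * M (ℓ ^ 2 * (ℓ ^ J i * e i)) := by
      have : ((e i * ((ℓ ^ J i + 1) * d * (2 * d) + (ℓ ^ J i + 1) * d) : ℕ) : ℝ) ≤
        ((6 * (ℓ ^ 2 * (ℓ ^ J i * e i)) : ℕ) : ℝ) := Nat.cast_le.2 b3
      push_cast at this b2 ⊢
      linarith
    have b5 := K.one_le_clog
    have hJ0 : (0 : ℝ) ≤ J i := Nat.cast_nonneg _
    set B := M (ℓ ^ 2 * (ℓ ^ J i * e i))
    have hB : 0 ≤ B := (Nat.cast_nonneg _).trans b2
    have b6 : B ≤ Nat.clog 2 ℓ * B := by simpa using mul_le_mul_of_nonneg_right b5 hB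
    have b7 := mul_le_mul_of_nonneg_left (mul_le_mul_of_nonneg_left b1
      (by linarith : (0 : ℝ) ≤ Nat.clog 2 ℓ)) (by linarith : (0 : ℝ) ≤ 242 * (J i + 1))
    have b8 := mul_nonneg hJ0 (hB.trans b6)
    nlinarith

end KummerField

theorem image_restrict_KE {F : Type*} {E : Type*} [Field F] [Field E] [Algebra F E] {ι Ω : Type*}
    (b : Module.Basis ι F E) (X : Set Ω) (z : Ω → E) :
    KE b (fun ω : X => z ω) = (fun (f : Ω → F) (ω : X) => f ω) '' KE b z :=
  Set.range_comp (fun (f : Ω → F) (ω : X) => f ω) fun j ω => b.repr (z ω) j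

namespace KummerField

variable {F : Type u} {E : Type*} [Field F] [Finite F] [Field E] [Algebra F E] {ℓ d h : ℕ}
  (K : KummerField F E ℓ d h) {M : ℕ → ℝ}

include K in
theorem sum_level_le (hM : IsMultiplicationTime F M) {s : ℕ} (hs : 1 ≤ s) {J e : Fin s → ℕ}
    (hJ : ∀ i, J i ≤ h) (he : ∀ i, 1 ≤ e i) :
    ∑ i, ((J i : ℝ) + 1) * (Nat.clog 2 ℓ * M (ℓ ^ 2 * (ℓ ^ J i * e i))) ≤
      (h + 1) * (Nat.clog 2 ℓ * M (ℓ ^ 2 * ∑ i, ℓ ^ J i * e i)) := by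
  have hpos : ∀ i, 1 ≤ ℓ ^ 2 * (ℓ ^ J i * e i) := fun i =>
    Nat.mul_pos (pow_pos K.prime.pos 2) (Nat.mul_pos (pow_pos K.prime.pos _) (he i))
  have h1 : ∑ i, M (ℓ ^ 2 * (ℓ ^ J i * e i)) ≤ M (ℓ ^ 2 * ∑ i, ℓ ^ J i * e i) :=
    hM.sum_le _ ⟨⟨0, hs⟩, Finset.mem_univ _⟩ (fun i _ => hpos i) (by rw [Finset.mul_sum])
  calc ∑ i, ((J i : ℝ) + 1) * (Nat.clog 2 ℓ * M (ℓ ^ 2 * (ℓ ^ J i * e i)))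
      ≤ ∑ i, ((h : ℝ) + 1) * (Nat.clog 2 ℓ * M (ℓ ^ 2 * (ℓ ^ J i * e i))) := by
        refine Finset.sum_le_sum fun i _ => mul_le_mul_of_nonneg_right ?_
          (mul_nonneg (Nat.cast_nonneg _) (hM.pos (hpos i)).le)
        have : (J i : ℝ) ≤ h := Nat.cast_le.2 (hJ i)
        linarith
    _ = (h + 1) * (Nat.clog 2 ℓ * ∑ i, M (ℓ ^ 2 * (ℓ ^ J i * e i))) := by
        rw [Finset.mul_sum, Finset.mul_sum]
    _ ≤ _ := by
        refine mul_le_mul_of_nonneg_left (mul_le_mul_of_nonneg_left h1 (Nat.cast_nonneg _)) ?_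
        positivity

/-- Interpolation at the conjugates of elements of the top of a Kummer tower. -/
theorem exists_program (hM : IsMultiplicationTime F M) {s : ℕ} (hs : 1 ≤ s) :
    ∃ P : Program F ((Fin s × Fin (d * ℓ ^ h)) ⊕ (Fin s × Fin (d * ℓ ^ h))), ∀ v w : Fin s → E,
      (∀ i j, i ≠ j → minpoly F (v i) ≠ minpoly F (v j)) →
      (∀ i, w i ∈ Algebra.adjoin F {v i}) →
      ∃ (T L : F[X]) (k : ℕ), T.Monic ∧ T.natDegree = ∑ i, (minpoly F (v i)).natDegree ∧
        (∀ i, aeval (v i) T = 0) ∧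
        L.degree < ((∑ i, (minpoly F (v i)).natDegree : ℕ) : WithBot ℕ) ∧
        (∀ i, aeval (v i) L = w i) ∧
        P.Runs (Sum.elim (fun x => K.basis.repr (v x.1) x.2) fun x => K.basis.repr (w x.1) x.2)
          (_root_.coeffList (∑ i, (minpoly F (v i)).natDegree + 1) T ++
            _root_.coeffList (∑ i, (minpoly F (v i)).natDegree) L) k ∧
        (k : ℝ) ≤ 460 * (Nat.clog 2 s + 1) * M (∑ i, (minpoly F (v i)).natDegree) +
          1232 * ((h + 1) *
            (Nat.clog 2 ℓ * M (ℓ ^ 2 * ∑ i, (minpoly F (v i)).natDegree))) := by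
  have := K.finiteDimensional
  have := Module.finite_of_finite F (M := E)
  have hl : 1 ≤ ℓ := K.prime.pos
  let Ω := {p : (Fin s → E) × (Fin s → E) //
    (∀ i j, i ≠ j → minpoly F (p.1 i) ≠ minpoly F (p.1 j)) ∧
      ∀ i, p.2 i ∈ Algebra.adjoin F {p.1 i}}
  let v : Fin s → Ω → E := fun i ω => ω.1.1 i
  let w : Fin s → Ω → E := fun i ω => ω.1.2 i
  have hdvd : ∀ z : E, (minpoly F z).natDegree ∣ d * ℓ ^ h := fun z => by
    rw [← Fr_eq_self_iff, K.Fr_eq_self_iff_repr le_rfl]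
    intro i hi
    simp at hi
  choose J e hJ hτ hg hlev using fun (ω : Ω) i => exists_level K.d_pos K.prime (hdvd (v i ω))
  have hg' : ∀ ω i, d.gcd (ℓ ^ J ω i * e ω i) = e ω i := fun ω i => by rw [← hτ, hg]
  have hv : ∀ (ω : Ω) i j, i ≠ j → minpoly F (v i ω) ≠ minpoly F (v j ω) := fun ω => ω.2.1
  have hw : ∀ (ω : Ω) i, w i ω ∈ Algebra.adjoin F {v i ω} := fun ω => ω.2.2
  choose T hT using fun ω => exists_map_of_fr_one (fr_interpProd (v := fun i => v i ω) hl (hg' ω)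
    (hτ ω))
  choose L hL using fun ω => exists_map_of_fr_one (fr_interpPoly (v := fun i => v i ω)
    (w := fun i => w i ω) hl (hg' ω) (hτ ω) (hw ω))
  let t : Ω → ℕ := fun ω => ∑ i, (minpoly F (v i ω)).natDegree
  let out : Ω → List F := fun ω =>
    _root_.coeffList (t ω + 1) (T ω) ++ _root_.coeffList (t ω) (L ω)
  let bound : Ω → ℝ := fun ω => 460 * (Nat.clog 2 s + 1) * M (t ω) +
    1232 * ((h + 1) * (Nat.clog 2 ℓ * M (ℓ ^ 2 * t ω)))
  have ht : ∀ ω, t ω = ∑ i, ℓ ^ J ω i * e ω i := fun ω => Finset.sum_congr rfl fun i _ => hτ ω i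
  have hwin : Win out bound Set.univ
      (⋃ i ∈ Finset.univ, (KE K.basis (v i) ∪ KE K.basis (w i))) 0 := by
    refine Win.of_forall_pattern (Set.toFinite _) J (fun ω ω' hω => ?_) fun J₀ => ?_
    · have key : ∀ i, J ω i ≤ J ω' i ∧ J ω' i ≤ J ω i := fun i => by
        have h1 : ∀ j ≤ h, J ω i ≤ j ↔ J ω' i ≤ j := fun j hj => by
          rw [← hlev, ← hlev, ← Fr_eq_self_iff, ← Fr_eq_self_iff, K.Fr_eq_self_iff_repr hj,
            K.Fr_eq_self_iff_repr hj]
          refine forall₂_congr fun a _ => hω (fun ω => K.basis.repr (v i ω) a) ?_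
          simp only [Set.mem_iUnion]
          exact ⟨i, Finset.mem_univ i, .inl ⟨a, rfl⟩⟩
        exact ⟨(h1 _ (hJ ω' i)).2 le_rfl, (h1 _ (hJ ω i)).1 le_rfl⟩
      exact funext fun i => Nat.le_antisymm (key i).1 (key i).2
    · refine Win.of_subtype ?_
      set X := Set.univ ∩ {ω | J ω = J₀}
      by_cases hX : Nonempty X
      swap
      · rw [not_nonempty_iff] at hX
        rw [Set.univ_eq_empty_iff.2 hX]
        exact .of_empty
      obtain ⟨ω₀⟩ := hX
      have hJX : ∀ ω : X, J ω = J₀ := fun ω => ω.2.2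
      have hJ₀ : ∀ i, J₀ i ≤ h := fun i => by rw [← hJX ω₀]; exact hJ _ i
      refine K.win_search hM hJ₀ (ε := fun i (ω : X) => e ω i) (v := fun i (ω : X) => v i ω)
        (fun i (ω : X) => by rw [← hJX ω]; exact hg' _ i) (fun (ω : X) i => by rw [← hJX ω]; exact hτ _ i)
        (fun i => ?_) fun e₀ he₀ => Win.of_subtype ?_
      · rw [image_restrict_KE]
        refine Set.image_mono (Set.subset_union_left.trans (Set.subset_biUnion_of_mem
          (u := fun i => KE K.basis (v i) ∪ KE K.basis (w i)) (Finset.mem_univ i)))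
      set Y := {ω : X | ∀ i, e ω i = e₀ i}
      by_cases hY : Nonempty Y
      swap
      · rw [not_nonempty_iff] at hY
        rw [Set.univ_eq_empty_iff.2 hY]
        exact .of_empty
      obtain ⟨ω₁⟩ := hY
      have heY : ∀ ω : Y, e ω.1 = e₀ := fun ω => funext ω.2
      have hJY : ∀ ω : Y, J ω.1 = J₀ := fun ω => hJX ω.1
      have htY : ∀ ω : Y, t ω.1 = ∑ i, ℓ ^ J₀ i * e₀ i := fun ω => by rw [ht, heY, hJY]
      refine (K.win_interpolation hM hs hJ₀ (e := e₀) (v := fun i (ω : Y) => v i ω.1)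
        (w := fun i (ω : Y) => w i ω.1) (T := fun (ω : Y) => T ω.1) (L := fun (ω : Y) => L ω.1)
        (fun i => by rw [← hJX ω₁, ← heY ω₁]; exact hg' _ i)
        (fun ω i => by rw [← hJY ω, ← heY ω]; exact hτ _ i) he₀ (fun ω => hv _) (fun ω => hw _)
        (fun ω => by rw [hT, hJY, heY]) (fun ω => by rw [hL, hJY, heY]) (fun ω => ?_)
        fun ω => ?_).mono_set subset_rfl ?_ le_rfl
      · rw [← htY ω]
      · have hb : bound ω.1 = 460 * (Nat.clog 2 s + 1) * M (∑ i, ℓ ^ J₀ i * e₀ i) +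
            1232 * ((h + 1) * (Nat.clog 2 ℓ * M (ℓ ^ 2 * ∑ i, ℓ ^ J₀ i * e₀ i))) := by
          simp only [bound, htY]
        rw [hb]
        have := K.sum_level_le hM hs hJ₀ he₀
        linarith
      · refine Set.iUnion₂_subset fun i _ => ?_
        have h1 := image_restrict_KE K.basis Y fun ω : X => v i ω
        have h2 := image_restrict_KE K.basis Y fun ω : X => w i ω
        rw [h1, h2, image_restrict_KE, image_restrict_KE, ← Set.image_union, ← Set.image_union]
        exact Set.image_mono (Set.image_mono (Set.subset_biUnion_of_mem
          (u := fun i => KE K.basis (v i) ∪ KE K.basis (w i)) (Finset.mem_univ i)))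
  obtain ⟨P, hP⟩ := hwin.exists_program (V := (Fin s × Fin (d * ℓ ^ h)) ⊕ (Fin s × Fin (d * ℓ ^ h)))
    (Sum.elim (fun x ω => K.basis.repr (v x.1 ω) x.2) fun x ω => K.basis.repr (w x.1 ω) x.2)
    fun f hf => by
      simp only [Set.mem_iUnion] at hf
      obtain ⟨i, -, ⟨a, rfl⟩ | ⟨a, rfl⟩⟩ := hf
      · exact ⟨.inl (i, a), fun _ _ => rfl⟩
      · exact ⟨.inr (i, a), fun _ _ => rfl⟩
  refine ⟨P, fun v' w' hv' hw' => ?_⟩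
  let ω : Ω := ⟨(v', w'), hv', hw'⟩
  obtain ⟨k, hk, hkb⟩ := hP ω (Set.mem_univ _)
  have hmon : (T ω).Monic := by
    refine monic_of_injective (algebraMap F E).injective ?_
    rw [hT]
    exact monic_prod_of_monic _ _ fun i _ => conjProd_monic _
  refine ⟨T ω, L ω, k, hmon, ?_, fun i => ?_, ?_, fun i => ?_, ?_, by simpa using hkb⟩
  · rw [← natDegree_map (algebraMap F E), hT, natDegree_interpProd]
    exact (ht ω).symm
  · rw [← eval_map_algebraMap, hT, interpProd_eq hl (hg' ω) (hτ ω), eval_prod]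
    refine Finset.prod_eq_zero (Finset.mem_univ i) ?_
    rw [eval_map_algebraMap]
    exact minpoly.aeval F _
  · rw [← degree_map (L ω) (algebraMap F E), hL]
    have := degree_interpPoly_lt (d := d) (w := fun i => w i ω) hl (hτ ω)
    rw [← ht ω] at this
    exact this
  · rw [← eval_map_algebraMap, hL]
    exact eval_interpPoly (v := fun i => v i ω) (w := fun i => w i ω) hl (hg' ω) (hτ ω) (hv ω) i
  · convert hk using 1
    funext x
    rcases x with x | x <;> rfl

end KummerField

open IntermediateField in
theorem X_pow_two_pow_sub_C_irreducible (n : ℕ) {K : Type u} [Field K] {a : K}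
    (hsq : IsSquare (-1 : K)) (ha : ∀ b : K, b ^ 2 ≠ a) : Irreducible (X ^ 2 ^ n - C a) := by
  induction n generalizing K a with
  | zero => simpa using irreducible_X_sub_C a
  | succ n ih =>
    rw [pow_succ]
    refine X_pow_mul_sub_C_irreducible (X_pow_sub_C_irreducible_of_prime Nat.prime_two ha)
      fun E _ _ x hx => ?_
    have hint : IsIntegral K x := not_not.mp fun h => by
      simpa only [degree_zero, degree_X_pow_sub_C two_pos, WithBot.natCast_ne_bot] using
        congr_arg degree (hx.symm.trans (dif_neg h))
    refine ih ?_ fun b hb => ?_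
    · simpa using hsq.map (algebraMap K K⟮x⟯)
    · obtain ⟨i, hi⟩ := hsq
      have h1 : (Algebra.norm K b) ^ 2 = -a := by
        rw [← map_pow, hb, ← adjoin.powerBasis_gen hint,
          Algebra.PowerBasis.norm_gen_eq_coeff_zero_minpoly]
        simp [minpoly_gen, hx, adjoin.powerBasis_dim]
      refine ha (i * Algebra.norm K b) ?_
      rw [mul_pow, h1, sq, ← hi]
      ring

open IntermediateField in
theorem irreducible_expand_of_not_pow {F : Type u} [Field F] {p : F[X]} {ℓ : ℕ} (hp : p.Monic)
    (hirr : Irreducible p) (hl : ℓ.Prime)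
    (hpow : ¬ ∃ y : AdjoinRoot p, y ^ ℓ = AdjoinRoot.root p)
    (hsq : ℓ = 2 → IsSquare (-1 : AdjoinRoot p)) (h : ℕ) : Irreducible (expand F (ℓ ^ h) p) := by
  rw [expand_eq_comp_X_pow]
  refine irreducible_comp hp (monic_X_pow _) hirr fun E _ _ x hx => ?_
  subst hx
  have hint : IsIntegral F x := by
    by_contra hc
    rw [minpoly.eq_zero hc] at hirr
    exact hirr.ne_zero rfl
  let φ := adjoinRootEquivAdjoin F hint
  have hpow' : ∀ b : F⟮x⟯, b ^ ℓ ≠ AdjoinSimple.gen F x := fun b hb =>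
    hpow ⟨φ.symm b, by
      rw [← map_pow, hb, ← adjoinRootEquivAdjoin_apply_root F hint]
      exact φ.symm_apply_apply _⟩
  rw [Polynomial.map_pow, map_X]
  rcases eq_or_ne ℓ 2 with rfl | h2
  · refine X_pow_two_pow_sub_C_irreducible h ?_ hpow'
    simpa using (hsq rfl).map φ
  · exact X_pow_sub_C_irreducible_of_prime_pow hl h2 h hpow'

/-- The top of a Kummer tower, presented as a quotient of the polynomial ring. -/
noncomputable def KummerField.adjoinRoot {F : Type u} [Field F] [Finite F] {ℓ h : ℕ} {p g : F[X]}
    [Fact (Irreducible g)] (hp : p.Monic) (hg : g.Monic) (hgp : g = expand F (ℓ ^ h) p)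
    (e : g.natDegree = p.natDegree * ℓ ^ h) (hl : ℓ.Prime) (hle : p.natDegree ≤ ℓ)
    (hdvd : 0 < h → ℓ ∣ Nat.card F ^ p.natDegree - 1) :
    KummerField F (AdjoinRoot g) ℓ p.natDegree h where
  poly := p
  monic := hp
  natDegree := rfl
  irreducible := hgp ▸ Fact.out
  prime := hl
  le := hle
  dvd := hdvd
  gen := AdjoinRoot.root g
  root := by rw [← hgp, AdjoinRoot.aeval_eq, AdjoinRoot.mk_self]
  basis := (AdjoinRoot.powerBasisAux' hg).reindex (finCongr e)
  basis_apply i := by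
    rw [Module.Basis.reindex_apply]
    exact (AdjoinRoot.powerBasis' hg).basis_eq_pow _

theorem FiniteField.isSquare_neg_one_of_card_mod_four {E : Type*} [Field E] [Finite E]
    (h : Nat.card E % 4 = 1) : IsSquare (-1 : E) := by
  have := Fintype.ofFinite E
  rw [FiniteField.isSquare_neg_one_iff, ← Nat.card_eq_fintype_card, h]
  decide

namespace KummerTower

variable {F : Type u} [Field F] {ℓ : ℕ} (K : KummerTower F ℓ)

theorem isSquare_neg_one [Finite F] (hl : ℓ = 2) : IsSquare (-1 : AdjoinRoot K.poly) := by
  have := Fact.mk K.irreducible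
  have := K.monic.finite_adjoinRoot
  have := Module.finite_of_finite F (M := AdjoinRoot K.poly)
  refine FiniteField.isSquare_neg_one_of_card_mod_four ?_
  rw [Module.natCard_eq_pow_finrank (K := F), (AdjoinRoot.powerBasis' K.monic).finrank,
    AdjoinRoot.powerBasis'_dim, Nat.pow_mod]
  rcases K.shape with ⟨-, -, -, h⟩ | ⟨-, -, h, h'⟩
  · simp [h hl]
  · simp [h, h']

theorem irreducible_modulus [Finite F] (n : ℕ) : Irreducible (K.modulus n) := by
  unfold modulus
  split_ifs
  · exact irreducible_X
  · exact irreducible_expand_of_not_pow K.monic K.irreducible K.prime K.not_pow K.isSquare_neg_one _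

theorem natDegree_poly_le : K.poly.natDegree ≤ ℓ := by
  rcases K.shape with ⟨-, h, -⟩ | ⟨-, rfl, -, h⟩
  · exact (Nat.le_of_dvd (Nat.sub_pos_of_lt K.prime.one_lt) h).trans (Nat.sub_le _ _)
  · exact h.le

theorem dvd_card_pow_sub_one : ℓ ∣ Nat.card F ^ K.poly.natDegree - 1 := by
  rcases K.shape with ⟨-, -, h, -⟩ | ⟨-, rfl, h, h'⟩
  · exact h
  · have : Nat.card F ^ K.poly.natDegree % 4 = 1 := by simp [h', Nat.pow_mod, h]
    omega

/-- A level of a Kummer tower is the top of a Kummer tower with the same coordinates. -/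
theorem exists_kummerField [Finite F] {n : ℕ} (hn : 1 ≤ n) [Fact (Irreducible (K.modulus n))] :
    ∃ (d h : ℕ) (E : KummerField F (K.Level n) ℓ d h) (e : K.levelDegree n = d * ℓ ^ h),
      h + 1 ≤ n ∧ ∀ v j, K.coords n v j = E.basis.repr v (Fin.cast e j) := by
  by_cases h : n < K.firstLevel
  · have hX : K.modulus n = X := by simp [modulus, h]
    have e : (K.modulus n).natDegree = (X : F[X]).natDegree * ℓ ^ 0 := by simp [hX]
    refine ⟨_, 0, .adjoinRoot (p := X) monic_X (K.monic_modulus n) (by simpa using hX) e K.prime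
      (by simpa using K.prime.one_lt.le) (by simp), e, by omega, fun v j => ?_⟩
    simp only [KummerField.adjoinRoot, Module.Basis.repr_reindex_apply]
    rfl
  · have hm : K.modulus n = expand F (ℓ ^ (n - K.firstLevel)) K.poly := by simp [modulus, h]
    have e : (K.modulus n).natDegree = K.poly.natDegree * ℓ ^ (n - K.firstLevel) := by
      rw [hm, natDegree_expand]
    refine ⟨_, n - K.firstLevel, .adjoinRoot K.monic (K.monic_modulus n) hm e K.prime
      K.natDegree_poly_le fun _ => K.dvd_card_pow_sub_one, e, ?_, fun v j => ?_⟩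
    · have : 1 ≤ K.firstLevel := by rcases K.shape with ⟨h, -⟩ | ⟨h, -⟩ <;> omega
      omega
    · simp only [KummerField.adjoinRoot, Module.Basis.repr_reindex_apply]
      rfl

end KummerTower

theorem Nat.clog_two_le_log_div {s : ℕ} (hs : 1 ≤ s) :
    (Nat.clog 2 s : ℝ) ≤ Real.log s / Real.log 2 + 1 := by
  rcases hs.eq_or_lt with rfl | hs
  · simp
  · have h1 : 2 ^ (Nat.clog 2 s - 1) < s := Nat.pow_pred_clog_lt_self one_lt_two hs
    have h2 : Nat.clog 2 s ≠ 0 := (Nat.clog_pos one_lt_two hs).ne'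
    have h3 : (2 : ℝ) ^ (Nat.clog 2 s - 1) ≤ s := by exact_mod_cast h1.le
    have h4 := Real.log_le_log (by positivity) h3
    rw [Real.log_pow, Nat.cast_pred (Nat.pos_of_ne_zero h2)] at h4
    rw [← sub_le_iff_le_add, le_div_iff₀ (Real.log_pos one_lt_two)]
    exact h4

/-- The explicit operation count is of the order of the stated one. -/
theorem IsMultiplicationTime.count_le {F : Type*} [Field F] {M : ℕ → ℝ}
    (hM : IsMultiplicationTime F M) {ℓ n h s t : ℕ} (hl : 2 ≤ ℓ) (hn : h + 1 ≤ n) (hs : 1 ≤ s)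
    (ht : 1 ≤ t) :
    460 * ((Nat.clog 2 s : ℝ) + 1) * M t + 1232 * ((h + 1) * (Nat.clog 2 ℓ * M (ℓ ^ 2 * t))) ≤
      10000 * (M t * Real.log s + n * M (ℓ ^ 2 * t) * Real.log ℓ) := by
  have hlog : 1 / 2 < Real.log 2 := by linarith [Real.log_two_gt_d9]
  have hlog' : 0 < Real.log 2 := by linarith
  have hls : 0 ≤ Real.log s := Real.log_natCast_nonneg s
  have hll : Real.log 2 ≤ Real.log ℓ := Real.log_le_log two_pos (by exact_mod_cast hl)
  have hd : ∀ x : ℝ, 0 ≤ x → x / Real.log 2 ≤ 2 * x := fun x hx => by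
    rw [div_le_iff₀ hlog']
    nlinarith
  have h1 : (Nat.clog 2 s : ℝ) + 1 ≤ 2 * Real.log s + 2 := by
    linarith [Nat.clog_two_le_log_div hs, hd _ hls]
  have h2 : (Nat.clog 2 ℓ : ℝ) ≤ 4 * Real.log ℓ := by
    linarith [Nat.clog_two_le_log_div (one_le_two.trans hl), hd (Real.log ℓ) (by linarith)]
  have hMt : 0 < M t := hM.pos ht
  have hmono : M t ≤ M (ℓ ^ 2 * t) := hM.mono ht (Nat.le_mul_of_pos_left _ (by positivity))
  have hn' : (h : ℝ) + 1 ≤ n := by exact_mod_cast hn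
  have hn1 : (1 : ℝ) ≤ n := by exact_mod_cast (Nat.le_add_left 1 h).trans hn
  have hB : 0 < M (ℓ ^ 2 * t) := hMt.trans_le hmono
  have e1 : ((Nat.clog 2 s : ℝ) + 1) * M t ≤ (2 * Real.log s + 2) * M t :=
    mul_le_mul_of_nonneg_right h1 hMt.le
  have e2 : ((h : ℝ) + 1) * (Nat.clog 2 ℓ * M (ℓ ^ 2 * t)) ≤
      n * (4 * Real.log ℓ * M (ℓ ^ 2 * t)) := by gcongr
  have e3 : M (ℓ ^ 2 * t) * (1 / 2) ≤ n * M (ℓ ^ 2 * t) * Real.log ℓ := by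
    refine mul_le_mul (le_mul_of_one_le_left hB.le hn1) (by linarith) (by norm_num) (by positivity)
  have e4 : 0 ≤ M t * Real.log s := by positivity
  nlinarith

end

theorem mainTheorem11 :
    ∃ C : ℝ, 0 < C ∧
      ∀ (F : Type u) [Field F] [Finite F] (_ : ringChar F ≠ 2)
        (M : ℕ → ℝ) (_ : IsMultiplicationTime F M)
        (ℓ : ℕ) (K : KummerTower F ℓ) (n s : ℕ) (_ : 1 ≤ n) (_ : 1 ≤ s),
      ∃ P : Program F ((Fin s × Fin (K.levelDegree n)) ⊕ (Fin s × Fin (K.levelDegree n))),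
        ∀ v w : Fin s → K.Level n,
          (∀ i j : Fin s, i ≠ j → minpoly F (v i) ≠ minpoly F (v j)) →
          (∀ i : Fin s, w i ∈ Algebra.adjoin F {v i}) →
          ∃ (T L : Polynomial F) (k : ℕ),
            T.Monic ∧ T.natDegree = totalDegree K n s v ∧
            (∀ i : Fin s, Polynomial.aeval (v i) T = 0) ∧
            L.degree < totalDegree K n s v ∧
            (∀ i : Fin s, Polynomial.aeval (v i) L = w i) ∧
            P.Runs (interpolationInput K n s v w)
              (coeffList (totalDegree K n s v + 1) T ++ coeffList (totalDegree K n s v) L) k ∧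
            (k : ℝ) ≤ C * (M (totalDegree K n s v) * Real.log s +
              n * M (ℓ ^ 2 * totalDegree K n s v) * Real.log ℓ) := by
  refine ⟨10000, by norm_num, fun F _ _ _ M hM ℓ K n s hn hs => ?_⟩
  have := Fact.mk (K.irreducible_modulus n)
  obtain ⟨d, h, E, e, hh, hcoords⟩ := K.exists_kummerField hn
  obtain ⟨P, hP⟩ := E.exists_program hM hs
  have key : ∀ (N : ℕ) (e : N = d * ℓ ^ h),
      ∃ P : Program F ((Fin s × Fin N) ⊕ (Fin s × Fin N)), ∀ v w : Fin s → K.Level n,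
        (∀ i j : Fin s, i ≠ j → minpoly F (v i) ≠ minpoly F (v j)) →
        (∀ i : Fin s, w i ∈ Algebra.adjoin F {v i}) →
        ∃ (T L : Polynomial F) (k : ℕ),
          T.Monic ∧ T.natDegree = totalDegree K n s v ∧
          (∀ i : Fin s, Polynomial.aeval (v i) T = 0) ∧
          L.degree < totalDegree K n s v ∧
          (∀ i : Fin s, Polynomial.aeval (v i) L = w i) ∧
          P.Runs (Sum.elim (fun x => E.basis.repr (v x.1) (Fin.cast e x.2))
              fun x => E.basis.repr (w x.1) (Fin.cast e x.2))
            (coeffList (totalDegree K n s v + 1) T ++ coeffList (totalDegree K n s v) L) k ∧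
          (k : ℝ) ≤ 460 * (Nat.clog 2 s + 1) * M (totalDegree K n s v) +
            1232 * ((h + 1) * (Nat.clog 2 ℓ * M (ℓ ^ 2 * totalDegree K n s v))) := by
    rintro N rfl
    exact ⟨P, hP⟩
  obtain ⟨Q, hQ⟩ := key _ e
  refine ⟨Q, fun v w hv hw => ?_⟩
  obtain ⟨T, L, k, h1, h2, h3, h4, h5, h6, h7⟩ := hQ v w hv hw
  have hE := E.finiteDimensional
  have ht : 1 ≤ totalDegree K n s v :=
    (minpoly.natDegree_pos (Algebra.IsIntegral.isIntegral (v ⟨0, hs⟩))).trans_le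
      (Finset.single_le_sum (f := fun i => (minpoly F (v i)).natDegree) (fun _ _ => Nat.zero_le _)
        (Finset.mem_univ _))
  refine ⟨T, L, k, h1, h2, h3, h4, h5, ?_, h7.trans (hM.count_le K.prime.two_le hh hs ht)⟩
  simp only [interpolationInput, hcoords]
  exact h6
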